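/- Let $d\ge 2$ and $n=d-1$. Let $X=\mathrm{SL}_d(\mathbb R)/\mathrm{SL}_d(\mathbb Z)$ be the space of unimodular lattices in $\mathbb R^d$, let $A<\mathrm{SL}_d(\mathbb R)$ be the group of diagonal matrices with positive diagonal entries, and use the supremum norm on $\mathbb R^d$ (and its operator norm on matrices). For $x\in X$ put $\ell(x)=\min\{\|v\|:0\ne v\in x\}$ and $X^{\ge\delta}=\{x\in X:\ell(x)\ge\delta\}$. Let $\Omega=\{x\in X: Ax\text{ is compact}\}$. Let $\mathbb R^d_0=\{\mathbf t\in\mathbb R^d:\sum_i t_i=0\}$, $a(\mathbf t)=\mathrm{diag}(e^{t_1},\dots,e^{t_d})$ and $\lceil\mathbf t\rceil=\max_i t_i$. For $x\in\Omega$ let $\Delta_x\subset\mathbb R^d_0$ be the lattice of all vectors $(\log|c_1|,\dots,\log|c_d|)$, where $\mathrm{diag}(c_1,\dots,c_d)$ runs over the diagonal matrices of determinant $\pm1$ that map $x$ to itself; $|\Delta|$ denotes the covolume of a lattice $\Delta\subset\mathbb R^d_0$. A simplex set is a set $\Phi\subset\mathbb R^d_0$ of $d$ vectors that spans $\mathbb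 R^d_0$ and has sum $0$; put $\Delta_\Phi=\mathrm{span}_{\mathbb Z}\Phi$ and $\xi_\Phi=\max_{\mathbf t\in\Phi}\lceil\mathbf t\rceil$. Let $\Phi_*=\{\mathbf b_1,\dots,\mathbf b_d\}$, where $\mathbf b_j$ has $j$-th coordinate $-n$ and all other coordinates $1$. A distortion map of $\Phi$ is a linear automorphism $h_\Phi$ of $\mathbb R^d_0$ with $h_\Phi\Phi_*=|\Delta_\Phi|^{-1/n}\Phi$. For a permutation $\tau$ of $\{1,\dots,d\}$ put $\mathbf w_\tau=|\Delta_\Phi|^{1/n}h_\Phi\big(d^{-1}\sum_{\ell=1}^d(\ell-1)\mathbf b_{\tau(\ell)}\big)$ (another choice of $h_\Phi$ only permutes the indices $\tau$). A simplex set $\Phi$ is $M$-tight for $x\in\Omega$ if $\Phi\subset\Delta_x$ and $\ell(x)\le Me^{-\frac n2\xi_\Phi}$. Let $\Omega_M$ be the set of $x\in\Omega$ that have an $M$-tight simplex set. Let $\Omega_M(\epsilon,C)$ be the set of $x\in\Omega_M$ that have an $M$-tight simplex set $\Phi$ such that for every permutation $\tau$ $$a(\mathbf w_\tau)x=g_\tau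 a(\mathbf s_\tau)\mathbb Z^d\quad\text{with } g_\tau\in\mathrm{SL}_d(\mathbb R),\ \|g_\tau-I\|\le Ce^{-|\Delta_x|^\epsilon},\ \mathbf s_\tau\in\mathbb R^d_0.\qquad(*)$$ For a compact subset $K$ of the space of lattices in $\mathbb R^d_0$ up to homothety (the space of shapes), let $\Omega_{M,K}$ be the set of $x\in\Omega_M$ that have an $M$-tight simplex set $\Phi$ such that the shape of $\Delta_\Phi$ is in $K$. Fix $M,C\ge1$, $\epsilon>0$ and a compact set of shapes $K$. Then the following hold. 1. For every sequence $x_k\in\Omega_M$ with distinct orbits $Ax_k$, each $Ax_k$ supports a unique $A$-invariant probability measure $\mu_{Ax_k}$, and the measures $\mu_{Ax_k}$ converge to the zero measure (that is, $\int f\,d\mu_{Ax_k}\to0$ for every continuous compactly supported $f:X\to\mathbb R$). 2. For every sequence $x_k\in\Omega_M(\epsilon,C)$ with distinct orbits $Ax_k$ and all $a_k\in A$, every limit point of the sequence $a_kx_k$ in $X$ lies in $A\mathbb Z^d$. 3. Let $x_k\in\Omega_M(\epsilon,C)\cap\Omega_{M,K}$ be a sequence with distinct orbits $Ax_k$, and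 let $\Phi_k$ be $M$-tight simplex sets for $x_k$ satisfying $(*)$ with times $\mathbf s_\tau=\mathbf s_\tau(k)$ that are bounded uniformly in $k$ and $\tau$. Then for every $\delta_1\in(0,1)$ and all large $k$: (i) $\Phi_k$ generates $\Delta_{x_k}$, that is, $\Delta_{\Phi_k}=\Delta_{x_k}$; and (ii) $Ax_k\cap X^{\ge\delta_1}$ has at least $n!$ connected components. -/

import Mathlib

open Filter Topology MeasureTheory

noncomputable section

namespace EscapeOfMass

/-! Throughout `d = n + 1`, and `Fin (n + 1) → ℝ` carries the supremum norm. -/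

/-- The group `SL_d(ℝ)`. -/
abbrev SLR (n : ℕ) : Type := Matrix.SpecialLinearGroup (Fin (n + 1)) ℝ

/-- `SL_d(ℤ)` as a subgroup of `SL_d(ℝ)`. -/
def SLZ (n : ℕ) : Subgroup (SLR n) :=
  (Matrix.SpecialLinearGroup.map (n := Fin (n + 1)) (Int.castRingHom ℝ)).range

/-- The space `X = SL_d(ℝ) / SL_d(ℤ)` of unimodular lattices in `ℝ^d`. -/
def X (n : ℕ) : Type := SLR n ⧸ SLZ n

/-- The quotient topology. -/
instance (n : ℕ) : TopologicalSpace (X n) := inferInstanceAs (TopologicalSpace (SLR n ⧸ SLZ n))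

instance (n : ℕ) : MulAction (SLR n) (X n) := inferInstanceAs (MulAction (SLR n) (SLR n ⧸ SLZ n))

instance (n : ℕ) : MeasurableSpace (X n) := borel (X n)

instance (n : ℕ) : BorelSpace (X n) := ⟨rfl⟩

/-- The standard lattice `ℤ^d`, as a point of `X`. -/
def stdPoint (n : ℕ) : X n := (QuotientGroup.mk (1 : SLR n) : SLR n ⧸ SLZ n)

/-- The set `g ℤ^d` of vectors. -/
def latticeOf (n : ℕ) (g : SLR n) : Set (Fin (n + 1) → ℝ) :=
  Set.range fun z : Fin (n + 1) → ℤ => g.1.mulVec fun i => (z i : ℝ)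

theorem latticeOf_mul_subset (n : ℕ) (g γ : SLR n) (hγ : γ ∈ SLZ n) :
    latticeOf n (g * γ) ⊆ latticeOf n g := by
  obtain ⟨c, rfl⟩ := hγ
  rintro _ ⟨z, rfl⟩
  refine ⟨c.1.mulVec z, ?_⟩
  have h : (fun i => ((c.1.mulVec z i : ℤ) : ℝ)) =
      (Matrix.SpecialLinearGroup.map (Int.castRingHom ℝ) c).1.mulVec fun i => (z i : ℝ) := by
    funext i
    simp [Matrix.mulVec, dotProduct]
  simp only [h, Matrix.mulVec_mulVec]
  rfl

/-- The points of the lattice `x ∈ X`, a subset of `ℝ^d`. -/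
def lattice (n : ℕ) (x : X n) : Set (Fin (n + 1) → ℝ) :=
  Quotient.liftOn' (s₁ := QuotientGroup.leftRel (SLZ n)) x (latticeOf n) (by
    intro a b hab
    rw [QuotientGroup.leftRel_apply] at hab
    apply Set.Subset.antisymm
    · have h := latticeOf_mul_subset n b (a⁻¹ * b)⁻¹ (inv_mem hab)
      simpa using h
    · have h := latticeOf_mul_subset n a (a⁻¹ * b) hab
      simpa using h)

/-- `ℓ(x)`, the length of a shortest nonzero vector of the lattice `x`. -/
def ell (n : ℕ) (x : X n) : ℝ := sInf ((fun v => ‖v‖) '' (lattice n x \ {0}))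

/-- `X^{≥ δ}`. -/
def Xge (n : ℕ) (δ : ℝ) : Set (X n) := {x | δ ≤ ell n x}

/-- The group `A` of diagonal matrices with positive diagonal entries in `SL_d(ℝ)`. -/
def A (n : ℕ) : Subgroup (SLR n) where
  carrier := {g | ∃ c : Fin (n + 1) → ℝ, (∀ i, 0 < c i) ∧ g.1 = Matrix.diagonal c}
  one_mem' := ⟨fun _ => 1, fun _ => one_pos, by simp⟩
  mul_mem' := by
    rintro a b ⟨c, hc, ha⟩ ⟨e, he, hb⟩
    refine ⟨fun i => c i * e i, fun i => mul_pos (hc i) (he i), ?_⟩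
    have h : (a * b).1 = a.1 * b.1 := rfl
    rw [h, ha, hb, Matrix.diagonal_mul_diagonal]
  inv_mem' := by
    rintro a ⟨c, hc, ha⟩
    refine ⟨fun i => (c i)⁻¹, fun i => inv_pos.2 (hc i), ?_⟩
    have h1 : (a⁻¹).1 * a.1 = 1 := by
      have h : (a⁻¹ * a).1 = (1 : SLR n).1 := by rw [inv_mul_cancel]
      exact h
    have h2 : a.1 * Matrix.diagonal (fun i => (c i)⁻¹) = 1 := by
      rw [ha, Matrix.diagonal_mul_diagonal, ← Matrix.diagonal_one]
      congr 1
      funext i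
      exact mul_inv_cancel₀ (hc i).ne'
    exact left_inv_eq_right_inv h1 h2

/-- The orbit `Ax`. -/
def orbitA (n : ℕ) (x : X n) : Set (X n) := MulAction.orbit (A n) x

/-- `Ω`, the set of `x` with compact `A`-orbit. -/
def Omega (n : ℕ) : Set (X n) := {x | IsCompact (orbitA n x)}

/-- The hyperplane `ℝ^d_0` of vectors with coordinate sum `0`. -/
def R0 (n : ℕ) : Submodule ℝ (Fin (n + 1) → ℝ) where
  carrier := {t | ∑ i, t i = 0}
  zero_mem' := by simp
  add_mem' := by
    intro a b ha hb
    change ∑ i, a i = 0 at ha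
    change ∑ i, b i = 0 at hb
    change ∑ i, (a i + b i) = 0
    simp [Finset.sum_add_distrib, ha, hb]
  smul_mem' := by
    intro c a ha
    change ∑ i, a i = 0 at ha
    change ∑ i, c * a i = 0
    simp [← Finset.mul_sum, ha]

/-- `a(t) = diag(e^{t_1}, …, e^{t_d})`. -/
def aMat (n : ℕ) (t : R0 n) : SLR n :=
  ⟨Matrix.diagonal fun i => Real.exp (t.1 i), by
    have h : ∑ i, t.1 i = 0 := t.2
    rw [Matrix.det_diagonal, ← Real.exp_sum, h, Real.exp_zero]⟩

/-- `⌈t⌉ = max_i t_i`. -/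
def ceilMax (n : ℕ) (t : R0 n) : ℝ := ⨆ i, t.1 i

/-- `Δ_x = φ(stab_{UA}(x))`: here `UA` is the group of diagonal matrices `diag(c)` of determinant
`± 1`, and `φ(diag(c)) = (log |c_1|, …, log |c_d|)`. -/
def Delta (n : ℕ) (x : X n) : Submodule ℤ (R0 n) :=
  AddSubgroup.toIntSubmodule
  { carrier := {t | ∃ c : Fin (n + 1) → ℝ, |(Matrix.diagonal c).det| = 1 ∧
      (Matrix.diagonal c).mulVec '' lattice n x = lattice n x ∧ ∀ i, t.1 i = Real.log |c i|}
    zero_mem' := ⟨fun _ => 1, by simp, by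
      have h : (Matrix.diagonal fun _ : Fin (n + 1) => (1 : ℝ)) = 1 := Matrix.diagonal_one
      rw [h]
      ext v
      simp, by simp⟩
    add_mem' := by
      rintro s t ⟨c, hc, hcx, hs⟩ ⟨e, he, hex, ht⟩
      have hc0 : ∀ i, c i ≠ 0 := by
        intro i hi
        rw [Matrix.det_diagonal, Finset.prod_eq_zero (Finset.mem_univ i) hi] at hc
        simp at hc
      have he0 : ∀ i, e i ≠ 0 := by
        intro i hi
        rw [Matrix.det_diagonal, Finset.prod_eq_zero (Finset.mem_univ i) hi] at he
        simp at he
      refine ⟨fun i => c i * e i, ?_, ?_, ?_⟩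
      · rw [← Matrix.diagonal_mul_diagonal, Matrix.det_mul, abs_mul, hc, he, one_mul]
      · have h : (Matrix.diagonal fun i => c i * e i).mulVec =
            (Matrix.diagonal c).mulVec ∘ (Matrix.diagonal e).mulVec := by
          funext v
          simp [Matrix.mulVec_mulVec]
        rw [h, Set.image_comp, hex, hcx]
      · intro i
        have h : (s + t).1 i = s.1 i + t.1 i := rfl
        rw [h, hs, ht, abs_mul, Real.log_mul (abs_ne_zero.2 (hc0 i)) (abs_ne_zero.2 (he0 i))]
    neg_mem' := by
      rintro t ⟨c, hc, hcx, ht⟩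
      have hc0 : ∀ i, c i ≠ 0 := by
        intro i hi
        rw [Matrix.det_diagonal, Finset.prod_eq_zero (Finset.mem_univ i) hi] at hc
        simp at hc
      have hinv : Matrix.diagonal (fun i => (c i)⁻¹) * Matrix.diagonal c = 1 := by
        rw [Matrix.diagonal_mul_diagonal, ← Matrix.diagonal_one]
        congr 1
        funext i
        exact inv_mul_cancel₀ (hc0 i)
      refine ⟨fun i => (c i)⁻¹, ?_, ?_, ?_⟩
      · have h := congrArg (fun m => |m.det|) hinv
        simp only [Matrix.det_mul, abs_mul, hc, mul_one, Matrix.det_one, abs_one] at h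
        exact h
      · nth_rewrite 1 [← hcx]
        rw [← Set.image_comp]
        have h : (Matrix.diagonal fun i => (c i)⁻¹).mulVec ∘ (Matrix.diagonal c).mulVec = id := by
          funext v
          simp only [Function.comp_apply, Matrix.mulVec_mulVec, hinv, Matrix.one_mulVec, id]
        rw [h, Set.image_id]
      · intro i
        have h : (-t).1 i = -t.1 i := rfl
        rw [h, ht, abs_inv, Real.log_inv] }

/-- The linear map `(s_1, …, s_n) ↦ (s_1, …, s_n, -∑ s_i)` from `ℝ^n` onto `ℝ^d_0`. -/
def graphMap (n : ℕ) (s : Fin n → ℝ) : R0 n :=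
  ⟨Fin.snoc s (-∑ i, s i), by
    change ∑ i, (Fin.snoc s (-∑ i, s i) : Fin (n + 1) → ℝ) i = 0
    simp [Fin.sum_univ_castSucc]⟩

/-- Lebesgue measure (euclidean `n`-dimensional volume) on the hyperplane `ℝ^d_0`: the euclidean
volume is `√d` times the volume of the projection to the first `n` coordinates. -/
def vol0 (n : ℕ) : Measure (R0 n) :=
  ENNReal.ofReal (Real.sqrt (n + 1)) • Measure.map (graphMap n) volume

/-- The covolume `|L|` of a lattice `L` in `ℝ^d_0`. -/
def covol (n : ℕ) (L : Submodule ℤ (R0 n)) : ℝ := ZLattice.covolume L (vol0 n)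

/-- A simplex set: a spanning set of `ℝ^d_0` of cardinality `d` whose elements add up to `0`. -/
structure IsSimplexSet (n : ℕ) (Φ : Finset (R0 n)) : Prop where
  span_eq_top : Submodule.span ℝ (Φ : Set (R0 n)) = ⊤
  card_eq : Φ.card = n + 1
  sum_eq_zero : ∑ t ∈ Φ, t = 0

/-- The lattice `Δ_Φ = span_ℤ Φ`. -/
def DeltaPhi (n : ℕ) (Φ : Finset (R0 n)) : Submodule ℤ (R0 n) :=
  Submodule.span ℤ (Φ : Set (R0 n))

/-- `ξ_Φ = max_{t ∈ Φ} ⌈t⌉`. -/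
def xi (n : ℕ) (Φ : Finset (R0 n)) : ℝ := ⨆ t : Φ, ceilMax n t.1

/-- `b_j = (1, …, 1, -n, 1, …, 1)`, with `-n` in the `j`-th place. -/
def bStar (n : ℕ) (j : Fin (n + 1)) : R0 n :=
  ⟨fun i => if i = j then -(n : ℝ) else 1, by
    change ∑ i, (if i = j then -(n : ℝ) else 1) = 0
    simp [Finset.sum_ite, Finset.filter_ne', Finset.filter_eq']⟩

/-- The standard simplex set `Φ_* = {b_j}`. -/
def PhiStar (n : ℕ) : Set (R0 n) := Set.range (bStar n)

/-- `Δ_* = span_ℤ Φ_*`. -/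
def DeltaStar (n : ℕ) : Submodule ℤ (R0 n) := Submodule.span ℤ (PhiStar n)

/-- `h` is a distortion map of `Φ`: `h Φ_* = |Δ_Φ|^{-1/n} Φ`. -/
def IsDistortionMap (n : ℕ) (Φ : Finset (R0 n)) (h : R0 n ≃ₗ[ℝ] R0 n) : Prop :=
  h '' PhiStar n = (fun t => (covol n (DeltaPhi n Φ) ^ (-(1 / (n : ℝ)))) • t) '' (Φ : Set (R0 n))

/-- `w_τ^{Φ_*} = τ (d⁻¹ ∑_ℓ (ℓ - 1) b_ℓ)`, where the permutation matrix `τ` sends `b_ℓ` to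
`b_{τ ℓ}`; the indices `ℓ - 1` are the elements of `Fin (n + 1)`. -/
def wStar (n : ℕ) (τ : Equiv.Perm (Fin (n + 1))) : R0 n :=
  ((n : ℝ) + 1)⁻¹ • ∑ l : Fin (n + 1), ((l : ℕ) : ℝ) • bStar n (τ l)

/-- `w_τ^Φ = |Δ_Φ|^{1/n} h_Φ w_τ^{Φ_*}`. -/
def wPhi (n : ℕ) (Φ : Finset (R0 n)) (h : R0 n ≃ₗ[ℝ] R0 n) (τ : Equiv.Perm (Fin (n + 1))) : R0 n :=
  (covol n (DeltaPhi n Φ) ^ (1 / (n : ℝ))) • h (wStar n τ)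

/-- `Φ` is an `M`-tight simplex set for `x`. -/
structure IsTight (n : ℕ) (M : ℝ) (x : X n) (Φ : Finset (R0 n)) : Prop where
  isSimplexSet : IsSimplexSet n Φ
  subset_Delta : ∀ t ∈ Φ, t ∈ Delta n x
  ell_le : ell n x ≤ M * Real.exp (-((n : ℝ) / 2 * xi n Φ))

/-- `Ω_M`. -/
def OmegaM (n : ℕ) (M : ℝ) : Set (X n) := {x | x ∈ Omega n ∧ ∃ Φ, IsTight n M x Φ}

/-- `‖g - I‖`, in the operator norm for the supremum norm on `ℝ^d`. -/
def distOne (n : ℕ) (g : SLR n) : ℝ :=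
  ‖LinearMap.toContinuousLinearMap (Matrix.toLin' (g.1 - 1))‖

/-- For every `τ`, `a(w_τ) x = g_τ a(s_τ) ℤ^d` for some `g_τ` with
`‖g_τ - I‖ ≤ C exp(-|Δ_x|^ε)`, where the `w_τ` are those of `Φ` and its distortion map `h`. -/
def NearStdAt (n : ℕ) (ε C : ℝ) (x : X n) (Φ : Finset (R0 n)) (h : R0 n ≃ₗ[ℝ] R0 n)
    (s : Equiv.Perm (Fin (n + 1)) → R0 n) : Prop :=
  ∀ τ, ∃ g : SLR n, distOne n g ≤ C * Real.exp (-(covol n (Delta n x) ^ ε)) ∧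
    aMat n (wPhi n Φ h τ) • x = g • aMat n (s τ) • stdPoint n

/-- `Ω_M(ε, C)`. -/
def OmegaMEps (n : ℕ) (M ε C : ℝ) : Set (X n) :=
  {x | x ∈ OmegaM n M ∧ ∃ Φ, IsTight n M x Φ ∧
    ∃ h, IsDistortionMap n Φ h ∧ ∃ s, NearStdAt n ε C x Φ h s}

/-- Every lattice in `ℝ^d_0` is of the form `h Δ_*` with `h ∈ GL(ℝ^d_0)`. Two elements of
`GL(ℝ^d_0)` are equivalent when the lattices they give are homothetic. -/
def shapeSetoid (n : ℕ) : Setoid (R0 n →L[ℝ] R0 n)ˣ where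
  r h h' := ∃ c : ℝ, 0 < c ∧
    (fun v => h'.1 v) '' (DeltaStar n : Set (R0 n)) =
      (fun v => c • h.1 v) '' (DeltaStar n : Set (R0 n))
  iseqv := by
    refine ⟨fun h => ⟨1, one_pos, by simp⟩, ?_, ?_⟩
    · rintro h h' ⟨c, hc, e⟩
      refine ⟨c⁻¹, inv_pos.2 hc, ?_⟩
      have e' := congrArg (fun S : Set (R0 n) => (fun v => c⁻¹ • v) '' S) e
      simp only [Set.image_image] at e'
      rw [e']
      simp [smul_smul, inv_mul_cancel₀ hc.ne']
    · rintro h h' h'' ⟨c, hc, e⟩ ⟨c', hc', e'⟩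
      refine ⟨c' * c, mul_pos hc' hc, ?_⟩
      have e2 := congrArg (fun S : Set (R0 n) => (fun v => c' • v) '' S) e
      simp only [Set.image_image] at e2
      rw [e', e2]
      simp [smul_smul]

/-- The space of shapes: lattices in `ℝ^d_0` up to homothety, with the quotient topology. -/
def Shape (n : ℕ) : Type := Quotient (shapeSetoid n)

instance (n : ℕ) : TopologicalSpace (Shape n) :=
  inferInstanceAs (TopologicalSpace (Quotient (shapeSetoid n)))

/-- The shape of the lattice `h Δ_*`. -/
def Shape.mk {n : ℕ} (h : (R0 n →L[ℝ] R0 n)ˣ) : Shape n := Quotient.mk (shapeSetoid n) h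

/-- The lattice `L` in `ℝ^d_0` has its shape in `K`. -/
def HasShapeIn (n : ℕ) (K : Set (Shape n)) (L : Submodule ℤ (R0 n)) : Prop :=
  ∃ h : (R0 n →L[ℝ] R0 n)ˣ,
    (fun v => h.1 v) '' (DeltaStar n : Set (R0 n)) = (L : Set (R0 n)) ∧ Shape.mk h ∈ K

/-- `Ω_{M,K}`. -/
def OmegaMK (n : ℕ) (M : ℝ) (K : Set (Shape n)) : Set (X n) :=
  {x | x ∈ OmegaM n M ∧ ∃ Φ, IsTight n M x Φ ∧ HasShapeIn n K (DeltaPhi n Φ)}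

/-- `μ` is an `A`-invariant probability measure supported on `Ax`. -/
structure IsOrbitMeasure (n : ℕ) (x : X n) (μ : Measure (X n)) : Prop where
  isProbabilityMeasure : IsProbabilityMeasure μ
  compl_orbit : μ (orbitA n x)ᶜ = 0
  invariant : ∀ g ∈ A n, Measure.map (fun y => g • y) μ = μ

/-- Full escape of mass: the unique `A`-invariant probability measures `μ_{A x_k}` exist and
converge to the zero measure in the vague topology. -/
def FullEscape (n : ℕ) (x : ℕ → X n) : Prop :=
  (∀ k, ∃! μ, IsOrbitMeasure n (x k) μ) ∧
  ∀ μ : ℕ → Measure (X n), (∀ k, IsOrbitMeasure n (x k) (μ k)) →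
    ∀ f : X n → ℝ, Continuous f → HasCompactSupport f →
      Tendsto (fun k => ∫ y, f y ∂(μ k)) atTop (𝓝 0)

/-- Every limit point of a sequence `a_k x_k`, with `a_k ∈ A`, lies in `A ℤ^d`. -/
def AccumulatesOnlyOnStd (n : ℕ) (x : ℕ → X n) : Prop :=
  ∀ a : ℕ → SLR n, (∀ k, a k ∈ A n) →
    ∀ y, MapClusterPt y atTop (fun k => a k • x k) → y ∈ orbitA n (stdPoint n)

end EscapeOfMass

end

noncomputable section

namespace EscapeOfMass

/-! Everything rests on locating the times s at which a(s)x is not high in the cusp. Write s = ∑ α_i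
φ_i, where the φ_i enumerate a tight simplex set. Elements of Δ_x stabilise x up to signs, so
ℓ(a(s)x) is Δ_x-periodic in s. For each base index j, s may thus be replaced by ∑ {α_i - α_j} φ_i,
whose coordinates are at most ξ S_j with S_j = ∑_i {α_i - α_j}, and tightness gives ℓ(a(s)x) ≤ M
exp(ξ (S_j - n/2)). Since {u} + {-u} ≤ 1, the S_j have average at most n/2. Hence ℓ ≥ δ forces all
S_j to be nearly n/2, and the α_i are, modulo integers and a common shift, a permutation of 0, 1/d,
..., n/d up to log(M/δ)/ξ. As ‖φ_i‖ ≤ nξ, the time s is at distance bounded in terms of n, M, δ from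
some w_τ + Δ_Φ (`near_equidistributed_of_le_sum_fract`, `IsTightFamily.location`).

Assertion 1: for fixed δ, the part of the orbit of height at least δ has measure O(1/ξ), and ξ → ∞
because only finitely many orbits have boundedly many-sized vectors of Δ_x spanning ℝ^d_0
(`finite_orbits_of_span_bounded`).

Assertion 2: (*) puts a(w_τ)x near Aℤ^d, with an error tending to 0 because |Δ_x| → ∞
(`tendsto_covol`). A bounded displacement of the time multiplies the error by a bounded factor, and
a translation by Δ_x only conjugates the error by signs (`IsTightFamily.near_std`).

Assertion 3: let Φ' be a tight simplex set with shape in K. Then Δ_Φ' eventually has no short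
vectors (`eventually_lt_norm`). Location relative to Φ' puts (n+1)Δ_x within bounded distance of
Δ_Φ', hence inside it (`dilate_mem`), so Δ_x has no short vectors either. Translations by Δ_x then
permute the classes w_τ + Δ_Φ exactly, which forces Δ_x = Δ_Φ (`IsSimplexFamily.mem_of_permutes`).
The parts of the orbit near different classes are disjoint, there are at least n! classes, and each
part contains a(w_τ - s_τ)x, which is close to ℤ^d and so has height at least δ₁ < 1. -/

/-! ### Lattices as sets of vectors -/

/-- The set `ℤ^d ⊆ ℝ^d`. -/
def intVecs (n : ℕ) : Set (Fin (n + 1) → ℝ) :=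
  Set.range fun z : Fin (n + 1) → ℤ => fun i => (z i : ℝ)

theorem exists_smul_stdPoint {n : ℕ} (x : X n) : ∃ g : SLR n, x = g • stdPoint n := by
  obtain ⟨g, hg⟩ := QuotientGroup.mk_surjective (s := SLZ n) x
  refine ⟨g, hg.symm.trans ?_⟩
  have h : (QuotientGroup.mk (g * 1) : SLR n ⧸ SLZ n) = QuotientGroup.mk g := by rw [mul_one]
  exact h.symm

theorem lattice_smul {n : ℕ} (g : SLR n) (x : X n) :
    lattice n (g • x) = g.1.mulVec '' lattice n x := by
  obtain ⟨h, rfl⟩ := QuotientGroup.mk_surjective (s := SLZ n) x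
  change latticeOf n (g * h) = g.1.mulVec '' latticeOf n h
  rw [latticeOf, latticeOf, ← Set.range_comp]
  congr 1
  funext z
  simp [Matrix.mulVec_mulVec]

theorem lattice_stdPoint (n : ℕ) : lattice n (stdPoint n) = intVecs n := by
  change latticeOf n 1 = _
  simp [latticeOf, intVecs]

theorem lattice_smul_stdPoint {n : ℕ} (g : SLR n) :
    lattice n (g • stdPoint n) = g.1.mulVec '' intVecs n := by
  rw [lattice_smul, lattice_stdPoint]

theorem intVecs_add_mem {n : ℕ} {v w : Fin (n + 1) → ℝ} (hv : v ∈ intVecs n)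
    (hw : w ∈ intVecs n) : v + w ∈ intVecs n := by
  obtain ⟨a, rfl⟩ := hv
  obtain ⟨b, rfl⟩ := hw
  exact ⟨a + b, by funext i; simp⟩

theorem one_le_norm_of_mem_intVecs {n : ℕ} {v : Fin (n + 1) → ℝ} (hv : v ∈ intVecs n)
    (h0 : v ≠ 0) : 1 ≤ ‖v‖ := by
  obtain ⟨z, rfl⟩ := hv
  obtain ⟨i, hi⟩ := Function.ne_iff.1 h0
  have hz : z i ≠ 0 := by simpa using hi
  refine le_trans ?_ (norm_le_pi_norm _ i)
  rw [Real.norm_eq_abs]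
  have h := Int.one_le_abs hz
  change (1 : ℝ) ≤ |(z i : ℝ)|
  exact_mod_cast h

theorem mulVec_injective {n : ℕ} (g : SLR n) : Function.Injective g.1.mulVec := by
  apply Matrix.mulVec_injective_of_isUnit
  rw [Matrix.isUnit_iff_isUnit_det, g.2]
  exact isUnit_one

/-- A matrix that maps `ℤ^d` into itself has integer entries. -/
theorem exists_int_matrix {n : ℕ} (m : Matrix (Fin (n + 1)) (Fin (n + 1)) ℝ)
    (h : ∀ v ∈ intVecs n, m.mulVec v ∈ intVecs n) :
    ∃ N : Matrix (Fin (n + 1)) (Fin (n + 1)) ℤ, m = N.map (Int.cast : ℤ → ℝ) := by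
  have h1 : ∀ j, ∃ z : Fin (n + 1) → ℤ, (fun i => (z i : ℝ)) = m.mulVec (Pi.single j 1) := by
    intro j
    apply h
    refine ⟨Pi.single j 1, ?_⟩
    funext i
    by_cases hij : i = j
    · subst hij; simp
    · simp [hij]
  choose z hz using h1
  refine ⟨Matrix.of fun i j => z j i, ?_⟩
  ext i j
  have := congrFun (hz j) i
  simp at this
  simp [this]

theorem stdPoint_fixed {n : ℕ} (k : SLR n) (h : ∀ v ∈ intVecs n, k.1.mulVec v ∈ intVecs n) :
    k • stdPoint n = stdPoint n := by
  obtain ⟨N, hN⟩ := exists_int_matrix k.1 h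
  have hdet : N.det = 1 := by
    have h1 : ((N.map (Int.castRingHom ℝ)).det) = 1 := by
      have := k.2
      rw [hN] at this
      exact this
    rw [← RingHom.mapMatrix_apply, ← RingHom.map_det] at h1
    exact Int.cast_injective (α := ℝ) (by simpa using h1)
  have hk : k ∈ SLZ n := ⟨⟨N, hdet⟩, by
    apply Subtype.ext
    rw [hN]
    rfl⟩
  change (QuotientGroup.mk (k * 1) : SLR n ⧸ SLZ n) = QuotientGroup.mk 1
  rw [mul_one, QuotientGroup.eq]
  simpa using inv_mem hk

/-- This allows identities in `X n` to be checked on sets of vectors, where sign matrices of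
determinant -1 also act. -/
theorem lattice_injective {n : ℕ} {x y : X n} (h : lattice n x = lattice n y) : x = y := by
  obtain ⟨g, rfl⟩ := exists_smul_stdPoint x
  obtain ⟨k, rfl⟩ := exists_smul_stdPoint y
  have h2 : (k⁻¹ * g) • stdPoint n = stdPoint n := by
    apply stdPoint_fixed
    intro v hv
    have h1 : g.1.mulVec v ∈ lattice n (k • stdPoint n) := by
      rw [← h, lattice_smul_stdPoint]
      exact ⟨v, hv, rfl⟩
    rw [lattice_smul_stdPoint] at h1
    obtain ⟨w, hw, hwv⟩ := h1
    have h3 : (k⁻¹ * g).1.mulVec v = w := by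
      have : (k⁻¹ * g).1 = (k⁻¹).1 * g.1 := rfl
      rw [this, ← Matrix.mulVec_mulVec, ← hwv, Matrix.mulVec_mulVec]
      have h4 : (k⁻¹).1 * k.1 = 1 := by
        have h : (k⁻¹ * k).1 = (1 : SLR n).1 := by rw [inv_mul_cancel]
        exact h
      rw [h4, Matrix.one_mulVec]
    rw [h3]
    exact hw
  rw [mul_smul, inv_smul_eq_iff] at h2
  exact h2

/-! ### The operator norm -/

/-- The operator norm of a matrix for the supremum norm. -/
def opN {n : ℕ} (m : Matrix (Fin (n + 1)) (Fin (n + 1)) ℝ) : ℝ :=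
  ‖LinearMap.toContinuousLinearMap (Matrix.toLin' m)‖

theorem distOne_eq {n : ℕ} (g : SLR n) : distOne n g = opN (g.1 - 1) := rfl

theorem opN_nonneg {n : ℕ} (m : Matrix (Fin (n + 1)) (Fin (n + 1)) ℝ) : 0 ≤ opN m :=
  norm_nonneg _

theorem norm_mulVec_le {n : ℕ} (m : Matrix (Fin (n + 1)) (Fin (n + 1)) ℝ)
    (v : Fin (n + 1) → ℝ) : ‖m.mulVec v‖ ≤ opN m * ‖v‖ :=
  (LinearMap.toContinuousLinearMap (Matrix.toLin' m)).le_opNorm v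

theorem opN_le {n : ℕ} (m : Matrix (Fin (n + 1)) (Fin (n + 1)) ℝ) {c : ℝ} (hc : 0 ≤ c)
    (h : ∀ v, ‖m.mulVec v‖ ≤ c * ‖v‖) : opN m ≤ c :=
  ContinuousLinearMap.opNorm_le_bound _ hc h

theorem opN_mul_le {n : ℕ} (a b : Matrix (Fin (n + 1)) (Fin (n + 1)) ℝ) :
    opN (a * b) ≤ opN a * opN b := by
  apply opN_le _ (mul_nonneg (opN_nonneg _) (opN_nonneg _))
  intro v
  rw [← Matrix.mulVec_mulVec, mul_assoc]
  exact (norm_mulVec_le _ _).trans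
    (mul_le_mul_of_nonneg_left (norm_mulVec_le _ _) (opN_nonneg _))

theorem norm_diagonal_mulVec_le {n : ℕ} (c : Fin (n + 1) → ℝ) {r : ℝ}
    (h : ∀ i, |c i| ≤ r) (v : Fin (n + 1) → ℝ) :
    ‖(Matrix.diagonal c).mulVec v‖ ≤ r * ‖v‖ := by
  have hr : 0 ≤ r := (abs_nonneg _).trans (h 0)
  rw [pi_norm_le_iff_of_nonneg (by positivity)]
  intro i
  rw [Matrix.mulVec_diagonal, norm_mul]
  exact mul_le_mul (h i) (norm_le_pi_norm v i) (norm_nonneg _) hr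

theorem opN_diagonal_le {n : ℕ} (c : Fin (n + 1) → ℝ) {r : ℝ}
    (h : ∀ i, |c i| ≤ r) : opN (Matrix.diagonal c) ≤ r :=
  opN_le _ ((abs_nonneg _).trans (h 0)) (norm_diagonal_mulVec_le c h)

theorem abs_entry_le_opN {n : ℕ} (m : Matrix (Fin (n + 1)) (Fin (n + 1)) ℝ)
    (i j : Fin (n + 1)) : |m i j| ≤ opN m := by
  have h := norm_mulVec_le m (Pi.single j 1)
  have h1 : ‖(Pi.single j 1 : Fin (n + 1) → ℝ)‖ = 1 := by rw [Pi.norm_single, norm_one]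
  rw [h1, mul_one] at h
  refine le_trans ?_ h
  refine le_trans (le_of_eq ?_) (norm_le_pi_norm _ i)
  simp

theorem tendsto_comap_distOne (n : ℕ) :
    Tendsto (fun g : SLR n => g) (comap (distOne n) (𝓝 0)) (𝓝 1) := by
  have hind : Topology.IsInducing (fun g : SLR n => g.1) := ⟨rfl⟩
  rw [hind.tendsto_nhds_iff]
  have h0 : Tendsto (distOne n) (comap (distOne n) (𝓝 0)) (𝓝 0) := tendsto_comap
  refine tendsto_pi_nhds.2 fun i => tendsto_pi_nhds.2 fun j => ?_
  rw [tendsto_iff_norm_sub_tendsto_zero]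
  refine squeeze_zero (fun _ => norm_nonneg _) (fun g => ?_) h0
  exact abs_entry_le_opN (g.1 - 1) i j

/-! ### The function `ell` -/

theorem ell_set_bddBelow {n : ℕ} (x : X n) :
    BddBelow ((fun v => ‖v‖) '' (lattice n x \ {0})) :=
  ⟨0, by rintro _ ⟨v, _, rfl⟩; exact norm_nonneg v⟩

theorem exists_ne_zero_mem_lattice {n : ℕ} (x : X n) : ∃ v ∈ lattice n x, v ≠ 0 := by
  obtain ⟨g, rfl⟩ := exists_smul_stdPoint x
  rw [lattice_smul_stdPoint]
  refine ⟨_, ⟨fun _ => 1, ⟨fun _ => 1, by simp⟩, rfl⟩, ?_⟩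
  intro h
  rw [← Matrix.mulVec_zero g.1] at h
  have := congrFun (mulVec_injective g h) 0
  simp at this

theorem ell_le_norm {n : ℕ} {x : X n} {v : Fin (n + 1) → ℝ} (hv : v ∈ lattice n x)
    (h0 : v ≠ 0) : ell n x ≤ ‖v‖ :=
  csInf_le (ell_set_bddBelow x) ⟨v, ⟨hv, h0⟩, rfl⟩

theorem le_ell {n : ℕ} {x : X n} {r : ℝ} (h : ∀ v ∈ lattice n x, v ≠ 0 → r ≤ ‖v‖) :
    r ≤ ell n x := by
  obtain ⟨v, hv, h0⟩ := exists_ne_zero_mem_lattice x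
  refine le_csInf ⟨‖v‖, ⟨v, ⟨hv, h0⟩, rfl⟩⟩ ?_
  rintro _ ⟨w, hw, rfl⟩
  exact h w hw.1 hw.2

theorem ell_nonneg {n : ℕ} (x : X n) : 0 ≤ ell n x := le_ell fun v _ _ => norm_nonneg v

theorem one_le_ell_stdPoint (n : ℕ) : 1 ≤ ell n (stdPoint n) := by
  apply le_ell
  rw [lattice_stdPoint]
  exact fun v => one_le_norm_of_mem_intVecs

/-- A matrix that scales the norm of each vector by at least `r` scales `ell` by at least `r`. -/
theorem le_ell_smul {n : ℕ} {g : SLR n} {r : ℝ} (x : X n) (hr : 0 ≤ r)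
    (h : ∀ v, r * ‖v‖ ≤ ‖g.1.mulVec v‖) : r * ell n x ≤ ell n (g • x) := by
  apply le_ell
  rw [lattice_smul]
  rintro _ ⟨v, hv, rfl⟩ h0
  have hv0 : v ≠ 0 := by
    rintro rfl
    simp at h0
  exact (mul_le_mul_of_nonneg_left (ell_le_norm hv hv0) hr).trans (h v)

theorem ell_smul_le {n : ℕ} {g : SLR n} {r : ℝ} (x : X n) (hr : 0 < r)
    (h : ∀ v, ‖g.1.mulVec v‖ ≤ r * ‖v‖) : ell n (g • x) ≤ r * ell n x := by
  rw [← div_le_iff₀' hr]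
  apply le_ell
  intro v hv h0
  rw [div_le_iff₀' hr]
  refine le_trans (ell_le_norm ?_ ?_) (h v)
  · rw [lattice_smul]
    exact ⟨v, hv, rfl⟩
  · intro h1
    rw [← Matrix.mulVec_zero g.1] at h1
    exact h0 (mulVec_injective g h1)

theorem le_norm_mulVec {n : ℕ} (g : SLR n) (v : Fin (n + 1) → ℝ) :
    (opN (g⁻¹).1)⁻¹ * ‖v‖ ≤ ‖g.1.mulVec v‖ := by
  have h4 : (g⁻¹).1 * g.1 = 1 := by
    have h : (g⁻¹ * g).1 = (1 : SLR n).1 := by rw [inv_mul_cancel]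
    exact h
  have h := norm_mulVec_le (g⁻¹).1 (g.1.mulVec v)
  rw [Matrix.mulVec_mulVec, h4, Matrix.one_mulVec] at h
  rcases (opN_nonneg (g⁻¹).1).eq_or_lt with h0 | h0
  · rw [← h0]; simp
  · rwa [inv_mul_le_iff₀ h0]

theorem opN_pos {n : ℕ} (g : SLR n) : 0 < opN g.1 := by
  apply lt_of_le_of_ne (opN_nonneg _)
  intro h
  have h1 := norm_mulVec_le g.1 (fun _ => 1)
  rw [← h, zero_mul, norm_le_zero_iff, ← Matrix.mulVec_zero g.1] at h1
  have := congrFun (mulVec_injective g h1) 0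
  simp at this

theorem inv_opN_le_ell {n : ℕ} (g : SLR n) : (opN (g⁻¹).1)⁻¹ ≤ ell n (g • stdPoint n) := by
  have h0 : 0 ≤ (opN (g⁻¹).1)⁻¹ := inv_nonneg.2 (opN_nonneg _)
  have h := le_ell_smul (stdPoint n) h0 (le_norm_mulVec g)
  exact (le_mul_of_one_le_right h0 (one_le_ell_stdPoint n)).trans h

theorem ell_pos {n : ℕ} (x : X n) : 0 < ell n x := by
  obtain ⟨g, rfl⟩ := exists_smul_stdPoint x
  exact (inv_pos.2 (opN_pos _)).trans_le (inv_opN_le_ell g)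

theorem sub_distOne_mul_ell_le {n : ℕ} (g : SLR n) (hg : distOne n g ≤ 1) (x : X n) :
    (1 - distOne n g) * ell n x ≤ ell n (g • x) := by
  apply le_ell_smul x (by linarith)
  intro v
  have h := norm_mulVec_le (g.1 - 1) v
  rw [Matrix.sub_mulVec, Matrix.one_mulVec, ← distOne_eq] at h
  have h2 : ‖v‖ ≤ ‖g.1.mulVec v‖ + ‖g.1.mulVec v - v‖ := by
    have := norm_sub_le (g.1.mulVec v) (g.1.mulVec v - v)
    simpa using this
  linarith

theorem ell_smul_le_distOne {n : ℕ} (g : SLR n) (x : X n) :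
    ell n (g • x) ≤ (1 + distOne n g) * ell n x := by
  have h0 : 0 ≤ distOne n g := opN_nonneg _
  apply ell_smul_le x (by linarith)
  intro v
  have h := norm_mulVec_le (g.1 - 1) v
  rw [Matrix.sub_mulVec, Matrix.one_mulVec, ← distOne_eq] at h
  have h2 : ‖g.1.mulVec v‖ ≤ ‖v‖ + ‖g.1.mulVec v - v‖ := by
    have := norm_add_le v (g.1.mulVec v - v)
    simpa using this
  linarith

/-! ### The diagonal group -/

theorem aMat_val {n : ℕ} (t : R0 n) :
    (aMat n t).1 = Matrix.diagonal fun i => Real.exp (t.1 i) := rfl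

theorem aMat_add {n : ℕ} (s t : R0 n) : aMat n (s + t) = aMat n s * aMat n t := by
  apply Subtype.ext
  change _ = (aMat n s).1 * (aMat n t).1
  rw [aMat_val, aMat_val, aMat_val, Matrix.diagonal_mul_diagonal]
  congr 1
  funext i
  exact Real.exp_add _ _

theorem aMat_zero (n : ℕ) : aMat n 0 = 1 := by
  apply Subtype.ext
  rw [aMat_val]
  simp

theorem aMat_neg {n : ℕ} (s : R0 n) : aMat n (-s) = (aMat n s)⁻¹ := by
  rw [eq_inv_iff_mul_eq_one, ← aMat_add, neg_add_cancel, aMat_zero]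

theorem aMat_add_smul {n : ℕ} (s t : R0 n) (x : X n) :
    aMat n (s + t) • x = aMat n s • aMat n t • x := by rw [aMat_add, mul_smul]

theorem aMat_mem_A {n : ℕ} (t : R0 n) : aMat n t ∈ A n :=
  ⟨_, fun _ => Real.exp_pos _, aMat_val t⟩

theorem exists_aMat_of_mem_A {n : ℕ} {g : SLR n} (hg : g ∈ A n) : ∃ t, g = aMat n t := by
  obtain ⟨c, hc, h⟩ := hg
  refine ⟨⟨fun i => Real.log (c i), ?_⟩, ?_⟩
  · change ∑ i, Real.log (c i) = 0
    rw [← Real.log_prod (fun i _ => (hc i).ne'), ← Matrix.det_diagonal, ← h, g.2, Real.log_one]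
  · apply Subtype.ext
    refine h.trans ?_
    rw [aMat_val]
    congr 1
    funext i
    exact (Real.exp_log (hc i)).symm

theorem mem_orbitA_iff {n : ℕ} {x y : X n} : y ∈ orbitA n x ↔ ∃ t, y = aMat n t • x := by
  constructor
  · rintro ⟨⟨g, hg⟩, rfl⟩
    obtain ⟨t, rfl⟩ := exists_aMat_of_mem_A hg
    exact ⟨t, rfl⟩
  · rintro ⟨t, rfl⟩
    exact ⟨⟨aMat n t, aMat_mem_A t⟩, rfl⟩

theorem le_ceilMax {n : ℕ} (t : R0 n) (i : Fin (n + 1)) : t.1 i ≤ ceilMax n t :=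
  le_ciSup (Set.finite_range t.1).bddAbove i

theorem abs_coord_le_norm {n : ℕ} (t : R0 n) (i : Fin (n + 1)) : |t.1 i| ≤ ‖t‖ :=
  norm_le_pi_norm t.1 i

/-- The norm of a vector of `ℝ^d_0` is bounded by `n` times its largest coordinate. -/
theorem norm_le_of_coord_le {n : ℕ} (hn : 1 ≤ n) {t : R0 n} {r : ℝ} (h : ∀ i, t.1 i ≤ r) :
    ‖t‖ ≤ n * r := by
  have hs : ∑ i, t.1 i = 0 := t.2
  have hn' : (1 : ℝ) ≤ n := by exact_mod_cast hn
  have hr : 0 ≤ r := by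
    have : ∑ i, t.1 i ≤ ∑ i : Fin (n + 1), r := Finset.sum_le_sum fun i _ => h i
    rw [hs] at this
    simp at this
    by_contra! hr
    nlinarith
  change ‖t.1‖ ≤ _
  rw [pi_norm_le_iff_of_nonneg (by positivity)]
  intro i
  rw [Real.norm_eq_abs, abs_le]
  constructor
  · have h1 : t.1 i + ∑ j ∈ Finset.univ.erase i, t.1 j = 0 := by
      rw [Finset.add_sum_erase _ _ (Finset.mem_univ i), hs]
    have h2 : ∑ j ∈ Finset.univ.erase i, t.1 j ≤ n * r := by
      refine (Finset.sum_le_card_nsmul _ _ r fun j _ => h j).trans ?_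
      simp
    linarith
  · exact (h i).trans (le_mul_of_one_le_left hr hn')

theorem norm_aMat_mulVec_le {n : ℕ} {s : R0 n} {r : ℝ} (h : ∀ i, s.1 i ≤ r)
    (v : Fin (n + 1) → ℝ) : ‖(aMat n s).1.mulVec v‖ ≤ Real.exp r * ‖v‖ := by
  apply norm_diagonal_mulVec_le
  intro i
  rw [abs_of_pos (Real.exp_pos _)]
  exact Real.exp_le_exp.2 (h i)

theorem ell_aMat_smul_le {n : ℕ} {s : R0 n} {r : ℝ} (h : ∀ i, s.1 i ≤ r) (x : X n) :
    ell n (aMat n s • x) ≤ Real.exp r * ell n x :=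
  ell_smul_le x (Real.exp_pos _) (norm_aMat_mulVec_le h)

theorem exp_neg_norm_mul_ell_le {n : ℕ} (s : R0 n) (x : X n) :
    Real.exp (-‖s‖) * ell n x ≤ ell n (aMat n s • x) := by
  have h := ell_aMat_smul_le (s := -s) (r := ‖s‖)
    (fun i => by
      have := abs_coord_le_norm s i
      have h2 : (-s).1 i = -s.1 i := rfl
      rw [h2]
      exact (neg_le_abs _).trans this) (aMat n s • x)
  rw [aMat_neg, inv_smul_smul] at h
  rwa [Real.exp_neg, inv_mul_le_iff₀ (Real.exp_pos _)]

/-! ### The lattice `Delta` -/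

theorem ne_zero_of_abs_det_diagonal {n : ℕ} {c : Fin (n + 1) → ℝ}
    (h : |(Matrix.diagonal c).det| = 1) (i : Fin (n + 1)) : c i ≠ 0 := by
  intro hi
  rw [Matrix.det_diagonal, Finset.prod_eq_zero (Finset.mem_univ i) hi] at h
  simp at h

theorem exists_diagonal_of_mem_Delta {n : ℕ} {x : X n} {t : R0 n} (ht : t ∈ Delta n x) :
    ∃ c : Fin (n + 1) → ℝ, (∀ i, |c i| = Real.exp (t.1 i)) ∧
      (Matrix.diagonal c).mulVec '' lattice n x = lattice n x := by
  obtain ⟨c, hc, hcx, h⟩ := ht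
  refine ⟨c, fun i => ?_, hcx⟩
  rw [h, Real.exp_log (abs_pos.2 (ne_zero_of_abs_det_diagonal hc i))]

/-- An element of Δ_x records only the absolute values of a stabilising diag(c), so a(t) equals
diag(c) up to the signs e^{t_i}/c_i. Sign matrices are isometries, which is why `ell` is
Δ_x-periodic although a(t) need not fix x. -/
theorem aMat_smul_of_mem_Delta {n : ℕ} {x : X n} {t : R0 n} (ht : t ∈ Delta n x) :
    ∃ σ : Fin (n + 1) → ℝ, (∀ i, |σ i| = 1) ∧
      lattice n (aMat n t • x) = (Matrix.diagonal σ).mulVec '' lattice n x := by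
  obtain ⟨c, hc, hcx⟩ := exists_diagonal_of_mem_Delta ht
  have hc0 : ∀ i, c i ≠ 0 := fun i => abs_pos.1 ((hc i).symm ▸ Real.exp_pos _)
  refine ⟨fun i => Real.exp (t.1 i) / c i, fun i => ?_, ?_⟩
  · rw [abs_div, hc, abs_of_pos (Real.exp_pos _), div_self (Real.exp_pos _).ne']
  · conv_rhs => rw [← hcx]
    conv_lhs => rw [lattice_smul]
    rw [← Set.image_comp]
    congr 1
    funext v
    simp only [Function.comp_apply, Matrix.mulVec_mulVec, Matrix.diagonal_mul_diagonal, aMat_val]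
    congr 2
    funext i
    rw [div_mul_cancel₀ _ (hc0 i)]

theorem lattice_aMat_add_smul {n : ℕ} {x : X n} {t : R0 n} (ht : t ∈ Delta n x) :
    ∃ σ : Fin (n + 1) → ℝ, (∀ i, |σ i| = 1) ∧ ∀ s,
      lattice n (aMat n (s + t) • x) =
        (Matrix.diagonal σ).mulVec '' lattice n (aMat n s • x) := by
  obtain ⟨σ, hσ, h⟩ := aMat_smul_of_mem_Delta ht
  refine ⟨σ, hσ, fun s => ?_⟩
  rw [aMat_add, mul_smul, lattice_smul, h, lattice_smul, ← Set.image_comp, ← Set.image_comp]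
  congr 1
  funext v
  simp only [Function.comp_apply, Matrix.mulVec_mulVec, aMat_val, Matrix.diagonal_mul_diagonal]
  congr 2
  funext i
  ring

theorem norm_sign_mulVec {n : ℕ} {σ : Fin (n + 1) → ℝ} (hσ : ∀ i, |σ i| = 1)
    (v : Fin (n + 1) → ℝ) : ‖(Matrix.diagonal σ).mulVec v‖ = ‖v‖ := by
  apply le_antisymm
  · simpa using norm_diagonal_mulVec_le σ (fun i => (hσ i).le) v
  · have h := norm_diagonal_mulVec_le σ (fun i => (hσ i).le) ((Matrix.diagonal σ).mulVec v)
    rw [Matrix.mulVec_mulVec, Matrix.diagonal_mul_diagonal, one_mul] at h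
    have h1 : (fun i => σ i * σ i) = fun _ => 1 := by
      funext i
      rw [← abs_mul_abs_self, hσ, one_mul]
    rwa [h1, Matrix.diagonal_one, Matrix.one_mulVec] at h

theorem ell_aMat_add_smul {n : ℕ} {x : X n} {t : R0 n} (ht : t ∈ Delta n x) (s : R0 n) :
    ell n (aMat n (s + t) • x) = ell n (aMat n s • x) := by
  obtain ⟨σ, hσ, h⟩ := lattice_aMat_add_smul ht
  have hle : ∀ v, v ≠ 0 → (Matrix.diagonal σ).mulVec v ≠ 0 := by
    intro v hv h0
    rw [← norm_eq_zero, norm_sign_mulVec hσ, norm_eq_zero] at h0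
    exact hv h0
  apply le_antisymm
  · apply le_ell
    intro v hv h0
    rw [← norm_sign_mulVec hσ v]
    exact ell_le_norm (by rw [h]; exact ⟨v, hv, rfl⟩) (hle v h0)
  · apply le_ell
    rw [h]
    rintro _ ⟨v, hv, rfl⟩ h0
    rw [norm_sign_mulVec hσ v]
    refine ell_le_norm hv ?_
    rintro rfl
    simp at h0

/-- Doubling t squares the signs away. -/
theorem two_smul_mem_stabilizer {n : ℕ} {x : X n} {t : R0 n} (ht : t ∈ Delta n x) :
    aMat n (t + t) • x = x := by
  obtain ⟨σ, hσ, h⟩ := lattice_aMat_add_smul ht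
  apply lattice_injective
  have h0 := h 0
  rw [zero_add, aMat_zero, one_smul] at h0
  rw [h, h0, ← Set.image_comp]
  convert Set.image_id _
  funext v
  simp only [Function.comp_apply, Matrix.mulVec_mulVec, Matrix.diagonal_mul_diagonal, id]
  have h1 : (fun i => σ i * σ i) = fun _ => 1 := by
    funext i
    rw [← abs_mul_abs_self, hσ, one_mul]
  rw [h1, Matrix.diagonal_one, Matrix.one_mulVec]

theorem mem_Delta_of_smul_eq {n : ℕ} {x : X n} {t : R0 n} (h : aMat n t • x = x) :
    t ∈ Delta n x := by
  refine ⟨fun i => Real.exp (t.1 i), ?_, ?_, fun i => ?_⟩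
  · rw [← aMat_val, (aMat n t).2, abs_one]
  · rw [← aMat_val, ← lattice_smul, h]
  · rw [abs_of_pos (Real.exp_pos _), Real.log_exp]

/-! ### Fractional parts of configurations on the circle -/

theorem exists_perm_monotone {m : ℕ} (f : Fin m → ℝ) :
    ∃ τ : Equiv.Perm (Fin m), Monotone (f ∘ τ) :=
  ⟨Tuple.sort f, Tuple.monotone_sort f⟩

theorem card_lt_le_of_monotone {m : ℕ} {f : Fin m → ℝ} {τ : Equiv.Perm (Fin m)}
    (h : Monotone (f ∘ τ)) (l : Fin m) :
    (Finset.univ.filter fun i => f i < f (τ l)).card ≤ (l : ℕ) := by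
  have h1 : (Finset.univ.filter fun i => f i < f (τ l)) ⊆ (Finset.Iio l).map τ.toEmbedding := by
    intro i hi
    rw [Finset.mem_filter] at hi
    rw [Finset.mem_map]
    refine ⟨τ.symm i, ?_, by simp⟩
    rw [Finset.mem_Iio]
    by_contra! hl
    have := h hl
    simp at this
    linarith [hi.2]
  refine (Finset.card_le_card h1).trans ?_
  simp

theorem fract_sub_of_mem_Ico {a b : ℝ} (ha : 0 ≤ a) (ha1 : a < 1) (hb : 0 ≤ b) (hb1 : b < 1) :
    Int.fract (a - b) = a - b + if a < b then 1 else 0 := by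
  split_ifs with h
  · rw [Int.fract_eq_iff]
    exact ⟨by linarith, by linarith, -1, by push_cast; ring⟩
  · rw [Int.fract_eq_iff]
    exact ⟨by linarith, by linarith, 0, by push_cast; ring⟩

theorem sum_fin_val_eq (n : ℕ) :
    ∑ l : Fin (n + 1), ((l : ℕ) : ℝ) = (n + 1) * n / 2 := by
  induction n with
  | zero => simp
  | succ k ih =>
    rw [Fin.sum_univ_castSucc]
    simp only [Fin.val_castSucc, Fin.val_last]
    rw [ih]
    push_cast
    ring

/-- If no base point makes the sum of the fractional parts small, then the configuration is close
to an equidistributed one. -/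
theorem near_equidistributed_of_le_sum_fract {n : ℕ} (α : Fin (n + 1) → ℝ) (η : ℝ)
    (h : ∀ j, (n : ℝ) / 2 - η ≤ ∑ i, Int.fract (α i - α j)) :
    ∃ (τ : Equiv.Perm (Fin (n + 1))) (k : Fin (n + 1) → ℤ) (θ : ℝ) (β : Fin (n + 1) → ℝ),
      (∀ i, |β i| ≤ η) ∧
      ∀ i, α i = ((τ.symm i : ℕ) : ℝ) / (n + 1) + k i + β i + θ := by
  set f : Fin (n + 1) → ℝ := fun i => Int.fract (α i) with hf
  obtain ⟨τ, hτ⟩ := exists_perm_monotone f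
  set S := ∑ i, f i with hS
  -- For the base index τ l the sum of fractional parts is S - (n+1) f(τ l) + #{i : f i < f (τ l)},
  -- and the count is at most l, with ties allowed. The hypothesis becomes y l ≤ S - n/2 + η. These
  -- n+1 slacks are nonnegative with total (n+1)η, so each is at most (n+1)η.
  set y : Fin (n + 1) → ℝ := fun l => (n + 1) * f (τ l) - (l : ℕ) with hy
  have hn0 : (0 : ℝ) < n + 1 := by positivity
  have hfr : ∀ i j, Int.fract (α i - α j) = f i - f j + if f i < f j then 1 else 0 := by
    intro i j
    rw [← fract_sub_of_mem_Ico (Int.fract_nonneg _) (Int.fract_lt_one _) (Int.fract_nonneg _)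
      (Int.fract_lt_one _)]
    rw [Int.fract_eq_fract]
    refine ⟨⌊α i⌋ - ⌊α j⌋, ?_⟩
    simp only [Int.fract]
    push_cast
    ring
  have hle : ∀ l, y l ≤ S - n / 2 + η := by
    intro l
    have h1 := h (τ l)
    simp only [hfr] at h1
    rw [Finset.sum_add_distrib, Finset.sum_sub_distrib, Finset.sum_boole] at h1
    have h2 : ((Finset.univ.filter fun i => f i < f (τ l)).card : ℝ) ≤ (l : ℕ) := by
      exact_mod_cast card_lt_le_of_monotone hτ l
    simp at h1
    simp only [hy]
    linarith
  have hsum : ∑ l, (S - n / 2 + η - y l) = (n + 1) * η := by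
    simp only [hy, Finset.sum_sub_distrib, ← Finset.mul_sum]
    rw [Equiv.sum_comp τ f, sum_fin_val_eq, ← hS]
    simp
    ring
  have hge : ∀ l, S - n / 2 + η - y l ≤ (n + 1) * η := by
    intro l
    rw [← hsum]
    exact Finset.single_le_sum (f := fun l => S - n / 2 + η - y l)
      (fun i _ => by linarith [hle i]) (Finset.mem_univ l)
  have hη : 0 ≤ η := by
    have := (sub_nonneg.2 (hle 0)).trans (hge 0)
    by_contra! h0
    nlinarith
  -- S - n/2 is the mean of y. The deviation of y from it lies in [-nη, η], which after division by
  -- n+1 is at most η in absolute value.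
  refine ⟨τ, fun i => ⌊α i⌋, (S - n / 2) / (n + 1),
    fun i => f i - ((τ.symm i : ℕ) : ℝ) / (n + 1) - (S - n / 2) / (n + 1), ?_, ?_⟩
  · intro i
    beta_reduce
    have e : f i - ((τ.symm i : ℕ) : ℝ) / (n + 1) - (S - n / 2) / (n + 1) =
        (y (τ.symm i) - (S - n / 2)) / (n + 1) := by
      simp only [hy, Equiv.apply_symm_apply]
      field_simp
    rw [e, abs_div, abs_of_pos hn0, div_le_iff₀ hn0, abs_le]
    have h1 := hle (τ.symm i)
    have h2 := hge (τ.symm i)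
    have h3 : (0 : ℝ) ≤ n := by positivity
    constructor <;> nlinarith
  · intro i
    have : f i = α i - ⌊α i⌋ := rfl
    simp only [this]
    ring

/-! ### Enumerated simplex sets -/

/-- A family `φ_1, …, φ_d` that spans `ℝ^d_0` and has sum `0`. -/
structure IsSimplexFamily (n : ℕ) (φ : Fin (n + 1) → R0 n) : Prop where
  span_eq_top : Submodule.span ℝ (Set.range φ) = ⊤
  sum_eq_zero : ∑ i, φ i = 0

theorem finrank_R0 (n : ℕ) : Module.finrank ℝ (R0 n) = n := by
  let f : (Fin (n + 1) → ℝ) →ₗ[ℝ] ℝ := ∑ i, LinearMap.proj i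
  have hf : ∀ t, f t = ∑ i, t i := fun t => by simp [f]
  have hker : LinearMap.ker f = R0 n := by
    ext t
    rw [LinearMap.mem_ker, hf]
    rfl
  have hsurj : LinearMap.range f = ⊤ := by
    rw [LinearMap.range_eq_top]
    intro r
    refine ⟨Pi.single 0 r, ?_⟩
    rw [hf]
    simp
  have h := LinearMap.finrank_range_add_finrank_ker f
  rw [hsurj, hker, finrank_top] at h
  simp at h
  omega

theorem IsSimplexFamily.exists_coeff {n : ℕ} {φ : Fin (n + 1) → R0 n} (h : IsSimplexFamily n φ)
    (s : R0 n) : ∃ α : Fin (n + 1) → ℝ, s = ∑ i, α i • φ i := by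
  have hs : s ∈ Submodule.span ℝ (Set.range φ) := h.span_eq_top ▸ Submodule.mem_top
  obtain ⟨α, hα⟩ := (Submodule.mem_span_range_iff_exists_fun ℝ).1 hs
  exact ⟨α, hα.symm⟩

/-- The only linear relations in a simplex family are the multiples of `∑ φ_i = 0`. -/
theorem IsSimplexFamily.coeff_eq {n : ℕ} {φ : Fin (n + 1) → R0 n} (h : IsSimplexFamily n φ)
    {a : Fin (n + 1) → ℝ} (ha : ∑ i, a i • φ i = 0) (i j : Fin (n + 1)) : a i = a j := by
  let f : (Fin (n + 1) → ℝ) →ₗ[ℝ] R0 n := Fintype.linearCombination ℝ φ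
  have hf : ∀ t, f t = ∑ i, t i • φ i := fun t => by
    simp [f, Fintype.linearCombination_apply]
  have hsurj : LinearMap.range f = ⊤ := by
    rw [LinearMap.range_eq_top]
    intro s
    obtain ⟨α, hα⟩ := h.exists_coeff s
    exact ⟨α, by rw [hf, hα]⟩
  -- A surjection from dimension n+1 to dimension n has a one-dimensional kernel, here spanned by
  -- (1, ..., 1).
  have hd := LinearMap.finrank_range_add_finrank_ker f
  rw [hsurj, finrank_top, finrank_R0] at hd
  simp at hd
  have h1 : (fun _ => 1 : Fin (n + 1) → ℝ) ∈ LinearMap.ker f := by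
    rw [LinearMap.mem_ker, hf]
    simp [h.sum_eq_zero]
  have h1' : (⟨_, h1⟩ : LinearMap.ker f) ≠ 0 := by
    intro h0
    have := congrFun (congrArg Subtype.val h0) 0
    simp at this
  have h2 : a ∈ LinearMap.ker f := by rw [LinearMap.mem_ker, hf, ha]
  obtain ⟨c, hc⟩ := exists_smul_eq_of_finrank_eq_one (by omega) h1' ⟨a, h2⟩
  have hc' := congrArg Subtype.val hc
  have e : ∀ i, a i = c := fun i => by
    have := congrFun hc' i
    simp at this
    exact this.symm
  rw [e, e]

theorem IsSimplexFamily.coeff_sub_eq {n : ℕ} {φ : Fin (n + 1) → R0 n} (h : IsSimplexFamily n φ)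
    {a b : Fin (n + 1) → ℝ} (hab : ∑ i, a i • φ i = ∑ i, b i • φ i) (i j : Fin (n + 1)) :
    a i - b i = a j - b j := by
  have h0 : ∑ i, (a i - b i) • φ i = 0 := by
    have e : ∀ i, (a i - b i) • φ i = a i • φ i - b i • φ i := fun i => sub_smul (a i) (b i) (φ i)
    rw [Finset.sum_congr rfl fun i _ => e i, Finset.sum_sub_distrib, hab, sub_self]
  exact h.coeff_eq h0 i j

theorem IsSimplexFamily.sum_add_const_smul {n : ℕ} {φ : Fin (n + 1) → R0 n}
    (h : IsSimplexFamily n φ) (a : Fin (n + 1) → ℝ) (θ : ℝ) :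
    ∑ i, (a i + θ) • φ i = ∑ i, a i • φ i := by
  simp only [add_smul, Finset.sum_add_distrib, ← Finset.smul_sum, h.sum_eq_zero, smul_zero,
    add_zero]

/-- The lattice spanned by a family of vectors. -/
abbrev latSpan {n : ℕ} (φ : Fin (n + 1) → R0 n) : Submodule ℤ (R0 n) :=
  Submodule.span ℤ (Set.range φ)

theorem mem_latSpan_iff {n : ℕ} {φ : Fin (n + 1) → R0 n} {t : R0 n} :
    t ∈ latSpan φ ↔ ∃ k : Fin (n + 1) → ℤ, t = ∑ i, (k i : ℝ) • φ i := by
  rw [latSpan, Submodule.mem_span_range_iff_exists_fun]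
  refine exists_congr fun k => ?_
  rw [eq_comm]
  have e : ∀ i, k i • φ i = (k i : ℝ) • φ i := fun i => (Int.cast_smul_eq_zsmul ℝ (k i) (φ i)).symm
  simp only [e]

/-- The point `w_τ` of a simplex family. -/
def wFam {n : ℕ} (φ : Fin (n + 1) → R0 n) (τ : Equiv.Perm (Fin (n + 1))) : R0 n :=
  ∑ i, (((τ.symm i : ℕ) : ℝ) / (n + 1)) • φ i

/-- The w_τ are torsion points modulo the lattice. Multiplying by n+1 therefore turns approximate
identities among them into statements about lattice vectors. -/
theorem smul_wFam_mem {n : ℕ} (φ : Fin (n + 1) → R0 n) (τ : Equiv.Perm (Fin (n + 1))) :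
    ((n : ℝ) + 1) • wFam φ τ ∈ latSpan φ := by
  rw [mem_latSpan_iff]
  refine ⟨fun i => ((τ.symm i : ℕ) : ℤ), ?_⟩
  rw [wFam, Finset.smul_sum]
  refine Finset.sum_congr rfl fun i _ => ?_
  rw [smul_smul]
  congr 1
  have hn0 : (n : ℝ) + 1 ≠ 0 := by positivity
  field_simp
  push_cast
  rfl

/-- A simplex family of vectors of `Δ_x` for which `ℓ(x)` is small. -/
structure IsTightFamily (n : ℕ) (M ξ : ℝ) (x : X n) (φ : Fin (n + 1) → R0 n) : Prop
    extends IsSimplexFamily n φ where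
  mem_Delta : ∀ i, φ i ∈ Delta n x
  coord_le : ∀ i j, (φ i).1 j ≤ ξ
  ell_le : ell n x ≤ M * Real.exp (-((n : ℝ) / 2 * ξ))
  xi_pos : 0 < ξ

theorem IsTightFamily.latSpan_le {n : ℕ} {M ξ : ℝ} {x : X n} {φ : Fin (n + 1) → R0 n}
    (h : IsTightFamily n M ξ x φ) : latSpan φ ≤ Delta n x := by
  rw [Submodule.span_le]
  rintro _ ⟨i, rfl⟩
  exact h.mem_Delta i

theorem IsTightFamily.norm_le {n : ℕ} (hn : 1 ≤ n) {M ξ : ℝ} {x : X n}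
    {φ : Fin (n + 1) → R0 n} (h : IsTightFamily n M ξ x φ) (i : Fin (n + 1)) :
    ‖φ i‖ ≤ n * ξ := norm_le_of_coord_le hn (h.coord_le i)

/-- The times at which the orbit of a tight point is not high in the cusp have nearly
equidistributed coefficients. -/
theorem IsTightFamily.coeff_location {n : ℕ} {M ξ δ : ℝ} {x : X n}
    {φ : Fin (n + 1) → R0 n} (h : IsTightFamily n M ξ x φ) (hM : 0 < M) (hδ : 0 < δ)
    (α : Fin (n + 1) → ℝ) (hα : δ ≤ ell n (aMat n (∑ i, α i • φ i) • x)) :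
    ∃ (τ : Equiv.Perm (Fin (n + 1))) (k : Fin (n + 1) → ℤ) (θ : ℝ) (β : Fin (n + 1) → ℝ),
      (∀ i, |β i| ≤ Real.log (M / δ) / ξ) ∧
      ∀ i, α i = ((τ.symm i : ℕ) : ℝ) / (n + 1) + k i + β i + θ := by
  apply near_equidistributed_of_le_sum_fract
  intro j
  set S := ∑ i, Int.fract (α i - α j)
  -- Shifting all coefficients by -α j changes nothing since ∑ φ_i = 0. Translating by this element
  -- of Δ_x then leaves the fractional parts as coefficients.
  have ht : (∑ i, ((-⌊α i - α j⌋ : ℤ) : ℝ) • φ i) ∈ Delta n x :=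
    h.latSpan_le (mem_latSpan_iff.2 ⟨_, rfl⟩)
  have e : (∑ i, α i • φ i) + (∑ i, ((-⌊α i - α j⌋ : ℤ) : ℝ) • φ i) =
      ∑ i, Int.fract (α i - α j) • φ i := by
    rw [← h.sum_add_const_smul α (-α j), ← Finset.sum_add_distrib]
    refine Finset.sum_congr rfl fun i _ => ?_
    rw [← add_smul]
    congr 1
    rw [Int.fract]
    push_cast
    ring
  rw [← ell_aMat_add_smul ht, e] at hα
  have h1 : ∀ l, (∑ i, Int.fract (α i - α j) • φ i).1 l ≤ S * ξ := by
    intro l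
    have : (∑ i, Int.fract (α i - α j) • φ i).1 l =
        ∑ i, Int.fract (α i - α j) * (φ i).1 l := by
      simp
    rw [this, Finset.sum_mul]
    exact Finset.sum_le_sum fun i _ =>
      mul_le_mul_of_nonneg_left (h.coord_le i l) (Int.fract_nonneg _)
  have h2 := hα.trans (ell_aMat_smul_le h1 x)
  have h3 : δ ≤ M * Real.exp (S * ξ - n / 2 * ξ) := by
    refine h2.trans ((mul_le_mul_of_nonneg_left h.ell_le (Real.exp_pos _).le).trans (le_of_eq ?_))
    rw [sub_eq_add_neg, Real.exp_add]
    ring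
  have h4 : Real.log (M / δ) ≥ -(S * ξ - n / 2 * ξ) := by
    rw [ge_iff_le, Real.le_log_iff_exp_le (by positivity), Real.exp_neg, le_div_iff₀ hδ,
      inv_mul_le_iff₀ (Real.exp_pos _)]
    linarith
  rw [sub_le_comm, le_div_iff₀ h.xi_pos]
  linarith

/-- The coefficient error log(M/δ)/ξ meets vectors of norm at most nξ, so ξ cancels and the
displacement b is bounded independently of x. -/
theorem IsTightFamily.location {n : ℕ} (hn : 1 ≤ n) {M ξ δ : ℝ} {x : X n}
    {φ : Fin (n + 1) → R0 n} (h : IsTightFamily n M ξ x φ) (hM : 0 < M) (hδ : 0 < δ)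
    {s : R0 n} (hs : δ ≤ ell n (aMat n s • x)) :
    ∃ τ, ∃ b : R0 n, ∃ t ∈ latSpan φ, ‖b‖ ≤ (n + 1) * n * Real.log (M / δ) ∧
      s = wFam φ τ + b + t := by
  obtain ⟨α, rfl⟩ := h.exists_coeff s
  obtain ⟨τ, k, θ, β, hβ, hα⟩ := h.coeff_location hM hδ α hs
  refine ⟨τ, ∑ i, β i • φ i, ∑ i, (k i : ℝ) • φ i, mem_latSpan_iff.2 ⟨k, rfl⟩, ?_, ?_⟩
  · have h1 : ∀ i ∈ Finset.univ, ‖β i • φ i‖ ≤ n * Real.log (M / δ) := by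
      intro i _
      rw [norm_smul, Real.norm_eq_abs]
      refine (mul_le_mul (hβ i) (h.norm_le hn i) (norm_nonneg _)
        ((abs_nonneg _).trans (hβ i))).trans (le_of_eq ?_)
      have := h.xi_pos.ne'
      field_simp
    refine (norm_sum_le_of_le _ h1).trans (le_of_eq ?_)
    simp
    ring
  · rw [← h.sum_add_const_smul _ (-θ), wFam, ← Finset.sum_add_distrib, ← Finset.sum_add_distrib]
    refine Finset.sum_congr rfl fun i _ => ?_
    rw [← add_smul, ← add_smul]
    congr 1
    rw [hα i]
    ring

/-! ### Differences of the points `w_τ` -/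

/-- Coefficients are unique up to a common shift, so congruence of the points compares τ⁻¹ i - τ⁻¹ 0
modulo n+1. With τ 0 = τ' 0 = 0 the values lie in [0, n], which leaves no room for a nonzero
multiple of n+1. -/
theorem IsSimplexFamily.perm_eq {n : ℕ} {φ : Fin (n + 1) → R0 n} (h : IsSimplexFamily n φ)
    {τ τ' : Equiv.Perm (Fin (n + 1))} (h0 : τ 0 = 0) (h0' : τ' 0 = 0)
    (hmem : wFam φ τ - wFam φ τ' ∈ latSpan φ) : τ = τ' := by
  obtain ⟨k, hk⟩ := mem_latSpan_iff.1 hmem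
  have e : ∑ i, (((τ.symm i : ℕ) : ℝ) / (n + 1)) • φ i =
      ∑ i, (((τ'.symm i : ℕ) : ℝ) / (n + 1) + k i) • φ i := by
    simp only [add_smul, Finset.sum_add_distrib]
    rw [← hk]
    simp only [wFam]
    abel
  have hs0 : τ.symm 0 = 0 := by rw [Equiv.symm_apply_eq, h0]
  have hs0' : τ'.symm 0 = 0 := by rw [Equiv.symm_apply_eq, h0']
  have hn0 : (n : ℝ) + 1 ≠ 0 := by positivity
  have hsymm : τ.symm = τ'.symm := by
    ext i
    have hi := h.coeff_sub_eq e i 0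
    rw [hs0, hs0'] at hi
    field_simp at hi
    simp at hi
    have hz : ((τ.symm i : ℕ) : ℤ) = (τ'.symm i : ℕ) + (n + 1) * (k i - k 0) := by
      have : (((τ.symm i : ℕ) : ℤ) : ℝ) = (((τ'.symm i : ℕ) + (n + 1) * (k i - k 0) : ℤ) : ℝ) := by
        push_cast
        linarith
      exact_mod_cast this
    have h1 : (τ.symm i : ℕ) < n + 1 := (τ.symm i).2
    have h2 : (τ'.symm i : ℕ) < n + 1 := (τ'.symm i).2
    have h3 : k i - k 0 = 0 := by
      rcases lt_trichotomy (k i - k 0) 0 with h4 | h4 | h4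
      · nlinarith
      · exact h4
      · nlinarith
    rw [h3] at hz
    omega
  exact Equiv.symm_bijective.injective hsymm

/-- A vector whose translation permutes the points `w_τ` modulo the lattice is in the lattice. -/
theorem IsSimplexFamily.mem_of_permutes {n : ℕ} {φ : Fin (n + 1) → R0 n}
    (h : IsSimplexFamily n φ) {t : R0 n}
    (ht : ∀ τ, ∃ τ', wFam φ τ + t - wFam φ τ' ∈ latSpan φ) : t ∈ latSpan φ := by
  obtain ⟨q, rfl⟩ := h.exists_coeff t
  have hn0 : (n : ℝ) + 1 ≠ 0 := by positivity
  have key : ∀ τ : Equiv.Perm (Fin (n + 1)), ∃ τ' : Equiv.Perm (Fin (n + 1)), ∃ k : Fin (n + 1) → ℤ,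
      ∀ i, (n + 1) * (q i - q 0) = (((τ'.symm i : ℕ) - (τ'.symm 0 : ℕ) -
        ((τ.symm i : ℕ) - (τ.symm 0 : ℕ)) + (n + 1) * k i : ℤ) : ℝ) := by
    intro τ
    obtain ⟨τ', hτ'⟩ := ht τ
    obtain ⟨k, hk⟩ := mem_latSpan_iff.1 hτ'
    refine ⟨τ', fun i => k i - k 0, fun i => ?_⟩
    have e : ∑ i, (((τ.symm i : ℕ) : ℝ) / (n + 1) + q i) • φ i =
        ∑ i, (((τ'.symm i : ℕ) : ℝ) / (n + 1) + k i) • φ i := by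
      simp only [add_smul, Finset.sum_add_distrib]
      rw [← hk]
      simp only [wFam]
      abel
    have hi := h.coeff_sub_eq e i 0
    field_simp at hi
    push_cast
    linarith
  -- Any single permutation shows that n+1 times the coefficient differences q i - q 0 are integers.
  obtain ⟨τ₁, k₁, h₁⟩ := key 1
  obtain ⟨Q, hQ⟩ : ∃ Q : Fin (n + 1) → ℤ, ∀ i, (n + 1) * (q i - q 0) = (Q i : ℝ) := ⟨_, h₁⟩
  by_cases hdvd : ∀ i, ((n : ℤ) + 1) ∣ Q i
  · choose k hk using hdvd
    rw [mem_latSpan_iff]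
    refine ⟨k, ?_⟩
    rw [← h.sum_add_const_smul q (-q 0)]
    refine Finset.sum_congr rfl fun i _ => ?_
    congr 1
    have h2 := hQ i
    have h3 : (((n : ℤ) + 1) * k i : ℤ) = Q i := (hk i).symm
    have h4 : ((n : ℝ) + 1) * (q i - q 0) = (n + 1) * k i := by
      rw [h2]
      have : ((Q i : ℤ) : ℝ) = (n + 1) * k i := by rw [← h3]; push_cast; ring
      rw [← this]
    have h5 := mul_left_cancel₀ hn0 h4
    linarith
  · exfalso
    push Not at hdvd
    obtain ⟨i, hi⟩ := hdvd
    have hi0 : i ≠ 0 := by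
      rintro rfl
      apply hi
      have h2 := hQ 0
      rw [sub_self, mul_zero] at h2
      have h3 : Q 0 = 0 := by exact_mod_cast h2.symm
      rw [h3]
      exact dvd_zero _
    have hnz : (0 : ℤ) < n + 1 := by positivity
    have hr0 := Int.emod_nonneg (-Q i) hnz.ne'
    have hr1 := Int.emod_lt_of_pos (-Q i) hnz
    -- The permutation `swap i r` puts i at position r ≡ -Q i modulo n+1 and leaves 0 at position 0.
    -- Translation by t would then give i and 0 the same position, contradicting the injectivity of
    -- τ'⁻¹.
    set r : Fin (n + 1) := ⟨((-Q i) % ((n : ℤ) + 1)).toNat, by omega⟩ with hr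
    have hrv : ((r : ℕ) : ℤ) = (-Q i) % ((n : ℤ) + 1) := by
      simp only [hr]
      omega
    have hrne : r ≠ 0 := by
      intro h0
      have : ((r : ℕ) : ℤ) = 0 := by rw [h0]; simp
      rw [hrv] at this
      exact hi (Int.dvd_neg.1 (Int.dvd_of_emod_eq_zero this))
    obtain ⟨τ', k, hk⟩ := key (Equiv.swap i r)
    have h2 : ((Q i : ℤ) : ℝ) = _ := (hQ i).symm.trans (hk i)
    rw [Int.cast_inj] at h2
    rw [Equiv.symm_swap, Equiv.swap_apply_left,
      Equiv.swap_apply_of_ne_of_ne hi0.symm hrne.symm] at h2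
    have h3 : -Q i = (n + 1) * ((-Q i) / (n + 1)) + (r : ℕ) := by
      rw [hrv]
      exact (Int.mul_ediv_add_emod _ _).symm
    have h4 : ((τ'.symm i : ℕ) : ℤ) - (τ'.symm 0 : ℕ) = (n + 1) * (-(-Q i / (n + 1)) - k i) := by
      simp at h2
      linarith
    have h5 : (τ'.symm i : ℕ) < n + 1 := (τ'.symm i).2
    have h6 : (τ'.symm 0 : ℕ) < n + 1 := (τ'.symm 0).2
    have h7 : -(-Q i / (n + 1)) - k i = 0 := by
      rcases lt_trichotomy (-(-Q i / (n + 1)) - k i) 0 with h8 | h8 | h8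
      · nlinarith
      · exact h8
      · nlinarith
    rw [h7] at h4
    apply hi0
    apply τ'.symm.injective
    apply Fin.ext
    omega

/-! ### Approximation by spanning lattices -/

theorem exists_basis_mem {n : ℕ} {S : Set (R0 n)} (h : Submodule.span ℝ S = ⊤) :
    ∃ b : Module.Basis (Fin n) ℝ (R0 n), ∀ i, b i ∈ S := by
  let b := Module.Basis.ofSpan h.ge
  have : Fintype ((linearIndepOn_empty ℝ (id : R0 n → R0 n)).extend (Set.empty_subset S)) :=
    FiniteDimensional.fintypeBasisIndex b
  have hc := Module.finrank_eq_card_basis b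
  rw [finrank_R0] at hc
  let e := Fintype.equivFinOfCardEq hc.symm
  refine ⟨b.reindex e, fun i => ?_⟩
  rw [Module.Basis.reindex_apply]
  exact Module.Basis.ofSpan_subset h.ge ⟨_, rfl⟩

theorem exists_approx {n : ℕ} {L : Submodule ℤ (R0 n)}
    (h : Submodule.span ℝ (L : Set (R0 n)) = ⊤) :
    ∃ B : ℝ, ∀ u : R0 n, ∃ t ∈ L, ‖u - t‖ ≤ B := by
  obtain ⟨b, hb⟩ := exists_basis_mem h
  refine ⟨∑ i, ‖b i‖, fun u => ⟨ZSpan.floor b u, ?_, ?_⟩⟩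
  · have h1 : Submodule.span ℤ (Set.range b) ≤ L := by
      rw [Submodule.span_le]
      rintro _ ⟨i, rfl⟩
      exact hb i
    exact h1 (ZSpan.floor b u).2
  · rw [← ZSpan.fract_apply]
    exact ZSpan.norm_fract_le b u

theorem coord_sub_le {n : ℕ} (s t : R0 n) (i : Fin (n + 1)) : |s.1 i - t.1 i| ≤ ‖s - t‖ :=
  abs_coord_le_norm (s - t) i

/-- A spanning lattice contains vectors with pairwise distinct coordinates. -/
theorem exists_injective_mem {n : ℕ} {L : Submodule ℤ (R0 n)}
    (h : Submodule.span ℝ (L : Set (R0 n)) = ⊤) : ∃ t ∈ L, Function.Injective t.1 := by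
  obtain ⟨B, hB⟩ := exists_approx h
  have hB0 : 0 ≤ B := (norm_nonneg _).trans (hB 0).choose_spec.2
  -- Coordinates spaced 2B + 1 apart stay distinct after an error of size B. Subtracting n/2 makes
  -- their sum zero.
  let u : R0 n := ⟨fun i => (2 * B + 1) * ((i : ℕ) - (n : ℝ) / 2), by
    change ∑ i : Fin (n + 1), (2 * B + 1) * (((i : ℕ) : ℝ) - (n : ℝ) / 2) = 0
    rw [← Finset.mul_sum, Finset.sum_sub_distrib, sum_fin_val_eq]
    simp
    right
    ring⟩
  obtain ⟨t, ht, htu⟩ := hB u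
  refine ⟨t, ht, fun i j hij => ?_⟩
  have hi := (abs_le.1 ((coord_sub_le u t i).trans htu))
  have hj := (abs_le.1 ((coord_sub_le u t j).trans htu))
  rw [hij] at hi
  have e : ∀ i, u.1 i = (2 * B + 1) * (((i : ℕ) : ℝ) - (n : ℝ) / 2) := fun i => rfl
  rw [e] at hi hj
  by_contra hne
  rcases lt_or_gt_of_ne (fun h => hne (Fin.ext h) : (i : ℕ) ≠ j) with h | h
  · have : ((i : ℕ) : ℝ) + 1 ≤ (j : ℕ) := by exact_mod_cast h
    nlinarith
  · have : ((j : ℕ) : ℝ) + 1 ≤ (i : ℕ) := by exact_mod_cast h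
    nlinarith

/-- If `Δ_x` spans, then no coordinate of a nonzero lattice vector vanishes. -/
theorem coord_ne_zero {n : ℕ} {x : X n} (h : Submodule.span ℝ (Delta n x : Set (R0 n)) = ⊤)
    {v : Fin (n + 1) → ℝ} (hv : v ∈ lattice n x) (h0 : v ≠ 0) (i : Fin (n + 1)) : v i ≠ 0 := by
  intro hi
  obtain ⟨B, hB⟩ := exists_approx h
  obtain ⟨m, hm⟩ : ∃ m : ℝ, Real.exp (-m + B) * ‖v‖ < ell n x := by
    have h1 : Tendsto (fun m : ℝ => Real.exp (-m + B) * ‖v‖) atTop (𝓝 (0 * ‖v‖)) := by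
      refine Tendsto.mul_const _ (Real.tendsto_exp_atBot.comp ?_)
      exact tendsto_atBot_add_const_right _ _ tendsto_neg_atTop_atBot
    rw [zero_mul] at h1
    exact (h1.eventually (gt_mem_nhds (ell_pos x))).exists
  -- Along -m b_i every coordinate except the i-th is contracted by e^{-m}, and the approximation by
  -- Δ_x costs at most e^B. If v i = 0, the image of v is a nonzero lattice vector shorter than
  -- ℓ(x).
  obtain ⟨t, ht, htu⟩ := hB ((-m) • bStar n i)
  obtain ⟨c, hc, hcx⟩ := exists_diagonal_of_mem_Delta ht
  have hmem : (Matrix.diagonal c).mulVec v ∈ lattice n x := by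
    rw [← hcx]
    exact ⟨v, hv, rfl⟩
  have hc0 : ∀ i, c i ≠ 0 := fun i => abs_pos.1 ((hc i).symm ▸ Real.exp_pos _)
  have hne : (Matrix.diagonal c).mulVec v ≠ 0 := by
    intro hz
    apply h0
    funext j
    have := congrFun hz j
    rw [Matrix.mulVec_diagonal] at this
    simpa [hc0 j] using this
  have h2 := ell_le_norm hmem hne
  have h3 : ‖(Matrix.diagonal c).mulVec v‖ ≤ Real.exp (-m + B) * ‖v‖ := by
    rw [pi_norm_le_iff_of_nonneg (by positivity)]
    intro j
    rw [Matrix.mulVec_diagonal, norm_mul]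
    by_cases hji : j = i
    · rw [hji, hi]
      simp
      positivity
    · refine mul_le_mul ?_ (norm_le_pi_norm v j) (norm_nonneg _) (Real.exp_pos _).le
      rw [Real.norm_eq_abs, hc, Real.exp_le_exp]
      have h4 := abs_le.1 ((coord_sub_le _ t j).trans htu)
      have h5 : ((-m) • bStar n i).1 j = -m := by
        change -m * (if j = i then -(n : ℝ) else 1) = -m
        simp [hji]
      rw [h5] at h4
      linarith
  linarith

/-! ### Finiteness of bounded elements of the lattices `Δ_x` -/

/-- An integer matrix representing the action of a diagonal matrix on a lattice. -/
theorem exists_int_conj {n : ℕ} (g k : SLR n) (m : Matrix (Fin (n + 1)) (Fin (n + 1)) ℝ)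
    (h : ∀ v ∈ lattice n (k • stdPoint n), m.mulVec v ∈ lattice n (g • stdPoint n)) :
    ∃ N : Matrix (Fin (n + 1)) (Fin (n + 1)) ℤ,
      (g⁻¹).1 * m * k.1 = N.map (Int.cast : ℤ → ℝ) := by
  apply exists_int_matrix
  intro v hv
  have h1 := h (k.1.mulVec v) (by rw [lattice_smul_stdPoint]; exact ⟨v, hv, rfl⟩)
  rw [lattice_smul_stdPoint] at h1
  obtain ⟨w, hw, hwv⟩ := h1
  rw [← Matrix.mulVec_mulVec, ← Matrix.mulVec_mulVec, ← hwv, Matrix.mulVec_mulVec]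
  have h4 : (g⁻¹).1 * g.1 = 1 := by
    have h : (g⁻¹ * g).1 = (1 : SLR n).1 := by rw [inv_mul_cancel]
    exact h
  rwa [h4, Matrix.one_mulVec]

theorem coe_mul_inv {n : ℕ} (g : SLR n) : g.1 * (g⁻¹).1 = 1 := by
  have h : (g * g⁻¹).1 = (1 : SLR n).1 := by rw [mul_inv_cancel]
  exact h

theorem det_int_map {n : ℕ} (N : Matrix (Fin (n + 1)) (Fin (n + 1)) ℤ) :
    (N.map (Int.cast : ℤ → ℝ)).det = (N.det : ℝ) := by
  have h := (RingHom.map_det (Int.castRingHom ℝ) N).symm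
  exact h

theorem det_conj_eq {n : ℕ} (g k : SLR n) (m : Matrix (Fin (n + 1)) (Fin (n + 1)) ℝ) :
    ((g⁻¹).1 * m * k.1).det = m.det := by
  rw [Matrix.det_mul, Matrix.det_mul, (g⁻¹).2, k.2, one_mul, mul_one]

/-- In a basis of the lattice the diagonal matrix becomes integral, and conjugation preserves the
characteristic polynomial. -/
theorem charpoly_of_diagonal_invariant {n : ℕ} {x : X n} {c : Fin (n + 1) → ℝ}
    (hcx : (Matrix.diagonal c).mulVec '' lattice n x = lattice n x) :
    ∃ p : Polynomial ℤ, p.Monic ∧ p.natDegree = n + 1 ∧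
      p.map (Int.castRingHom ℝ) = ∏ i, (Polynomial.X - Polynomial.C (c i)) := by
  obtain ⟨g, rfl⟩ := exists_smul_stdPoint x
  obtain ⟨N, hN⟩ := exists_int_conj g g (Matrix.diagonal c) (fun v hv => by
    have : (Matrix.diagonal c).mulVec v ∈ (Matrix.diagonal c).mulVec '' lattice n (g • stdPoint n) :=
      ⟨v, hv, rfl⟩
    rwa [hcx] at this)
  refine ⟨N.charpoly, Matrix.charpoly_monic N, by rw [Matrix.charpoly_natDegree_eq_dim]; simp, ?_⟩
  rw [← Matrix.charpoly_map]
  have e : N.map (Int.castRingHom ℝ) = (g⁻¹).1 * Matrix.diagonal c * g.1 := hN.symm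
  rw [e, mul_assoc, Matrix.charpoly_mul_comm, mul_assoc, coe_mul_inv, mul_one,
    Matrix.charpoly_diagonal]

/-- Bounded roots bound the coefficients of the integral characteristic polynomial, so finitely many
polynomials occur, uniformly in x. -/
theorem finite_bounded_diagonal (n : ℕ) (B : ℝ) :
    ∃ F : Set ℝ, F.Finite ∧ ∀ (x : X n) (c : Fin (n + 1) → ℝ),
      (Matrix.diagonal c).mulVec '' lattice n x = lattice n x → (∀ i, |c i| ≤ B) →
      ∀ i, c i ∈ F := by
  set K := max B 1 ^ (n + 1) * ((n + 1).choose ((n + 1) / 2) : ℝ) with hK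
  have hU : {z : ℤ | |(z : ℝ)| ≤ K}.Finite := by
    apply (Set.finite_Icc (-⌈K⌉) ⌈K⌉).subset
    intro z hz
    have h1 := abs_le.1 (show |(z : ℝ)| ≤ K from hz)
    have h2 := Int.le_ceil K
    constructor
    · have : ((-⌈K⌉ : ℤ) : ℝ) ≤ z := by push_cast; linarith
      exact_mod_cast this
    · have : (z : ℝ) ≤ ⌈K⌉ := by linarith
      exact_mod_cast this
  refine ⟨_, Polynomial.bUnion_roots_finite (Int.castRingHom ℝ) (n + 1) hU, ?_⟩
  intro x c hcx hB i
  obtain ⟨p, hp, hdeg, hpc⟩ := charpoly_of_diagonal_invariant hcx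
  have hroots : (∏ i, (Polynomial.X - Polynomial.C (c i))).roots = Finset.univ.val.map c := by
    have h1 := Polynomial.roots_multiset_prod_X_sub_C (Finset.univ.val.map c)
    rwa [Multiset.map_map] at h1
  rw [Set.mem_iUnion₂]
  refine ⟨p, ⟨hdeg.le, fun j => ?_⟩, ?_⟩
  · have h1 := Polynomial.coeff_bdd_of_roots_le (B := B) (d := n + 1) (RingHom.id ℝ)
      (p := p.map (Int.castRingHom ℝ)) (hp.map _) ?_ ?_ ?_ j
    · rw [Polynomial.map_id, Polynomial.coeff_map] at h1
      exact h1
    · rw [Polynomial.map_id, hpc]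
      exact Polynomial.Splits.prod fun i _ => Polynomial.Splits.X_sub_C _
    · rw [hp.natDegree_map, hdeg]
    · rw [Polynomial.map_id, hpc, hroots]
      intro z hz
      obtain ⟨a, -, rfl⟩ := Multiset.mem_map.1 hz
      exact hB a
  · rw [hpc, hroots, Finset.mem_coe, Multiset.mem_toFinset]
    exact Multiset.mem_map.2 ⟨i, Finset.mem_univ_val i, rfl⟩

theorem finite_coords (n : ℕ) (B : ℝ) :
    ∃ P : Set (R0 n), P.Finite ∧ ∀ x, ∀ t ∈ Delta n x, ‖t‖ ≤ B → t ∈ P := by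
  obtain ⟨F, hF, h⟩ := finite_bounded_diagonal n (Real.exp B)
  have hG : ((fun c => Real.log |c|) '' F).Finite := hF.image _
  have hP : (Set.univ.pi fun _ : Fin (n + 1) => (fun c => Real.log |c|) '' F).Finite :=
    Set.Finite.pi fun _ => hG
  refine ⟨Subtype.val ⁻¹' (Set.univ.pi fun _ : Fin (n + 1) => (fun c => Real.log |c|) '' F),
    hP.preimage Subtype.val_injective.injOn, ?_⟩
  intro x t ht htB i _
  obtain ⟨c, hc, hcx⟩ := exists_diagonal_of_mem_Delta ht
  refine ⟨c i, h x c hcx (fun j => ?_) i, ?_⟩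
  · rw [hc, Real.exp_le_exp]
    exact (le_abs_self _).trans ((abs_coord_le_norm t j).trans htB)
  · simp only [hc, Real.log_exp]

/-- The lattices `Δ_x` are uniformly discrete. -/
theorem uniform_discrete (n : ℕ) :
    ∃ r > 0, ∀ x, ∀ t ∈ Delta n x, t ≠ 0 → r ≤ ‖t‖ := by
  obtain ⟨P, hP, h⟩ := finite_coords n 1
  have h1 : ((fun t : R0 n => ‖t‖) '' (P \ {0})).Finite := (hP.subset Set.sdiff_subset).image _
  have h0 : (0 : ℝ) ∉ (fun t : R0 n => ‖t‖) '' (P \ {0}) := by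
    rintro ⟨t, ht, h2⟩
    exact ht.2 (norm_eq_zero.1 h2)
  obtain ⟨ε, hε, hball⟩ := Metric.isOpen_iff.1 h1.isClosed.isOpen_compl 0 h0
  refine ⟨min ε 1, lt_min hε one_pos, fun x t ht ht0 => ?_⟩
  by_contra! hlt
  have h2 := h x t ht (hlt.le.trans (min_le_right _ _))
  have h3 : ‖t‖ ∈ Metric.ball (0 : ℝ) ε := by
    rw [mem_ball_zero_iff, norm_norm]
    exact hlt.trans_le (min_le_left _ _)
  exact hball h3 ⟨t, ⟨h2, ht0⟩, rfl⟩

/-! ### Finiteness of the set of orbits with bounded multipliers -/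

/-- Minkowski's theorem for unimodular lattices. -/
theorem exists_short_vector {n : ℕ} (x : X n) : ∃ v ∈ lattice n x, v ≠ 0 ∧ ‖v‖ ≤ 2 := by
  obtain ⟨g, rfl⟩ := exists_smul_stdPoint x
  let b := Pi.basisFun ℝ (Fin (n + 1))
  let f : (Fin (n + 1) → ℝ) →ₗ[ℝ] (Fin (n + 1) → ℝ) := Matrix.toLin' g.1
  have hfdet : LinearMap.det f = 1 := by
    rw [LinearMap.det_toLin']
    exact g.2
  have hf : ∀ v, f v = g.1.mulVec v := fun v => rfl
  have hfund := ZSpan.isAddFundamentalDomain' b (volume : Measure (Fin (n + 1) → ℝ))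
  -- The sup-norm ball of radius 2 has volume 4^{n+1}, strictly above the threshold 2^{n+1}.
  have hvol : volume (ZSpan.fundamentalDomain b) * 2 ^ Module.finrank ℝ (Fin (n + 1) → ℝ) <
      volume (f ⁻¹' Metric.ball 0 2) := by
    rw [Measure.addHaar_preimage_linearMap _ (by rw [hfdet]; exact one_ne_zero), hfdet,
      Real.volume_pi_ball _ two_pos, ZSpan.volume_fundamentalDomain]
    have h1 : (Matrix.of b).det = 1 := by
      have : Matrix.of b = 1 := by
        ext i j
        simp [b, Matrix.one_apply, Pi.single_apply, eq_comm]
      rw [this, Matrix.det_one]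
    rw [h1]
    simp only [abs_one, ENNReal.ofReal_one, one_mul, inv_one, Module.finrank_fintype_fun_eq_card,
      Fintype.card_fin]
    have h2 : ((2 : ENNReal) ^ (n + 1)) = ENNReal.ofReal (2 ^ (n + 1)) := by
      rw [ENNReal.ofReal_pow two_pos.le]
      simp
    rw [h2]
    apply (ENNReal.ofReal_lt_ofReal_iff (by positivity)).2
    exact pow_lt_pow_left₀ (by norm_num) two_pos.le (by omega)
  have hconv : Convex ℝ (f ⁻¹' Metric.ball 0 2) := (convex_ball 0 2).linear_preimage f
  have hsymm : ∀ v ∈ f ⁻¹' Metric.ball 0 2, -v ∈ f ⁻¹' Metric.ball 0 2 := by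
    intro v hv
    rw [Set.mem_preimage, mem_ball_zero_iff] at *
    rwa [map_neg, norm_neg]
  have hcount : Countable (Submodule.span ℤ (Set.range b)).toAddSubgroup :=
    inferInstanceAs (Countable (Submodule.span ℤ (Set.range b)))
  obtain ⟨⟨z, hz⟩, hz0, hzS⟩ :=
    exists_ne_zero_mem_lattice_of_measure_mul_two_pow_lt_measure hfund hsymm hconv hvol
  refine ⟨g.1.mulVec z, ?_, ?_, ?_⟩
  · rw [lattice_smul_stdPoint]
    refine ⟨z, ?_, rfl⟩
    obtain ⟨k, hk⟩ := (Submodule.mem_span_range_iff_exists_fun ℤ).1 hz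
    refine ⟨k, ?_⟩
    rw [← hk]
    funext i
    simp [b, Finset.sum_apply, Pi.single_apply]
  · intro h
    rw [← Matrix.mulVec_zero g.1] at h
    apply hz0
    apply Subtype.ext
    exact mulVec_injective g h
  · rw [Set.mem_preimage, mem_ball_zero_iff] at hzS
    exact hzS.le

theorem matrix_mulVec_mem_lattice {n : ℕ} {x : X n} (V : Matrix (Fin (n + 1)) (Fin (n + 1)) ℝ)
    (h : ∀ j, (fun i => V i j) ∈ lattice n x) {v : Fin (n + 1) → ℝ} (hv : v ∈ intVecs n) :
    V.mulVec v ∈ lattice n x := by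
  obtain ⟨g, rfl⟩ := exists_smul_stdPoint x
  rw [lattice_smul_stdPoint] at *
  choose w hw hwv using h
  choose z hz using hw
  obtain ⟨k, rfl⟩ := hv
  refine ⟨fun i => ∑ j, (z j i : ℝ) * k j, ⟨fun i => ∑ j, z j i * k j, by funext i; simp⟩, ?_⟩
  have e : V = g.1 * Matrix.of fun i j => (z j i : ℝ) := by
    ext i j
    have := congrFun (hwv j) i
    rw [← hz j] at this
    rw [← this]
    rfl
  rw [e, ← Matrix.mulVec_mulVec]
  rfl

theorem diagonal_mul_vandermonde_mem {n : ℕ} {x : X n} {c v : Fin (n + 1) → ℝ}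
    (hcx : (Matrix.diagonal c).mulVec '' lattice n x = lattice n x) (hv : v ∈ lattice n x) (j : ℕ) :
    (fun i => v i * c i ^ j) ∈ lattice n x := by
  induction j with
  | zero => simpa using hv
  | succ k ih =>
    have h : (Matrix.diagonal c).mulVec (fun i => v i * c i ^ k) ∈ lattice n x := by
      rw [← hcx]
      exact ⟨_, ih, rfl⟩
    convert h using 1
    funext i
    rw [Matrix.mulVec_diagonal]
    ring

/-- The sets `adj(N) ℤ^d`, where `N` is an integer matrix of determinant `D`. -/
def adjImages (n : ℕ) (D : ℤ) : Set (Set (Fin (n + 1) → ℤ)) :=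
  {T | ∃ N : Matrix (Fin (n + 1)) (Fin (n + 1)) ℤ, N.det = D ∧ T = Set.range N.adjugate.mulVec}

/-- Since adj(N) N = D, the image of adj(N) contains Dℤ^d. It is thus determined by its reduction
modulo D, which yields the finiteness in `finite_adjImages`. -/
theorem adjImages_add_mem {n : ℕ} {D : ℤ} {T : Set (Fin (n + 1) → ℤ)} (hT : T ∈ adjImages n D)
    {y : Fin (n + 1) → ℤ} (hy : y ∈ T) (w : Fin (n + 1) → ℤ) : y + D • w ∈ T := by
  obtain ⟨N, rfl, rfl⟩ := hT
  obtain ⟨z, rfl⟩ := hy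
  refine ⟨z + N.mulVec w, ?_⟩
  rw [Matrix.mulVec_add, Matrix.mulVec_mulVec, Matrix.adjugate_mul, Matrix.smul_mulVec,
    Matrix.one_mulVec]

theorem finite_adjImages (n : ℕ) {D : ℤ} (hD : D ≠ 0) : (adjImages n D).Finite := by
  have : NeZero D.natAbs := ⟨Int.natAbs_ne_zero.2 hD⟩
  let r : (Fin (n + 1) → ℤ) → (Fin (n + 1) → ZMod D.natAbs) := fun y i => (y i : ZMod D.natAbs)
  have hr : ∀ y y', r y = r y' → ∃ w : Fin (n + 1) → ℤ, y' = y + D • w := by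
    intro y y' h
    have h1 : ∀ i, ∃ w, y' i - y i = D * w := by
      intro i
      have h2 : ((y i : ℤ) : ZMod D.natAbs) = y' i := congrFun h i
      rw [ZMod.intCast_eq_intCast_iff_dvd_sub, Int.natCast_natAbs, abs_dvd] at h2
      exact h2
    choose w hw using h1
    refine ⟨w, ?_⟩
    funext i
    have := hw i
    simp
    linarith
  apply Set.Finite.of_injOn (f := fun T => r '' T) (t := Set.univ) (fun _ _ => Set.mem_univ _) _
    Set.finite_univ
  have key : ∀ T ∈ adjImages n D, ∀ T' ∈ adjImages n D, r '' T = r '' T' → T ⊆ T' := by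
    intro T _ T' hT' h y hy
    have h1 : r y ∈ r '' T' := by
      rw [← h]
      exact ⟨y, hy, rfl⟩
    obtain ⟨y', hy', e⟩ := h1
    obtain ⟨w, rfl⟩ := hr _ _ e
    exact adjImages_add_mem hT' hy' w
  intro T hT T' hT' h
  exact (key T hT T' hT' h).antisymm (key T' hT' T hT h.symm)

/-- Lattices invariant under a diagonal matrix with distinct entries are, up to the diagonal group,
given by finitely many data. -/
theorem exists_adjImages {n : ℕ} {x : X n} {c : Fin (n + 1) → ℝ} (hc : Function.Injective c)
    (hcx : (Matrix.diagonal c).mulVec '' lattice n x = lattice n x)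
    (hnz : ∀ v ∈ lattice n x, v ≠ 0 → ∀ i, v i ≠ 0) :
    ∃ D : ℤ, D ≠ 0 ∧ |(D : ℝ)| ≤ 2 ^ (n + 1) * |(Matrix.vandermonde c).det| ∧
      ∃ T ∈ adjImages n D, ∃ v : Fin (n + 1) → ℝ, (∀ i, v i ≠ 0) ∧
        lattice n x = (Matrix.diagonal v).mulVec '' ((fun z : Fin (n + 1) → ℤ =>
          (D : ℝ)⁻¹ • (Matrix.vandermonde c).mulVec fun i => (z i : ℝ)) '' T) := by
  obtain ⟨v, hv, hv0, hv2⟩ := exists_short_vector x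
  have hvi := hnz v hv hv0
  obtain ⟨g, rfl⟩ := exists_smul_stdPoint x
  -- The columns of V are the images of the short vector v under the powers of diag(c), so Vℤ^d is a
  -- sublattice. Its index |det N| is nonzero since the c i are distinct and no v i vanishes, and it
  -- is bounded since |v i| ≤ 2.
  set V := Matrix.diagonal v * Matrix.vandermonde c with hV
  obtain ⟨N, hN⟩ := exists_int_conj g (1 : SLR n) V (fun w hw => by
    rw [one_smul, lattice_stdPoint] at hw
    apply matrix_mulVec_mem_lattice _ _ hw
    intro j
    convert diagonal_mul_vandermonde_mem hcx hv (j : ℕ) using 1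
    funext i
    rw [hV, Matrix.diagonal_mul, Matrix.vandermonde_apply])
  have hdet : (N.det : ℝ) = (∏ i, v i) * (Matrix.vandermonde c).det := by
    rw [← det_int_map, ← hN, det_conj_eq, hV, Matrix.det_mul, Matrix.det_diagonal]
  have hD : (N.det : ℝ) ≠ 0 := by
    rw [hdet]
    exact mul_ne_zero (Finset.prod_ne_zero_iff.2 fun i _ => hvi i)
      (Matrix.det_vandermonde_ne_zero_iff.2 hc)
  have hgN : g.1 * N.map (Int.cast : ℤ → ℝ) = V := by
    rw [← hN]
    have : (1 : SLR n).1 = 1 := rfl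
    rw [this, mul_one, ← mul_assoc, coe_mul_inv, one_mul]
  have hadj : N.map (Int.cast : ℤ → ℝ) * N.adjugate.map (Int.cast : ℤ → ℝ) =
      (N.det : ℝ) • 1 := by
    have h := congrArg (fun m => m.map (Int.castRingHom ℝ)) (Matrix.mul_adjugate N)
    simp only [Matrix.map_mul] at h
    refine h.trans ?_
    ext i j
    change ((N.det * (1 : Matrix _ _ ℤ) i j : ℤ) : ℝ) = N.det * (1 : Matrix _ _ ℝ) i j
    rw [Matrix.one_apply, Matrix.one_apply]
    split_ifs <;> simp
  have hg : g.1 = (N.det : ℝ)⁻¹ • (V * N.adjugate.map (Int.cast : ℤ → ℝ)) := by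
    rw [← hgN, mul_assoc, hadj, mul_smul_comm, mul_one, smul_smul, inv_mul_cancel₀ hD, one_smul]
  refine ⟨N.det, by exact_mod_cast hD, ?_, Set.range N.adjugate.mulVec, ⟨N, rfl, rfl⟩, v, hvi, ?_⟩
  · rw [hdet, abs_mul]
    refine mul_le_mul_of_nonneg_right ?_ (abs_nonneg _)
    rw [Finset.abs_prod]
    refine (Finset.prod_le_prod (fun i _ => abs_nonneg _) fun i _ =>
      (norm_le_pi_norm v i).trans hv2).trans ?_
    simp
  · rw [lattice_smul_stdPoint, intVecs, ← Set.range_comp, ← Set.range_comp, ← Set.range_comp]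
    congr 1
    funext z
    have e : (fun i => ((N.adjugate.mulVec z i : ℤ) : ℝ)) =
        (N.adjugate.map (Int.cast : ℤ → ℝ)).mulVec fun i => (z i : ℝ) := by
      funext i
      simp [Matrix.mulVec, dotProduct]
    simp only [Function.comp_apply, e]
    rw [hg, hV, Matrix.smul_mulVec, Matrix.mulVec_smul]
    simp only [Matrix.mulVec_mulVec, mul_assoc]

theorem abs_det_eq_one {n : ℕ} {x y : X n} {u : Fin (n + 1) → ℝ} (hu : ∀ i, u i ≠ 0)
    (h : lattice n x = (Matrix.diagonal u).mulVec '' lattice n y) : |∏ i, u i| = 1 := by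
  obtain ⟨g, rfl⟩ := exists_smul_stdPoint x
  obtain ⟨k, rfl⟩ := exists_smul_stdPoint y
  obtain ⟨N, hN⟩ := exists_int_conj g k (Matrix.diagonal u) (fun v hv => by
    rw [h]
    exact ⟨v, hv, rfl⟩)
  obtain ⟨N', hN'⟩ := exists_int_conj k g (Matrix.diagonal fun i => (u i)⁻¹) (fun v hv => by
    rw [h] at hv
    obtain ⟨w, hw, rfl⟩ := hv
    rw [Matrix.mulVec_mulVec, Matrix.diagonal_mul_diagonal]
    simpa [hu] using hw)
  have h1 : (N.det : ℝ) = ∏ i, u i := by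
    rw [← det_int_map, ← hN, det_conj_eq, Matrix.det_diagonal]
  have h2 : (N'.det : ℝ) = ∏ i, (u i)⁻¹ := by
    rw [← det_int_map, ← hN', det_conj_eq, Matrix.det_diagonal]
  have h3 : N.det * N'.det = 1 := by
    have : (N.det : ℝ) * N'.det = 1 := by
      rw [h1, h2, ← Finset.prod_mul_distrib]
      exact Finset.prod_eq_one fun i _ => mul_inv_cancel₀ (hu i)
    exact_mod_cast this
  have h4 : |N.det| = 1 := Int.isUnit_iff_abs_eq.1 (IsUnit.of_mul_eq_one _ h3)
  rw [← h1]
  exact_mod_cast h4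

theorem orbitA_eq_of_lattice_eq {n : ℕ} {x y : X n} {u : Fin (n + 1) → ℝ} (hu : ∀ i, 0 < u i)
    (h : lattice n x = (Matrix.diagonal u).mulVec '' lattice n y) : orbitA n x = orbitA n y := by
  have h1 := abs_det_eq_one (fun i => (hu i).ne') h
  rw [abs_of_pos (Finset.prod_pos fun i _ => hu i)] at h1
  let g : SLR n := ⟨Matrix.diagonal u, by rw [Matrix.det_diagonal, h1]⟩
  have hg : g ∈ A n := ⟨u, hu, rfl⟩
  have hx : x = g • y := lattice_injective (by rw [lattice_smul]; exact h)
  rw [hx]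
  exact MulAction.orbit_smul (⟨g, hg⟩ : A n) y

/-- Once D, the set adj(N)ℤ^d and the signs of v are fixed, two such lattices differ by a positive
diagonal matrix, which automatically has determinant 1. Each of the finitely many data thus gives at
most one orbit. -/
theorem finite_orbits_of_diagonal {n : ℕ} {c : Fin (n + 1) → ℝ} (hc : Function.Injective c) :
    {O | ∃ x : X n, O = orbitA n x ∧
      (Matrix.diagonal c).mulVec '' lattice n x = lattice n x ∧
      ∀ v ∈ lattice n x, v ≠ 0 → ∀ i, v i ≠ 0}.Finite := by
  set K := 2 ^ (n + 1) * |(Matrix.vandermonde c).det| with hK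
  have hU : {D : ℤ | D ≠ 0 ∧ |(D : ℝ)| ≤ K}.Finite := by
    apply (Set.finite_Icc (-⌈K⌉) ⌈K⌉).subset
    rintro z ⟨-, hz⟩
    have h1 := abs_le.1 hz
    have h2 := Int.le_ceil K
    constructor
    · have : ((-⌈K⌉ : ℤ) : ℝ) ≤ z := by push_cast; linarith
      exact_mod_cast this
    · have : (z : ℝ) ≤ ⌈K⌉ := by linarith
      exact_mod_cast this
  let piece (D : ℤ) (T : Set (Fin (n + 1) → ℤ)) (σ : Fin (n + 1) → Prop) : Set (Set (X n)) :=
    {O | ∃ x : X n, O = orbitA n x ∧ ∃ v : Fin (n + 1) → ℝ, (∀ i, v i ≠ 0) ∧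
      (∀ i, 0 < v i ↔ σ i) ∧
      lattice n x = (Matrix.diagonal v).mulVec '' ((fun z : Fin (n + 1) → ℤ =>
          (D : ℝ)⁻¹ • (Matrix.vandermonde c).mulVec fun i => (z i : ℝ)) '' T)}
  have hpiece : ∀ D T σ, (piece D T σ).Subsingleton := by
    rintro D T σ _ ⟨x, rfl, v, hv, hvσ, hx⟩ _ ⟨y, rfl, w, hw, hwσ, hy⟩
    apply orbitA_eq_of_lattice_eq (u := fun i => v i / w i)
    · intro i
      by_cases hσ : σ i
      · exact div_pos ((hvσ i).2 hσ) ((hwσ i).2 hσ)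
      · exact div_pos_of_neg_of_neg
          (lt_of_le_of_ne (not_lt.1 fun h => hσ ((hvσ i).1 h)) (hv i))
          (lt_of_le_of_ne (not_lt.1 fun h => hσ ((hwσ i).1 h)) (hw i))
    · rw [hx, hy, ← Set.image_comp (Matrix.diagonal fun i => v i / w i).mulVec]
      congr 1
      funext z
      simp only [Function.comp_apply, Matrix.mulVec_mulVec, Matrix.diagonal_mul_diagonal]
      congr 2
      funext i
      rw [div_mul_cancel₀ _ (hw i)]
  have hfin : (⋃ D ∈ {D : ℤ | D ≠ 0 ∧ |(D : ℝ)| ≤ K}, ⋃ T ∈ adjImages n D, ⋃ σ,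
      piece D T σ).Finite :=
    hU.biUnion fun D hD => (finite_adjImages n hD.1).biUnion fun T _ =>
      Set.finite_iUnion fun σ => (hpiece D T σ).finite
  refine hfin.subset ?_
  rintro _ ⟨x, rfl, hcx, hnz⟩
  obtain ⟨D, hD, hDK, T, hT, v, hv, hx⟩ := exists_adjImages hc hcx hnz
  simp only [Set.mem_iUnion]
  exact ⟨D, ⟨hD, hDK⟩, T, hT, fun i => 0 < v i, x, rfl, v, hv, fun i => Iff.rfl, hx⟩

theorem span_int_subset_real {n : ℕ} (S : Set (R0 n)) :
    Submodule.span ℝ ((Submodule.span ℤ S : Submodule ℤ (R0 n)) : Set (R0 n)) =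
      Submodule.span ℝ S :=
  Submodule.span_span_of_tower ℤ ℝ S

/-- There are only finitely many orbits `Ax` for which the elements of `Δ_x` of norm at most `B`
span. -/
theorem finite_orbits_of_span_bounded (n : ℕ) (B : ℝ) :
    {O | ∃ x : X n, O = orbitA n x ∧
      Submodule.span ℝ ((Delta n x : Set (R0 n)) ∩ Metric.closedBall 0 B) = ⊤}.Finite := by
  obtain ⟨P, hP, hPB⟩ := finite_coords n B
  let good : Set (Set (R0 n)) := {S | S ⊆ P ∧ Submodule.span ℝ S = ⊤}
  have hgood : good.Finite := hP.finite_subsets.subset fun S hS => hS.1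
  -- The vector t is chosen from S alone and not from x. Finitely many sets S then give finitely
  -- many diagonal matrices, signs included.
  have hex : ∀ S : Set (R0 n), ∃ t : R0 n, S ∈ good →
      t ∈ Submodule.span ℤ S ∧ Function.Injective t.1 := by
    intro S
    by_cases hS : S ∈ good
    · obtain ⟨t, ht, hi⟩ := exists_injective_mem (L := Submodule.span ℤ S)
        (by rw [span_int_subset_real]; exact hS.2)
      exact ⟨t, fun _ => ⟨ht, hi⟩⟩
    · exact ⟨0, fun h => absurd h hS⟩
  choose t ht using hex
  let c (S : Set (R0 n)) (σ : Fin (n + 1) → Bool) : Fin (n + 1) → ℝ :=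
    fun i => if σ i then Real.exp ((t S).1 i) else -Real.exp ((t S).1 i)
  have habs : ∀ S σ i, |c S σ i| = Real.exp ((t S).1 i) := by
    intro S σ i
    simp only [c]
    split_ifs
    · exact abs_of_pos (Real.exp_pos _)
    · rw [abs_neg, abs_of_pos (Real.exp_pos _)]
  have hinj : ∀ S ∈ good, ∀ σ, Function.Injective (c S σ) := by
    intro S hS σ i j hij
    have h1 := habs S σ i
    rw [hij, habs, Real.exp_eq_exp] at h1
    exact ((ht S hS).2 h1).symm
  have hfin : (⋃ S ∈ good, ⋃ σ, {O | ∃ x : X n, O = orbitA n x ∧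
      (Matrix.diagonal (c S σ)).mulVec '' lattice n x = lattice n x ∧
      ∀ v ∈ lattice n x, v ≠ 0 → ∀ i, v i ≠ 0}).Finite :=
    hgood.biUnion fun S hS => Set.finite_iUnion fun σ => finite_orbits_of_diagonal (hinj S hS σ)
  refine hfin.subset ?_
  rintro _ ⟨x, rfl, hx⟩
  have hS : ((Delta n x : Set (R0 n)) ∩ Metric.closedBall 0 B) ∈ good :=
    ⟨fun s hs => hPB x s hs.1 (mem_closedBall_zero_iff.1 hs.2), hx⟩
  set S := (Delta n x : Set (R0 n)) ∩ Metric.closedBall 0 B with hSdef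
  have htx : t S ∈ Delta n x :=
    (Submodule.span_le (p := Delta n x)).2 Set.inter_subset_left (ht S hS).1
  obtain ⟨e, he, hex⟩ := exists_diagonal_of_mem_Delta htx
  have hspan : Submodule.span ℝ (Delta n x : Set (R0 n)) = ⊤ :=
    top_unique (hx.ge.trans (Submodule.span_mono Set.inter_subset_left))
  simp only [Set.mem_iUnion]
  refine ⟨S, hS, fun i => decide (0 < e i), x, rfl, ?_, fun v hv h0 => coord_ne_zero hspan hv h0⟩
  have hce : c S (fun i => decide (0 < e i)) = e := by
    funext i
    simp only [c, decide_eq_true_eq]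
    rw [← he]
    split_ifs with h
    · exact abs_of_pos h
    · rw [abs_of_nonpos (not_lt.1 h), neg_neg]
  rw [hce, hex]

/-! ### Finiteness of the set of orbits of bounded covolume -/

/-- The linear equivalence `ℝ^n ≃ ℝ^d_0` underlying `graphMap`. -/
def graphEquiv (n : ℕ) : (Fin n → ℝ) ≃ₗ[ℝ] R0 n where
  toFun := graphMap n
  map_add' s t := by
    apply Subtype.ext
    funext i
    refine Fin.lastCases ?_ (fun j => ?_) i
    · simp [graphMap, Finset.sum_add_distrib]
      ring
    · simp [graphMap]
  map_smul' c s := by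
    apply Subtype.ext
    funext i
    refine Fin.lastCases ?_ (fun j => ?_) i
    · simp [graphMap, Finset.mul_sum]
    · simp [graphMap]
  invFun t := fun i => t.1 i.castSucc
  left_inv s := by
    funext i
    simp [graphMap]
  right_inv t := by
    apply Subtype.ext
    funext i
    refine Fin.lastCases ?_ (fun j => ?_) i
    · have h : ∑ i, t.1 i = 0 := t.2
      rw [Fin.sum_univ_castSucc] at h
      simp [graphMap]
      linarith
    · simp [graphMap]

instance isAddHaarMeasure_vol0 (n : ℕ) : (vol0 n).IsAddHaarMeasure := by
  have h : (Measure.map (graphMap n) volume).IsAddHaarMeasure :=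
    (graphEquiv n).toContinuousLinearEquiv.isAddHaarMeasure_map volume
  apply Measure.IsAddHaarMeasure.smul
  · simp
    positivity
  · exact ENNReal.ofReal_ne_top

instance discreteTopology_Delta {n : ℕ} (x : X n) : DiscreteTopology (Delta n x) := by
  obtain ⟨r, hr, h⟩ := uniform_discrete n
  apply discreteTopology_of_isOpen_singleton_zero
  rw [Metric.isOpen_iff]
  rintro t ht
  rw [Set.mem_singleton_iff] at ht
  subst ht
  refine ⟨r, hr, fun s hs => ?_⟩
  rw [mem_ball_zero_iff] at hs
  by_contra h0
  have h1 := h x s.1 s.2 (fun h2 => h0 (Subtype.ext h2))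
  exact absurd hs (not_lt.2 h1)

/-- Blichfeldt's principle for a uniformly discrete lattice of bounded covolume: it is spanned by
vectors of bounded norm. -/
theorem exists_span_bounded_of_covol_le (n : ℕ) (V : ℝ) :
    ∃ B : ℝ, ∀ x : X n, Submodule.span ℝ (Delta n x : Set (R0 n)) = ⊤ →
      covol n (Delta n x) ≤ V →
      Submodule.span ℝ ((Delta n x : Set (R0 n)) ∩ Metric.closedBall 0 B) = ⊤ := by
  obtain ⟨r, hr, hdisc⟩ := uniform_discrete n
  have hm : vol0 n (Metric.ball 0 (r / 2)) ≠ 0 :=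
    (Metric.measure_ball_pos (vol0 n) 0 (half_pos hr)).ne'
  obtain ⟨J, hJ⟩ := ENNReal.exists_nat_mul_gt hm (ENNReal.ofReal_ne_top (r := V))
  -- J disjoint balls of radius r/2 have total volume above V. Their centres will be spaced 4r apart
  -- on a line, so a difference of two of their points has norm at most 4rJ + r.
  refine ⟨r + 4 * r * J, fun x hspan hV => ?_⟩
  by_contra hne
  set W := Submodule.span ℝ ((Delta n x : Set (R0 n)) ∩ Metric.closedBall 0 (r + 4 * r * J))
  -- The balls are placed along a direction u that stays far from the span W of the bounded
  -- elements.
  obtain ⟨u₀, hu₀, hu₀W⟩ := riesz_lemma (F := W) W.closed_of_finiteDimensional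
    (by
      by_contra! h
      exact hne (top_unique fun y _ => h y)) (r := 1 / 2) (by norm_num)
  have hu₀0 : 0 < ‖u₀‖ := by
    rw [norm_pos_iff]
    rintro rfl
    exact hu₀ W.zero_mem
  set u := (‖u₀‖)⁻¹ • u₀ with hu
  have hu1 : ‖u‖ = 1 := by
    rw [hu, norm_smul, norm_inv, norm_norm, inv_mul_cancel₀ hu₀0.ne']
  have hfar : ∀ (a : ℝ), ∀ w ∈ W, |a| / 2 ≤ ‖a • u - w‖ := by
    intro a w hw
    rcases eq_or_ne a 0 with rfl | ha
    · simp
    have e : a • u - w = (a * (‖u₀‖)⁻¹) • (u₀ - (‖u₀‖ * a⁻¹) • w) := by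
      have key : (a * (‖u₀‖)⁻¹) • (‖u₀‖ * a⁻¹) • w = w := by
        rw [smul_smul, show a * ‖u₀‖⁻¹ * (‖u₀‖ * a⁻¹) = 1 by field_simp, one_smul]
      rw [smul_sub, key, hu, smul_smul]
    have h1 := hu₀W _ (W.smul_mem (‖u₀‖ * a⁻¹) hw)
    rw [e, norm_smul, norm_mul, norm_inv, norm_norm, Real.norm_eq_abs]
    refine le_trans (le_of_eq ?_) (mul_le_mul_of_nonneg_left h1 (by positivity))
    field_simp
  have hL : IsZLattice ℝ (Delta n x) := ⟨hspan⟩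
  have hfund := ZLattice.isAddFundamentalDomain
    (Module.Free.chooseBasis ℤ (Delta n x)) (vol0 n)
  have hcov := ZLattice.covolume_eq_measure_fundamentalDomain (Delta n x) (vol0 n) hfund
  set F := ZSpan.fundamentalDomain ((Module.Free.chooseBasis ℤ (Delta n x)).ofZLatticeBasis ℝ)
  have hF : vol0 n F ≤ ENNReal.ofReal V := by
    have h1 : vol0 n F ≠ ⊤ :=
      (Bornology.IsBounded.measure_lt_top (ZSpan.fundamentalDomain_isBounded _)).ne
    rw [← ENNReal.ofReal_toReal h1]
    exact ENNReal.ofReal_le_ofReal (hcov.symm.le.trans hV)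
  let T : Set (R0 n) := ⋃ j ∈ Finset.range J, Metric.ball ((4 * r * (j : ℝ)) • u) (r / 2)
  have hT : vol0 n T = J * vol0 n (Metric.ball 0 (r / 2)) := by
    rw [measure_biUnion_finset]
    · simp [Measure.addHaar_ball_center]
    · intro i _ j _ hij
      apply Metric.ball_disjoint_ball
      rw [dist_eq_norm, ← sub_smul (4 * r * (i : ℝ)) (4 * r * (j : ℝ)) u, norm_smul, hu1, mul_one, ← mul_sub, norm_mul,
        Real.norm_eq_abs, Real.norm_eq_abs, abs_of_pos (by positivity : 0 < 4 * r)]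
      have h1 : (1 : ℝ) ≤ |(i : ℝ) - j| := by
        have : (1 : ℤ) ≤ |(i : ℤ) - j| := Int.one_le_abs (sub_ne_zero.2 (by exact_mod_cast hij))
        exact_mod_cast this
      nlinarith
    · exact fun _ _ => Metric.isOpen_ball.measurableSet
  have hlt : vol0 n F < vol0 n T := by
    rw [hT]
    exact hF.trans_lt hJ
  have hTm : MeasurableSet T :=
    Finset.measurableSet_biUnion _ fun _ _ => Metric.isOpen_ball.measurableSet
  have i1 : MeasurableVAdd (Delta n x) (R0 n) :=
    (inferInstance : MeasurableVAdd (Delta n x).toAddSubgroup (R0 n))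
  have i2 : VAddInvariantMeasure (Delta n x) (R0 n) (vol0 n) :=
    (inferInstance : VAddInvariantMeasure (Delta n x).toAddSubgroup (R0 n) (vol0 n))
  obtain ⟨p, q, hpq, hdis⟩ :=
    exists_pair_mem_lattice_not_disjoint_vadd hfund hTm.nullMeasurableSet hlt
  obtain ⟨_, ⟨a, ha, rfl⟩, b, hb, hab⟩ := Set.not_disjoint_iff.1 hdis
  simp only [T, Set.mem_iUnion, Finset.mem_range] at ha hb
  obtain ⟨i, hi, ha⟩ := ha
  obtain ⟨j, hj, hb⟩ := hb
  rw [mem_ball_iff_norm] at ha hb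
  have hab' : q.1 + b = p.1 + a := hab
  set v : R0 n := p.1 - q.1 with hv
  have hvmem : v ∈ Delta n x := sub_mem p.2 q.2
  have hv0 : v ≠ 0 := fun h => hpq (Subtype.ext (sub_eq_zero.1 h))
  have hvba : v = b - a := by
    rw [hv, sub_eq_sub_iff_add_eq_add, add_comm b, hab']
  have e1 : (4 * r * ((j : ℝ) - i)) • u - v =
      (a - (4 * r * (i : ℝ)) • u) - (b - (4 * r * (j : ℝ)) • u) := by
    rw [hvba, mul_sub, sub_smul (4 * r * (j : ℝ)) (4 * r * (i : ℝ)) u]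
    abel
  have h2 : ‖(4 * r * ((j : ℝ) - i)) • u - v‖ < r := by
    rw [e1]
    exact (norm_sub_le _ _).trans_lt (by linarith)
  have hij : |(j : ℝ) - i| ≤ J := by
    have h3 : (i : ℝ) < J := by exact_mod_cast hi
    have h4 : (j : ℝ) < J := by exact_mod_cast hj
    have h5 : (0 : ℝ) ≤ i := by positivity
    have h6 : (0 : ℝ) ≤ j := by positivity
    rw [abs_le]
    constructor <;> linarith
  have hnorm : ‖(4 * r * ((j : ℝ) - i)) • u‖ = 4 * r * |(j : ℝ) - i| := by
    rw [norm_smul, hu1, mul_one, norm_mul, Real.norm_eq_abs, Real.norm_eq_abs,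
      abs_of_pos (by positivity : 0 < 4 * r)]
  have hvW : v ∈ W := by
    refine Submodule.subset_span ⟨hvmem, ?_⟩
    rw [mem_closedBall_zero_iff]
    have h3 : ‖v‖ - ‖(4 * r * ((j : ℝ) - i)) • u‖ ≤ ‖(4 * r * ((j : ℝ) - i)) • u - v‖ := by
      rw [norm_sub_rev ((4 * r * ((j : ℝ) - i)) • u) v]
      exact norm_sub_norm_le _ _
    rw [hnorm] at h3
    nlinarith
  -- The vector v of W is within r of 4r(j - i)u, whose distance to W is at least 2r|j - i|. Hence j
  -- = i and ‖v‖ < r, against uniform discreteness.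
  have h3 := hfar (4 * r * ((j : ℝ) - i)) v hvW
  rw [abs_mul, abs_of_pos (by positivity : 0 < 4 * r)] at h3
  have h4 : j = i := by
    by_contra hne
    have : (1 : ℤ) ≤ |(j : ℤ) - i| := Int.one_le_abs (sub_ne_zero.2 (by exact_mod_cast hne))
    have : (1 : ℝ) ≤ |(j : ℝ) - i| := by exact_mod_cast this
    nlinarith
  rw [h4, sub_self, mul_zero, zero_smul, zero_sub, norm_neg] at h2
  exact absurd (hdisc x v hvmem hv0) (not_le.2 h2)

theorem finite_orbits_of_covol_le (n : ℕ) (V : ℝ) :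
    {O | ∃ x : X n, O = orbitA n x ∧ Submodule.span ℝ (Delta n x : Set (R0 n)) = ⊤ ∧
      covol n (Delta n x) ≤ V}.Finite := by
  obtain ⟨B, hB⟩ := exists_span_bounded_of_covol_le n V
  refine (finite_orbits_of_span_bounded n B).subset ?_
  rintro _ ⟨x, rfl, h1, h2⟩
  exact ⟨x, rfl, hB x h1 h2⟩

/-- Along a sequence with distinct orbits, a property of finitely many orbits fails eventually. -/
theorem eventually_not_of_finite {n : ℕ} {x : ℕ → X n}
    (hx : Function.Injective fun k => orbitA n (x k)) {P : X n → Prop}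
    (hP : {O | ∃ x : X n, O = orbitA n x ∧ P x}.Finite) : ∀ᶠ k in atTop, ¬ P (x k) := by
  have h := hP.preimage hx.injOn
  rw [← Nat.cofinite_eq_atTop]
  refine h.subset ?_
  intro k hk
  rw [Set.mem_compl_iff, Set.mem_ofPred_eq, not_not] at hk
  exact ⟨x k, rfl, hk⟩

theorem tendsto_covol {n : ℕ} {x : ℕ → X n}
    (hx : Function.Injective fun k => orbitA n (x k))
    (hspan : ∀ k, Submodule.span ℝ (Delta n (x k) : Set (R0 n)) = ⊤) :
    Tendsto (fun k => covol n (Delta n (x k))) atTop atTop := by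
  rw [tendsto_atTop]
  intro V
  filter_upwards [eventually_not_of_finite hx (finite_orbits_of_covol_le n V)] with k hk
  by_contra! h
  exact hk ⟨hspan k, h.le⟩

/-! ### From simplex sets to simplex families -/

theorem IsTight.family {n : ℕ} (hn : 1 ≤ n) {M : ℝ} {x : X n} {Φ : Finset (R0 n)}
    (h : IsTight n M x Φ) {φ : Fin (n + 1) → R0 n} (hφ : Set.range φ = (Φ : Set (R0 n))) :
    IsTightFamily n M (xi n Φ) x φ := by
  classical
  have hmem : ∀ i, φ i ∈ Φ := fun i => by
    rw [← Finset.mem_coe, ← hφ]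
    exact ⟨i, rfl⟩
  have himg : Finset.univ.image φ = Φ := by
    apply Finset.coe_injective
    rw [Finset.coe_image, Finset.coe_univ, Set.image_univ, hφ]
  have hinj : Set.InjOn φ (Finset.univ : Finset (Fin (n + 1))) := by
    rw [← Finset.card_image_iff, himg, h.isSimplexSet.card_eq]
    simp
  have hspan : Submodule.span ℝ (Set.range φ) = ⊤ := by rw [hφ, h.isSimplexSet.span_eq_top]
  have hcoord : ∀ i j, (φ i).1 j ≤ xi n Φ := fun i j =>
    (le_ceilMax (φ i) j).trans
      (le_ciSup (f := fun t : Φ => ceilMax n t.1) (Set.finite_range _).bddAbove ⟨φ i, hmem i⟩)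
  refine ⟨⟨hspan, ?_⟩, fun i => h.subset_Delta _ (hmem i), hcoord, h.ell_le, ?_⟩
  · rw [← h.isSimplexSet.sum_eq_zero, ← himg, Finset.sum_image hinj]
  -- If ξ ≤ 0, the zero coordinate sums force all φ_i = 0, and these do not span since n ≥ 1.
  · by_contra! hle
    have h0 : ∀ i, φ i = 0 := fun i => by
      rw [← norm_le_zero_iff]
      refine (norm_le_of_coord_le hn (hcoord i)).trans ?_
      exact mul_nonpos_of_nonneg_of_nonpos (by positivity) hle
    have h1 : Submodule.span ℝ (Set.range φ) = ⊥ := by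
      rw [Submodule.span_eq_bot]
      rintro _ ⟨i, rfl⟩
      exact h0 i
    rw [hspan] at h1
    have h2 := congrArg (fun W : Submodule ℝ (R0 n) => Module.finrank ℝ W) h1
    simp only [finrank_top, finrank_R0, finrank_bot] at h2
    omega

theorem IsTight.exists_range_eq {n : ℕ} {M : ℝ} {x : X n} {Φ : Finset (R0 n)}
    (h : IsTight n M x Φ) : ∃ φ : Fin (n + 1) → R0 n, Set.range φ = (Φ : Set (R0 n)) := by
  let e := Φ.equivFinOfCardEq h.isSimplexSet.card_eq
  refine ⟨fun i => (e.symm i).1, ?_⟩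
  ext t
  constructor
  · rintro ⟨i, rfl⟩
    exact (e.symm i).2
  · intro ht
    exact ⟨e ⟨t, ht⟩, by simp⟩

/-- The enumeration φ_j = |Δ_Φ|^{1/n} h(b_j) absorbs the distortion map, so that afterwards only
families and `wFam` occur. -/
theorem IsDistortionMap.exists_range_eq {n : ℕ} (hn : 1 ≤ n) {Φ : Finset (R0 n)}
    {h : R0 n ≃ₗ[ℝ] R0 n} (hh : IsDistortionMap n Φ h) :
    ∃ φ : Fin (n + 1) → R0 n, Set.range φ = (Φ : Set (R0 n)) ∧
      ∀ τ, wPhi n Φ h τ = wFam φ τ := by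
  set V := covol n (DeltaPhi n Φ) with hV
  have hn0 : (n : ℝ) ≠ 0 := by positivity
  have hV0 : 0 ≤ V := ENNReal.toReal_nonneg
  have hVne : V ≠ 0 := by
    intro h0
    -- Zero raised to a nonzero real power is 0 by convention, so V = 0 would give h(b_0) = 0.
    have hz : (V : ℝ) ^ (-(1 / (n : ℝ))) = 0 := by
      rw [h0, Real.zero_rpow]
      simp [hn0]
    have hmem : h (bStar n 0) ∈ h '' PhiStar n := ⟨_, ⟨0, rfl⟩, rfl⟩
    rw [hh] at hmem
    obtain ⟨t, -, ht⟩ := hmem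
    simp only [← hV, hz, zero_smul] at ht
    have h1 : bStar n 0 = 0 := h.map_eq_zero_iff.1 ht.symm
    have h2 := congrFun (congrArg Subtype.val h1) 0
    simp [bStar] at h2
    omega
  have hinv : V ^ (1 / (n : ℝ)) * V ^ (-(1 / (n : ℝ))) = 1 := by
    rw [← Real.rpow_add (lt_of_le_of_ne hV0 hVne.symm), add_neg_cancel, Real.rpow_zero]
  refine ⟨fun j => V ^ (1 / (n : ℝ)) • h (bStar n j), ?_, fun τ => ?_⟩
  · have h1 : Set.range (fun j => V ^ (1 / (n : ℝ)) • h (bStar n j)) =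
        (fun t => V ^ (1 / (n : ℝ)) • t) '' (h '' PhiStar n) := by
      rw [PhiStar, ← Set.range_comp, ← Set.range_comp]
      rfl
    rw [h1, hh, ← Set.image_comp]
    convert Set.image_id _
    funext t
    simp only [Function.comp_apply, smul_smul, ← hV, hinv, one_smul, id]
  · rw [wPhi, wStar, map_smul, map_sum, wFam, ← hV, Finset.smul_sum, Finset.smul_sum,
      ← Equiv.sum_comp τ fun i => (((τ.symm i : ℕ) : ℝ) / (n + 1)) • V ^ (1 / (n : ℝ)) • h (bStar n i)]
    refine Finset.sum_congr rfl fun l _ => ?_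
    rw [Equiv.symm_apply_apply, map_smul, smul_smul, smul_smul, smul_smul]
    congr 1
    ring

theorem latSpan_eq_DeltaPhi {n : ℕ} {Φ : Finset (R0 n)} {φ : Fin (n + 1) → R0 n}
    (hφ : Set.range φ = (Φ : Set (R0 n))) : latSpan φ = DeltaPhi n Φ := by
  rw [latSpan, DeltaPhi, hφ]

theorem IsTightFamily.span_Delta {n : ℕ} {M ξ : ℝ} {x : X n} {φ : Fin (n + 1) → R0 n}
    (h : IsTightFamily n M ξ x φ) : Submodule.span ℝ (Delta n x : Set (R0 n)) = ⊤ := by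
  refine top_unique (h.span_eq_top.ge.trans (Submodule.span_mono ?_))
  rintro _ ⟨i, rfl⟩
  exact h.mem_Delta i

/-- Where ξ is bounded, the spanning vectors φ_i of Δ_x are bounded, and this happens on finitely
many orbits only. -/
theorem tendsto_xi {n : ℕ} (hn : 1 ≤ n) {M : ℝ} {x : ℕ → X n}
    (hx : Function.Injective fun k => orbitA n (x k)) {ξ : ℕ → ℝ}
    {φ : ℕ → Fin (n + 1) → R0 n} (h : ∀ k, IsTightFamily n M (ξ k) (x k) (φ k)) :
    Tendsto ξ atTop atTop := by
  rw [tendsto_atTop]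
  intro B
  filter_upwards [eventually_not_of_finite hx (finite_orbits_of_span_bounded n (n * B))] with k hk
  by_contra! hlt
  apply hk
  refine top_unique ((h k).span_eq_top.ge.trans (Submodule.span_mono ?_))
  rintro _ ⟨i, rfl⟩
  refine ⟨(h k).mem_Delta i, mem_closedBall_zero_iff.2 (((h k).norm_le hn i).trans ?_)⟩
  exact mul_le_mul_of_nonneg_left hlt.le (by positivity)

/-! ### Topology of the space of lattices -/

instance continuousSMul_X (n : ℕ) : ContinuousSMul (SLR n) (X n) :=
  inferInstanceAs (ContinuousSMul (SLR n) (SLR n ⧸ SLZ n))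

theorem mem_SLZ_iff {n : ℕ} (g : SLR n) :
    g ∈ SLZ n ↔ ∀ i j, g.1 i j ∈ Set.range (Int.cast : ℤ → ℝ) := by
  constructor
  · rintro ⟨c, rfl⟩ i j
    exact ⟨c.1 i j, rfl⟩
  · intro h
    choose z hz using h
    have h1 : g.1 = (Matrix.of z).map (Int.cast : ℤ → ℝ) := by
      ext i j
      exact (hz i j).symm
    have hdet : (Matrix.of z).det = 1 := by
      have h2 := g.2
      rw [h1, det_int_map] at h2
      exact_mod_cast h2
    exact ⟨⟨Matrix.of z, hdet⟩, Subtype.ext h1.symm⟩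

theorem continuous_val (n : ℕ) : Continuous fun g : SLR n => g.1 := continuous_subtype_val

theorem isClosed_SLZ (n : ℕ) : IsClosed (SLZ n : Set (SLR n)) := by
  have h : (SLZ n : Set (SLR n)) =
      ⋂ i, ⋂ j, (fun g : SLR n => g.1 i j) ⁻¹' Set.range (Int.cast : ℤ → ℝ) := by
    ext g
    simp only [Set.mem_iInter, Set.mem_preimage]
    exact mem_SLZ_iff g
  rw [h]
  refine isClosed_iInter fun i => isClosed_iInter fun j => ?_
  exact Int.isClosedEmbedding_coe_real.isClosed_range.preimage
    ((continuous_val n).matrix_elem i j)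

instance t2Space_X (n : ℕ) : T2Space (X n) := by
  have h : IsOpenQuotientMap (QuotientGroup.mk : SLR n → SLR n ⧸ SLZ n) :=
    QuotientGroup.isOpenQuotientMap_mk
  refine (t2Space_iff_of_isOpenQuotientMap h).2 ?_
  have e : {q : SLR n × SLR n | (QuotientGroup.mk q.1 : SLR n ⧸ SLZ n) = QuotientGroup.mk q.2} =
      (fun q : SLR n × SLR n => q.1⁻¹ * q.2) ⁻¹' (SLZ n : Set (SLR n)) := by
    ext q
    exact QuotientGroup.eq
  rw [e]
  exact (isClosed_SLZ n).preimage (by fun_prop)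

theorem isOpenMap_smul_stdPoint (n : ℕ) : IsOpenMap fun g : SLR n => g • stdPoint n := by
  have h : IsOpenMap (QuotientGroup.mk : SLR n → SLR n ⧸ SLZ n) :=
    QuotientGroup.isOpenQuotientMap_mk.isOpenMap
  have e : (fun g : SLR n => g • stdPoint n) = (QuotientGroup.mk : SLR n → SLR n ⧸ SLZ n) := by
    funext g
    have h1 : (QuotientGroup.mk (g * 1) : SLR n ⧸ SLZ n) = QuotientGroup.mk g := by rw [mul_one]
    exact h1
  rw [e]
  exact h

theorem continuous_opN (n : ℕ) :
    Continuous fun m : Matrix (Fin (n + 1)) (Fin (n + 1)) ℝ => opN m := by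
  have h : Continuous ((LinearMap.toContinuousLinearMap (𝕜 := ℝ) (E := Fin (n + 1) → ℝ)
      (F' := Fin (n + 1) → ℝ)).toLinearMap ∘ₗ
        (Matrix.toLin' (R := ℝ) (m := Fin (n + 1)) (n := Fin (n + 1))).toLinearMap) :=
    LinearMap.continuous_of_finiteDimensional _
  exact continuous_norm.comp h

/-- At kℤ^d, `ell` is at least 1/‖k⁻¹‖, which is continuous in k, and k ↦ kℤ^d is open. This local
lower bound replaces continuity of `ell`. -/
theorem eventually_le_ell {n : ℕ} (y : X n) : ∃ δ > 0, ∀ᶠ z in 𝓝 y, δ ≤ ell n z := by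
  obtain ⟨g, rfl⟩ := exists_smul_stdPoint y
  have hcont : Continuous fun k : SLR n => opN (k⁻¹).1 :=
    (continuous_opN n).comp ((continuous_val n).comp continuous_inv)
  have hpos : 0 < opN (g⁻¹).1 + 1 := by linarith [opN_nonneg (g⁻¹).1]
  refine ⟨(opN (g⁻¹).1 + 1)⁻¹, inv_pos.2 hpos, ?_⟩
  have hopen : IsOpen {k : SLR n | opN (k⁻¹).1 < opN (g⁻¹).1 + 1} :=
    isOpen_lt hcont continuous_const
  have h1 := (isOpenMap_smul_stdPoint n) _ hopen
  filter_upwards [h1.mem_nhds ⟨g, by simp, rfl⟩]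
  rintro _ ⟨k, hk, rfl⟩
  refine le_trans ?_ (inv_opN_le_ell k)
  exact inv_anti₀ (opN_pos _) (le_of_lt hk)

theorem exists_subset_Xge_of_isCompact {n : ℕ} {S : Set (X n)} (hS : IsCompact S) :
    ∃ δ > 0, S ⊆ Xge n δ := by
  refine hS.induction_on (p := fun S => ∃ δ > 0, S ⊆ Xge n δ) ⟨1, one_pos, Set.empty_subset _⟩
    ?_ ?_ ?_
  · rintro s t hst ⟨δ, hδ, ht⟩
    exact ⟨δ, hδ, hst.trans ht⟩
  · rintro s t ⟨δ, hδ, hs⟩ ⟨δ', hδ', ht⟩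
    refine ⟨min δ δ', lt_min hδ hδ', Set.union_subset ?_ ?_⟩
    · exact fun y hy => (min_le_left δ δ').trans (show δ ≤ ell n y from hs hy)
    · exact fun y hy => (min_le_right δ δ').trans (show δ' ≤ ell n y from ht hy)
  · intro y _
    obtain ⟨δ, hδ, h⟩ := eventually_le_ell y
    exact ⟨_, mem_nhdsWithin_of_mem_nhds h, δ, hδ, fun z hz => hz⟩

theorem continuous_aMat (n : ℕ) : Continuous (aMat n) := by
  apply Continuous.subtype_mk
  apply Continuous.matrix_diagonal
  refine continuous_pi fun i => Real.continuous_exp.comp ?_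
  exact (continuous_apply i).comp continuous_subtype_val

theorem continuous_aMat_smul {n : ℕ} :
    Continuous fun q : R0 n × X n => aMat n q.1 • q.2 :=
  ((continuous_aMat n).comp continuous_fst).smul continuous_snd

/-! ### The invariant measure on a compact orbit -/

instance isProbabilityMeasure_unitAddCircle :
    IsProbabilityMeasure (volume : Measure UnitAddCircle) := ⟨UnitAddCircle.measure_univ⟩

/-- Representatives in `[0, 1)` of the coordinates of a point of the torus. -/
def torusLift {m : ℕ} (p : UnitAddTorus (Fin m)) : Fin m → ℝ :=
  fun i => (AddCircle.measurableEquivIco 1 0 (p i)).1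

theorem measurable_torusLift (m : ℕ) : Measurable (torusLift (m := m)) :=
  measurable_pi_lambda _ fun i => measurable_subtype_coe.comp
    ((AddCircle.measurableEquivIco 1 0).measurable.comp (measurable_pi_apply i))

theorem coe_torusLift {m : ℕ} (p : UnitAddTorus (Fin m)) (i : Fin m) :
    ((torusLift p i : ℝ) : UnitAddCircle) = p i := AddCircle.coe_equivIco

/-- The times parametrised by the torus. -/
def torusTime {n : ℕ} (φ : Fin (n + 1) → R0 n) (p : UnitAddTorus (Fin (n + 1))) : R0 n :=
  ∑ i, (2 * torusLift p i) • φ i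

/-- The parametrisation of a compact orbit by a torus. -/
def torusPt {n : ℕ} (φ : Fin (n + 1) → R0 n) (x : X n) (p : UnitAddTorus (Fin (n + 1))) : X n :=
  aMat n (torusTime φ p) • x

theorem measurable_torusTime {n : ℕ} (φ : Fin (n + 1) → R0 n) : Measurable (torusTime φ) := by
  have h : Continuous fun α : Fin (n + 1) → ℝ => ∑ i, (2 * α i) • φ i := by fun_prop
  exact h.measurable.comp (measurable_torusLift (n + 1))

theorem measurable_torusPt {n : ℕ} (φ : Fin (n + 1) → R0 n) (x : X n) :
    Measurable (torusPt φ x) := by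
  have h : Continuous fun s : R0 n => aMat n s • x :=
    (continuous_aMat n).smul continuous_const
  exact h.measurable.comp (measurable_torusTime φ)

/-- The factor 2 makes the parametrisation well defined on the torus, because only doubles of
elements of Δ_x are known to fix x. The torus has dimension n+1 and the orbit dimension n, so the
parametrisation is not injective. Only the push-forward of Haar measure matters. -/
theorem aMat_smul_congr {n : ℕ} {φ : Fin (n + 1) → R0 n} {x : X n} (h : latSpan φ ≤ Delta n x)
    {α β : Fin (n + 1) → ℝ} (hαβ : ∀ i, (α i : UnitAddCircle) = β i) :
    aMat n (∑ i, (2 * α i) • φ i) • x = aMat n (∑ i, (2 * β i) • φ i) • x := by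
  have h1 : ∀ i, ∃ k : ℤ, α i = β i + k := by
    intro i
    have h2 := sub_eq_zero.2 (hαβ i)
    rw [← AddCircle.coe_sub, AddCircle.coe_eq_zero_iff] at h2
    obtain ⟨k, hk⟩ := h2
    refine ⟨k, ?_⟩
    simp at hk
    linarith
  choose k hk using h1
  set t : R0 n := ∑ i, (k i : ℝ) • φ i with ht
  have htmem : t ∈ Delta n x := h (mem_latSpan_iff.2 ⟨k, rfl⟩)
  have e : ∑ i, (2 * α i) • φ i = ∑ i, (2 * β i) • φ i + (t + t) := by
    rw [ht, ← Finset.sum_add_distrib, ← Finset.sum_add_distrib]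
    refine Finset.sum_congr rfl fun i _ => ?_
    rw [← add_smul, ← add_smul, hk i]
    congr 1
    ring
  rw [e, aMat_add_smul, two_smul_mem_stabilizer htmem]

theorem torusPt_coe {n : ℕ} {φ : Fin (n + 1) → R0 n} {x : X n} (h : latSpan φ ≤ Delta n x)
    (α : Fin (n + 1) → ℝ) :
    torusPt φ x (fun i => (α i : UnitAddCircle)) = aMat n (∑ i, (2 * α i) • φ i) • x :=
  aMat_smul_congr h fun _ => coe_torusLift _ _

theorem torusPt_add_coe {n : ℕ} {φ : Fin (n + 1) → R0 n} {x : X n} (h : latSpan φ ≤ Delta n x)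
    (α : Fin (n + 1) → ℝ) (p : UnitAddTorus (Fin (n + 1))) :
    torusPt φ x (p + fun i => (α i : UnitAddCircle)) =
      aMat n (∑ i, (2 * α i) • φ i) • torusPt φ x p := by
  have e : (p + fun i => (α i : UnitAddCircle)) =
      fun i => ((torusLift p i + α i : ℝ) : UnitAddCircle) := by
    funext i
    rw [Pi.add_apply, AddCircle.coe_add, coe_torusLift]
  rw [e, torusPt_coe h, torusPt, ← aMat_add_smul, torusTime, ← Finset.sum_add_distrib]
  congr 2
  refine Finset.sum_congr rfl fun i _ => ?_
  rw [← add_smul]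
  congr 1
  ring

theorem IsSimplexFamily.exists_two_coeff {n : ℕ} {φ : Fin (n + 1) → R0 n}
    (h : IsSimplexFamily n φ) (s : R0 n) :
    ∃ α : Fin (n + 1) → ℝ, s = ∑ i, (2 * α i) • φ i := by
  obtain ⟨α, hα⟩ := h.exists_coeff s
  refine ⟨fun i => α i / 2, ?_⟩
  rw [hα]
  refine Finset.sum_congr rfl fun i _ => ?_
  congr 1
  ring

/-- The invariant measure of a compact orbit. -/
def orbitMeasure {n : ℕ} (φ : Fin (n + 1) → R0 n) (x : X n) : Measure (X n) :=
  Measure.map (torusPt φ x) volume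

theorem isOrbitMeasure_orbitMeasure {n : ℕ} {φ : Fin (n + 1) → R0 n} {x : X n}
    (hφ : IsSimplexFamily n φ) (h : latSpan φ ≤ Delta n x) (hx : x ∈ Omega n) :
    IsOrbitMeasure n x (orbitMeasure φ x) where
  isProbabilityMeasure := Measure.isProbabilityMeasure_map (measurable_torusPt φ x).aemeasurable
  compl_orbit := by
    have hc : IsCompact (orbitA n x) := hx
    rw [orbitMeasure, Measure.map_apply (measurable_torusPt φ x) hc.measurableSet.compl]
    convert measure_empty (μ := (volume : Measure (UnitAddTorus (Fin (n + 1)))))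
    rw [Set.eq_empty_iff_forall_notMem]
    intro p hp
    exact hp (mem_orbitA_iff.2 ⟨_, rfl⟩)
  invariant g hg := by
    obtain ⟨s, rfl⟩ := exists_aMat_of_mem_A hg
    obtain ⟨α, rfl⟩ := hφ.exists_two_coeff s
    have hm : Measurable fun y : X n => aMat n (∑ i, (2 * α i) • φ i) • y :=
      (continuous_const_smul _).measurable
    rw [orbitMeasure, Measure.map_map hm (measurable_torusPt φ x)]
    have e : (fun y : X n => aMat n (∑ i, (2 * α i) • φ i) • y) ∘ torusPt φ x =
        torusPt φ x ∘ fun p => p + fun i => (α i : UnitAddCircle) := by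
      funext p
      exact (torusPt_add_coe h α p).symm
    rw [e, ← Measure.map_map (measurable_torusPt φ x) (measurable_add_const _),
      map_add_right_eq_self]

theorem measurable_aMat_smul {n : ℕ} {T : Type*} [MeasurableSpace T] {f : T → R0 n}
    (hf : Measurable f) : Measurable fun q : T × X n => aMat n (f q.1) • q.2 := by
  have h1 : Measurable fun q : R0 n × X n => aMat n q.1 • q.2 :=
    Continuous.measurable continuous_aMat_smul
  exact Measurable.comp (g := fun q : R0 n × X n => aMat n q.1 • q.2)
    (f := fun q : T × X n => (f q.1, q.2)) h1 ((hf.comp measurable_fst).prodMk measurable_snd)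

/-- Integrate the indicator of E at a(time p)y over p and y. By invariance of ν the integral over y
is ν(E) for every p. For fixed y in the orbit, translation invariance on the torus makes the
integral over p equal to the orbit measure of E. Fubini compares the two. -/
theorem orbitMeasure_unique {n : ℕ} {φ : Fin (n + 1) → R0 n} {x : X n}
    (hφ : IsSimplexFamily n φ) (h : latSpan φ ≤ Delta n x) {ν : Measure (X n)}
    (hν : IsOrbitMeasure n x ν) : ν = orbitMeasure φ x := by
  have := hν.isProbabilityMeasure
  ext E hE
  have hJ : Measurable fun q : UnitAddTorus (Fin (n + 1)) × X n =>
      E.indicator (fun _ => (1 : ENNReal)) (aMat n (torusTime φ q.1) • q.2) :=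
    (measurable_const.indicator hE).comp (measurable_aMat_smul (measurable_torusTime φ))
  have e1 : ∀ p, ∫⁻ y, E.indicator (fun _ => (1 : ENNReal)) (aMat n (torusTime φ p) • y) ∂ν = ν E := by
    intro p
    have hm : Measurable fun y : X n => aMat n (torusTime φ p) • y :=
      (continuous_const_smul _).measurable
    rw [← lintegral_map (measurable_const.indicator hE) hm, hν.invariant _ (aMat_mem_A _),
      lintegral_indicator_const hE, one_mul]
  have e2 : ∀ᵐ y ∂ν, ∫⁻ p, E.indicator (fun _ => (1 : ENNReal)) (aMat n (torusTime φ p) • y) =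
      orbitMeasure φ x E := by
    have h0 : ∀ᵐ y ∂ν, y ∈ orbitA n x := hν.compl_orbit
    filter_upwards [h0] with y hy
    obtain ⟨s, rfl⟩ := mem_orbitA_iff.1 hy
    obtain ⟨α, rfl⟩ := hφ.exists_two_coeff s
    have e3 : ∀ p, aMat n (torusTime φ p) • aMat n (∑ i, (2 * α i) • φ i) • x =
        torusPt φ x (p + fun i => (α i : UnitAddCircle)) := by
      intro p
      rw [torusPt_add_coe h, torusPt, ← aMat_add_smul, ← aMat_add_smul, add_comm (torusTime φ p)]
    simp only [e3]
    rw [lintegral_add_right_eq_self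
      (fun p => E.indicator (fun _ => (1 : ENNReal)) (torusPt φ x p)),
      ← lintegral_map (measurable_const.indicator hE) (measurable_torusPt φ x),
      lintegral_indicator_const hE, one_mul, orbitMeasure]
  have e4 : ∫⁻ p : UnitAddTorus (Fin (n + 1)), ∫⁻ y,
      E.indicator (fun _ => (1 : ENNReal)) (aMat n (torusTime φ p) • y) ∂ν = ν E := by
    simp only [e1, lintegral_const, measure_univ, mul_one]
  rw [lintegral_lintegral_swap hJ.aemeasurable, lintegral_congr_ae e2, lintegral_const,
    measure_univ, mul_one] at e4
  exact e4.symm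

theorem existsUnique_orbitMeasure {n : ℕ} {φ : Fin (n + 1) → R0 n} {x : X n}
    (hφ : IsSimplexFamily n φ) (h : latSpan φ ≤ Delta n x) (hx : x ∈ Omega n) :
    ∃! μ, IsOrbitMeasure n x μ :=
  ⟨_, isOrbitMeasure_orbitMeasure hφ h hx, fun _ hν => orbitMeasure_unique hφ h hν⟩

/-! ### Escape of mass -/

theorem norm_coe_unitAddCircle_le (r : ℝ) : ‖(r : UnitAddCircle)‖ ≤ |r| := by
  rw [UnitAddCircle.norm_eq]
  simpa using round_le r 0

/-- The character of the torus that detects equidistributed configurations. -/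
def gapHom (n : ℕ) (i j : Fin (n + 1)) : UnitAddTorus (Fin (n + 1)) →+ UnitAddCircle :=
  (2 * (n + 1)) • (Pi.evalAddMonoidHom (fun _ => UnitAddCircle) i -
    Pi.evalAddMonoidHom (fun _ => UnitAddCircle) j)

theorem gapHom_apply {n : ℕ} (i j : Fin (n + 1)) (p : UnitAddTorus (Fin (n + 1))) :
    gapHom n i j p = (2 * (n + 1)) • (p i - p j) := rfl

theorem measurePreserving_gapHom {n : ℕ} {i j : Fin (n + 1)} (hij : i ≠ j) :
    MeasurePreserving (gapHom n i j) volume volume := by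
  apply AddMonoidHom.measurePreserving
  · have : (gapHom n i j : UnitAddTorus (Fin (n + 1)) → UnitAddCircle) =
        fun p => (2 * (n + 1)) • (p i - p j) := rfl
    rw [this]
    fun_prop
  · intro z
    obtain ⟨r, rfl⟩ := QuotientAddGroup.mk_surjective z
    refine ⟨Pi.single i ((r / (2 * (n + 1)) : ℝ) : UnitAddCircle), ?_⟩
    rw [gapHom_apply, Pi.single_eq_same, Pi.single_eq_of_ne hij.symm, sub_zero,
      ← AddCircle.coe_nsmul]
    congr 1
    rw [nsmul_eq_mul]
    push_cast
    have : (n : ℝ) + 1 ≠ 0 := by positivity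
    field_simp
  · rw [measure_univ, measure_univ]

/-- The time of p has coefficients 2p_i, so 2(p_i - p_j) is a multiple of 1/(n+1) plus β_i - β_j.
Multiplication by n+1 leaves only the error on the circle. -/
theorem IsTightFamily.norm_gapHom_le {n : ℕ} {M ξ δ : ℝ} {x : X n} {φ : Fin (n + 1) → R0 n}
    (h : IsTightFamily n M ξ x φ) (hM : 0 < M) (hδ : 0 < δ) (i j : Fin (n + 1))
    {p : UnitAddTorus (Fin (n + 1))} (hp : δ ≤ ell n (torusPt φ x p)) :
    ‖gapHom n i j p‖ ≤ 2 * (n + 1) * (Real.log (M / δ) / ξ) := by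
  obtain ⟨τ, k, θ, β, hβ, hα⟩ := h.coeff_location hM hδ (fun i => 2 * torusLift p i) hp
  have hn0 : (n : ℝ) + 1 ≠ 0 := by positivity
  have e1 : gapHom n i j p =
      (((2 * (n + 1) : ℕ) • (torusLift p i - torusLift p j) : ℝ) : UnitAddCircle) := by
    rw [AddCircle.coe_nsmul, AddCircle.coe_sub, coe_torusLift, coe_torusLift]
    rfl
  have e2 : (((2 * (n + 1) : ℕ) • (torusLift p i - torusLift p j) : ℝ)) =
      (n + 1) * (β i - β j) + (((τ.symm i : ℕ) - (τ.symm j : ℕ) + (n + 1) * (k i - k j) : ℤ) : ℝ) := by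
    have hi := hα i
    have hj := hα j
    rw [nsmul_eq_mul]
    push_cast
    field_simp at hi hj
    linarith
  have e3 : gapHom n i j p = (((n + 1) * (β i - β j) : ℝ) : UnitAddCircle) := by
    rw [e1, e2, AddCircle.coe_add, add_eq_left, AddCircle.coe_eq_zero_iff]
    exact ⟨_, by rw [zsmul_eq_mul, mul_one]⟩
  rw [e3]
  refine (norm_coe_unitAddCircle_le _).trans ?_
  rw [abs_mul, abs_of_pos (by positivity : (0 : ℝ) < n + 1)]
  have h1 : |β i - β j| ≤ 2 * (Real.log (M / δ) / ξ) := by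
    refine (abs_sub _ _).trans ?_
    linarith [hβ i, hβ j]
  calc ((n : ℝ) + 1) * |β i - β j| ≤ (n + 1) * (2 * (Real.log (M / δ) / ξ)) :=
        mul_le_mul_of_nonneg_left h1 (by positivity)
    _ = _ := by ring

/-- One gap between two different coordinates suffices, and n ≥ 1 provides one. Its law is Haar
measure on the circle, so a ball of radius ρ has measure at most 2ρ. -/
theorem IsTightFamily.orbitMeasure_le {n : ℕ} (hn : 1 ≤ n) {M ξ δ : ℝ} {x : X n}
    {φ : Fin (n + 1) → R0 n} (h : IsTightFamily n M ξ x φ) (hM : 0 < M) (hδ : 0 < δ)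
    {S : Set (X n)} (hS : MeasurableSet S) (hSδ : S ⊆ Xge n δ) :
    orbitMeasure φ x S ≤ ENNReal.ofReal (4 * (n + 1) * (Real.log (M / δ) / ξ)) := by
  have hij : (0 : Fin (n + 1)) ≠ Fin.last n := by
    intro h0
    have := congrArg Fin.val h0
    simp at this
    omega
  rw [orbitMeasure, Measure.map_apply (measurable_torusPt φ x) hS]
  have h1 : torusPt φ x ⁻¹' S ⊆ gapHom n 0 (Fin.last n) ⁻¹'
      Metric.closedBall 0 (2 * (n + 1) * (Real.log (M / δ) / ξ)) := by
    intro p hp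
    rw [Set.mem_preimage, mem_closedBall_zero_iff]
    exact h.norm_gapHom_le hM hδ _ _ (hSδ hp)
  refine (measure_mono h1).trans ?_
  rw [(measurePreserving_gapHom hij).measure_preimage
    Metric.isClosed_closedBall.measurableSet.nullMeasurableSet, AddCircle.volume_closedBall]
  refine ENNReal.ofReal_le_ofReal ((min_le_right _ _).trans (le_of_eq ?_))
  ring

theorem abs_integral_le_of_subset {n : ℕ} {μ : Measure (X n)} [IsProbabilityMeasure μ]
    {f : X n → ℝ} {C : ℝ} (hC : ∀ y, ‖f y‖ ≤ C) {r : ℝ} (hr : 0 ≤ r)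
    (hμ : μ (tsupport f) ≤ ENNReal.ofReal r) : ‖∫ y, f y ∂μ‖ ≤ C * r := by
  have hC0 : 0 ≤ C := (norm_nonneg _).trans (hC (stdPoint n))
  have e : ∫ y, f y ∂μ = ∫ y in tsupport f, f y ∂μ :=
    (setIntegral_eq_integral_of_forall_compl_eq_zero fun y hy => image_eq_zero_of_notMem_tsupport hy).symm
  rw [e]
  refine (norm_setIntegral_le_of_norm_le_const (measure_lt_top _ _) fun y _ => hC y).trans ?_
  refine mul_le_mul_of_nonneg_left ?_ hC0
  exact ENNReal.toReal_le_of_le_ofReal hr hμ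

theorem fullEscape_of_tight {n : ℕ} (hn : 1 ≤ n) {M : ℝ} (hM : 0 < M) {x : ℕ → X n}
    (hx : Function.Injective fun k => orbitA n (x k)) (hΩ : ∀ k, x k ∈ Omega n) {ξ : ℕ → ℝ}
    {φ : ℕ → Fin (n + 1) → R0 n} (h : ∀ k, IsTightFamily n M (ξ k) (x k) (φ k)) :
    FullEscape n x := by
  refine ⟨fun k => existsUnique_orbitMeasure (h k).toIsSimplexFamily (h k).latSpan_le (hΩ k), ?_⟩
  intro μ hμ f hf hfc
  obtain ⟨C, hC⟩ := hfc.exists_bound_of_continuous hf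
  obtain ⟨δ', hδ', hsub'⟩ := exists_subset_Xge_of_isCompact (n := n) hfc
  -- Taking δ ≤ M makes log(M/δ) nonnegative.
  set δ := min δ' M
  have hδ : 0 < δ := lt_min hδ' hM
  have hsub : tsupport f ⊆ Xge n δ := fun y hy =>
    (min_le_left δ' M).trans (show δ' ≤ ell n y from hsub' hy)
  have hlog : 0 ≤ Real.log (M / δ) :=
    Real.log_nonneg ((one_le_div hδ).2 (min_le_right _ _))
  have hlim : Tendsto (fun k => C * (4 * (n + 1) * (Real.log (M / δ) / ξ k))) atTop (𝓝 0) := by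
    have h1 := (tendsto_xi hn hx h).const_div_atTop (Real.log (M / δ))
    have h2 := (h1.const_mul (4 * ((n : ℝ) + 1))).const_mul C
    simpa using h2
  refine squeeze_zero_norm (fun k => ?_) hlim
  have := (hμ k).isProbabilityMeasure
  refine abs_integral_le_of_subset hC ?_ ?_
  · have := (h k).xi_pos
    positivity
  · rw [orbitMeasure_unique (h k).toIsSimplexFamily (h k).latSpan_le (hμ k)]
    exact (h k).orbitMeasure_le hn hM hδ (isClosed_tsupport f).measurableSet hsub

/-! ### Accumulation on the orbit of the standard lattice -/

theorem sign_mulVec_intVecs {n : ℕ} {σ : Fin (n + 1) → ℝ} (hσ : ∀ i, |σ i| = 1)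
    {v : Fin (n + 1) → ℝ} (hv : v ∈ intVecs n) : (Matrix.diagonal σ).mulVec v ∈ intVecs n := by
  obtain ⟨z, rfl⟩ := hv
  have h1 : ∀ i, ∃ k : ℤ, (k : ℝ) = σ i := by
    intro i
    rcases (abs_eq one_pos.le).1 (hσ i) with h | h
    · exact ⟨1, by rw [h]; simp⟩
    · exact ⟨-1, by rw [h]; simp⟩
  choose k hk using h1
  refine ⟨fun i => k i * z i, ?_⟩
  funext i
  rw [Matrix.mulVec_diagonal, ← hk]
  push_cast
  rfl

theorem diagonal_sign_mul_self {n : ℕ} {σ : Fin (n + 1) → ℝ} (hσ : ∀ i, |σ i| = 1) :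
    Matrix.diagonal σ * Matrix.diagonal σ = 1 := by
  rw [Matrix.diagonal_mul_diagonal, ← Matrix.diagonal_one]
  congr 1
  funext i
  rw [← abs_mul_abs_self, hσ, one_mul]

/-- Signs preserve ℤ^d and commute with a(r). A sign matrix to the left of g can therefore be
balanced by one to its right, which turns g into a conjugate and does not increase ‖g - I‖. -/
theorem sign_image_lattice_aMat {n : ℕ} {σ : Fin (n + 1) → ℝ} (hσ : ∀ i, |σ i| = 1) (r : R0 n)
    {v : Fin (n + 1) → ℝ} (hv : v ∈ lattice n (aMat n r • stdPoint n)) :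
    (Matrix.diagonal σ).mulVec v ∈ lattice n (aMat n r • stdPoint n) := by
  rw [lattice_smul_stdPoint] at *
  obtain ⟨w, hw, rfl⟩ := hv
  refine ⟨(Matrix.diagonal σ).mulVec w, sign_mulVec_intVecs hσ hw, ?_⟩
  rw [Matrix.mulVec_mulVec, Matrix.mulVec_mulVec, aMat_val, Matrix.diagonal_mul_diagonal,
    Matrix.diagonal_mul_diagonal]
  congr 2
  funext i
  ring

/-- Translating the time by an element of `Δ_x` conjugates the deviation from the standard orbit
by a sign matrix. -/
theorem exists_conj_sign {n : ℕ} {x : X n} {s t r : R0 n} (ht : t ∈ Delta n x) {g : SLR n}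
    (h : aMat n s • x = g • aMat n r • stdPoint n) :
    ∃ g' : SLR n, distOne n g' ≤ distOne n g ∧
      aMat n (s + t) • x = g' • aMat n r • stdPoint n := by
  obtain ⟨σ, hσ, hL⟩ := lattice_aMat_add_smul ht
  have hdet : (Matrix.diagonal σ * g.1 * Matrix.diagonal σ).det = 1 := by
    have h1 := congrArg Matrix.det (diagonal_sign_mul_self hσ)
    rw [Matrix.det_mul, Matrix.det_one] at h1
    rw [Matrix.det_mul, Matrix.det_mul, g.2, mul_one, h1]
  refine ⟨⟨_, hdet⟩, ?_, ?_⟩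
  · have e : Matrix.diagonal σ * g.1 * Matrix.diagonal σ - 1 =
        Matrix.diagonal σ * (g.1 - 1) * Matrix.diagonal σ := by
      rw [mul_sub, sub_mul, mul_one, diagonal_sign_mul_self hσ]
    change opN (Matrix.diagonal σ * g.1 * Matrix.diagonal σ - 1) ≤ opN (g.1 - 1)
    have hs : opN (Matrix.diagonal σ) ≤ 1 := opN_diagonal_le σ fun i => (hσ i).le
    rw [e]
    calc opN (Matrix.diagonal σ * (g.1 - 1) * Matrix.diagonal σ)
        ≤ opN (Matrix.diagonal σ) * opN (g.1 - 1) * opN (Matrix.diagonal σ) :=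
          (opN_mul_le _ _).trans (mul_le_mul_of_nonneg_right (opN_mul_le _ _) (opN_nonneg _))
      _ ≤ 1 * opN (g.1 - 1) * 1 := by
          have := opN_nonneg (g.1 - 1)
          have := opN_nonneg (Matrix.diagonal σ)
          gcongr
      _ = opN (g.1 - 1) := by ring
  · apply lattice_injective
    rw [hL, h, lattice_smul g, lattice_smul ⟨Matrix.diagonal σ * g.1 * Matrix.diagonal σ, hdet⟩]
    ext v
    constructor
    · rintro ⟨_, ⟨w, hw, rfl⟩, rfl⟩
      refine ⟨_, sign_image_lattice_aMat hσ r hw, ?_⟩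
      rw [Matrix.mulVec_mulVec, mul_assoc, diagonal_sign_mul_self hσ, mul_one,
        Matrix.mulVec_mulVec]
    · rintro ⟨w, hw, rfl⟩
      refine ⟨_, ⟨_, sign_image_lattice_aMat hσ r hw, rfl⟩, ?_⟩
      change _ = (Matrix.diagonal σ * g.1 * Matrix.diagonal σ).mulVec w
      simp only [Matrix.mulVec_mulVec, mul_assoc]

theorem opN_aMat_le {n : ℕ} (b : R0 n) : opN (aMat n b).1 ≤ Real.exp ‖b‖ := by
  rw [aMat_val]
  apply opN_diagonal_le
  intro i
  rw [abs_of_pos (Real.exp_pos _), Real.exp_le_exp]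
  exact (le_abs_self _).trans (abs_coord_le_norm b i)

theorem distOne_conj_aMat_le {n : ℕ} (b : R0 n) (g : SLR n) :
    distOne n (aMat n b * g * aMat n (-b)) ≤ Real.exp (2 * ‖b‖) * distOne n g := by
  have e : (aMat n b * g * aMat n (-b)).1 - 1 = (aMat n b).1 * (g.1 - 1) * (aMat n (-b)).1 := by
    have h1 : (aMat n b * g * aMat n (-b)).1 = (aMat n b).1 * g.1 * (aMat n (-b)).1 := rfl
    rw [h1, mul_sub, sub_mul, mul_one, aMat_neg, coe_mul_inv]
  rw [distOne_eq, distOne_eq, e]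
  have h2 := opN_aMat_le (-b)
  rw [norm_neg] at h2
  calc opN ((aMat n b).1 * (g.1 - 1) * (aMat n (-b)).1)
      ≤ opN (aMat n b).1 * opN (g.1 - 1) * opN (aMat n (-b)).1 :=
        (opN_mul_le _ _).trans (mul_le_mul_of_nonneg_right (opN_mul_le _ _) (opN_nonneg _))
    _ ≤ Real.exp ‖b‖ * opN (g.1 - 1) * Real.exp ‖b‖ := by
        have := opN_nonneg (g.1 - 1)
        have := opN_nonneg (aMat n (-b)).1
        gcongr
        exact opN_aMat_le b
    _ = Real.exp (2 * ‖b‖) * opN (g.1 - 1) := by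
        rw [two_mul, Real.exp_add]
        ring

theorem aMat_smul_smul {n : ℕ} (b : R0 n) (g : SLR n) (y : X n) :
    aMat n b • g • y = (aMat n b * g * aMat n (-b)) • aMat n b • y := by
  rw [mul_smul, mul_smul, aMat_neg, inv_smul_smul]

/-- The points of the orbit that are not high in the cusp are close to the orbit of the standard
lattice. -/
theorem IsTightFamily.near_std {n : ℕ} (hn : 1 ≤ n) {M ξ δ ω : ℝ} {x : X n}
    {φ : Fin (n + 1) → R0 n} (h : IsTightFamily n M ξ x φ) (hM : 0 < M) (hδ : 0 < δ)
    (hnear : ∀ τ, ∃ g : SLR n, distOne n g ≤ ω ∧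
      ∃ r, aMat n (wFam φ τ) • x = g • aMat n r • stdPoint n)
    {s : R0 n} (hs : δ ≤ ell n (aMat n s • x)) :
    ∃ g : SLR n, distOne n g ≤ Real.exp (2 * ((n + 1) * n * Real.log (M / δ))) * ω ∧
      ∃ r, aMat n s • x = g • aMat n r • stdPoint n := by
  obtain ⟨τ, b, t, ht, hb, rfl⟩ := h.location hn hM hδ hs
  obtain ⟨g, hg, r, hgr⟩ := hnear τ
  have h1 : aMat n (wFam φ τ + b) • x =
      (aMat n b * g * aMat n (-b)) • aMat n (b + r) • stdPoint n := by
    rw [add_comm (wFam φ τ), aMat_add_smul, hgr, aMat_smul_smul, aMat_add_smul]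
  obtain ⟨g', hg', h2⟩ := exists_conj_sign (h.latSpan_le ht) h1
  refine ⟨g', hg'.trans ((distOne_conj_aMat_le b g).trans ?_), _, h2⟩
  have h0 : 0 ≤ distOne n g := opN_nonneg _
  gcongr

/-- The lattice contains e^{r_i} times the i-th unit vector, so every coordinate of r is at least
log δ. The zero sum bounds the others. -/
theorem norm_le_of_le_ell {n : ℕ} (hn : 1 ≤ n) {r : R0 n} {δ : ℝ} (hδ : 0 < δ)
    (h : δ ≤ ell n (aMat n r • stdPoint n)) : ‖r‖ ≤ n * (-Real.log δ) := by
  rw [← norm_neg]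
  apply norm_le_of_coord_le hn
  intro i
  have h1 : (-r).1 i = -r.1 i := rfl
  rw [h1, neg_le_neg_iff, Real.log_le_iff_le_exp hδ]
  refine h.trans ?_
  have h2 : (aMat n r).1.mulVec (Pi.single i 1) = Pi.single i (Real.exp (r.1 i)) := by
    funext j
    rw [aMat_val, Matrix.mulVec_diagonal]
    by_cases hj : j = i
    · subst hj; simp
    · simp [hj]
  have h3 := ell_le_norm (x := aMat n r • stdPoint n) (v := Pi.single i (Real.exp (r.1 i))) (by
    rw [lattice_smul_stdPoint]
    refine ⟨Pi.single i 1, ⟨Pi.single i 1, ?_⟩, h2⟩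
    funext j
    by_cases hj : j = i
    · subst hj; simp
    · simp [hj]) (by
    intro h0
    have := congrFun h0 i
    simp at this)
  rwa [Pi.norm_single, Real.norm_eq_abs, abs_of_pos (Real.exp_pos _)] at h3

theorem exists_distOne_lt {n : ℕ} {N : Set (SLR n)} (hN : N ∈ 𝓝 (1 : SLR n)) :
    ∃ κ > 0, ∀ g, distOne n g < κ → g ∈ N := by
  have h := tendsto_comap_distOne n hN
  obtain ⟨t, ht, hsub⟩ := mem_comap.1 h
  obtain ⟨κ, hκ, hball⟩ := Metric.mem_nhds_iff.1 ht
  refine ⟨κ, hκ, fun g hg => hsub (hball ?_)⟩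
  have h0 : 0 ≤ distOne n g := opN_nonneg _
  rwa [mem_ball_zero_iff, Real.norm_eq_abs, abs_of_nonneg h0]

theorem tendsto_error {C ε : ℝ} (hε : 0 < ε) {v : ℕ → ℝ} (hv : Tendsto v atTop atTop) :
    Tendsto (fun k => C * Real.exp (-(v k ^ ε))) atTop (𝓝 0) := by
  have h1 : Tendsto (fun k => Real.exp (-(v k ^ ε))) atTop (𝓝 0) :=
    Real.tendsto_exp_neg_atTop_nhds_zero.comp ((tendsto_rpow_atTop hε).comp hv)
  simpa using h1.const_mul C

theorem continuous_aMat_smul_const {n : ℕ} (x : X n) :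
    Continuous fun r : R0 n => aMat n r • x :=
  continuous_aMat_smul.comp (continuous_id.prodMk continuous_const)

theorem tendsto_inv_smul {n : ℕ} (y : X n) :
    Tendsto (fun q : SLR n × X n => q.1⁻¹ • q.2) (𝓝 (1, y)) (𝓝 y) := by
  have h1 : Continuous fun q : SLR n × X n => q.1⁻¹ • q.2 :=
    Continuous.smul (f := fun q : SLR n × X n => q.1⁻¹) (g := fun q => q.2)
      continuous_fst.inv continuous_snd
  have h2 := h1.tendsto (1, y)
  rwa [inv_one, one_smul] at h2

theorem exists_nhds_inv_smul_notMem {n : ℕ} {Q : Set (X n)} (hQ : IsClosed Q) {y : X n}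
    (hy : y ∉ Q) :
    ∃ κ > 0, ∃ U ∈ 𝓝 y, ∀ g : SLR n, distOne n g < κ → ∀ z ∈ U, g⁻¹ • z ∉ Q := by
  have hev : ∀ᶠ z in 𝓝 y, z ∉ Q := hQ.isOpen_compl.mem_nhds hy
  have hmem : ∀ᶠ q : SLR n × X n in 𝓝 1 ×ˢ 𝓝 y, q.1⁻¹ • q.2 ∉ Q := by
    rw [← nhds_prod_eq]
    exact (tendsto_inv_smul y).eventually hev
  obtain ⟨p, hp, q, hq, hpq⟩ := eventually_prod_iff.1 hmem
  obtain ⟨κ, hκ, hκN⟩ := exists_distOne_lt hp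
  exact ⟨κ, hκ, _, hq, fun g hg z hz => hpq (hκN g hg) hz⟩

theorem mem_image_closedBall {n : ℕ} (hn : 1 ≤ n) {g : SLR n} (hg : distOne n g ≤ 1) {r : R0 n}
    {δ : ℝ} (hδ : 0 < δ) (h : δ ≤ ell n (g • aMat n r • stdPoint n)) :
    r ∈ Metric.closedBall (0 : R0 n) (n * (-Real.log (δ / 2))) := by
  refine mem_closedBall_zero_iff.2 (norm_le_of_le_ell hn (half_pos hδ) ?_)
  have h2 := h.trans (ell_smul_le_distOne g _)
  have h4 := ell_nonneg (aMat n r • stdPoint n)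
  nlinarith

/-- Points of height at least δ are g a(r)ℤ^d with g near I, and r then ranges over a fixed ball.
The comparison is with the compact piece Q of Aℤ^d for that ball, so it need not be known that Aℤ^d
is closed. The δ/2 allows for g at most doubling `ell`. -/
theorem accumulates_of_near_std {n : ℕ} (hn : 1 ≤ n) {M : ℝ} (hM : 0 < M) {x : ℕ → X n}
    {ξ : ℕ → ℝ} {φ : ℕ → Fin (n + 1) → R0 n} (h : ∀ k, IsTightFamily n M (ξ k) (x k) (φ k))
    {ω : ℕ → ℝ} (hω : Tendsto ω atTop (𝓝 0))
    (hnear : ∀ k τ, ∃ g : SLR n, distOne n g ≤ ω k ∧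
      ∃ r, aMat n (wFam (φ k) τ) • x k = g • aMat n r • stdPoint n) :
    AccumulatesOnlyOnStd n x := by
  intro a ha y hy
  choose s hs using fun k => exists_aMat_of_mem_A (ha k)
  obtain ⟨δ, hδ, hev⟩ := eventually_le_ell y
  by_contra hyO
  obtain ⟨Q, hQdef⟩ : ∃ Q : Set (X n), Q = (fun r => aMat n r • stdPoint n) ''
    Metric.closedBall 0 (n * (-Real.log (δ / 2))) := ⟨_, rfl⟩
  have hQ : IsCompact Q := by
    rw [hQdef]
    exact (isCompact_closedBall _ _).image (continuous_aMat_smul_const _)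
  have hyQ : y ∉ Q := by
    rw [hQdef]
    rintro ⟨r, -, rfl⟩
    exact hyO (mem_orbitA_iff.2 ⟨r, rfl⟩)
  obtain ⟨κ, hκ, U, hU, hκU⟩ := exists_nhds_inv_smul_notMem hQ.isClosed hyQ
  have hlim := hω.const_mul (Real.exp (2 * ((n + 1) * n * Real.log (M / δ))))
  rw [mul_zero] at hlim
  have hsmall := hlim.eventually (gt_mem_nhds (lt_min hκ one_pos))
  have hfreq := mapClusterPt_iff_frequently.1 hy _ (inter_mem hU hev)
  obtain ⟨k, ⟨hkU, hkδ⟩, hk⟩ := (hfreq.and_eventually hsmall).exists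
  change δ ≤ ell n (a k • x k) at hkδ
  rw [hs k] at hkU hkδ
  obtain ⟨g, hg, r, hgr⟩ := (h k).near_std hn hM hδ (hnear k) hkδ
  have hg1 := hg.trans_lt hk
  apply hκU g (hg1.trans_le (min_le_left _ _)) _ hkU
  rw [hgr, inv_smul_smul, hQdef]
  rw [hgr] at hkδ
  exact ⟨r, mem_image_closedBall hn (hg1.trans_le (min_le_right _ _)).le hδ hkδ, rfl⟩

/-! ### Compact sets of shapes -/

theorem continuous_units_mul_const {E : Type*} [NormedAddCommGroup E] [NormedSpace ℝ E]
    (a : (E →L[ℝ] E)ˣ) : Continuous fun k : (E →L[ℝ] E)ˣ => k * a := continuous_mul_const a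

theorem continuous_units_norm_mul {E : Type*} [NormedAddCommGroup E] [NormedSpace ℝ E] :
    Continuous fun k : (E →L[ℝ] E)ˣ => ‖k.1‖ * ‖(k⁻¹).1‖ :=
  (Units.continuous_val.norm).mul (Units.continuous_val.comp continuous_inv).norm

theorem shape_mk_eq_iff {n : ℕ} {h h' : (R0 n →L[ℝ] R0 n)ˣ} :
    Shape.mk h = Shape.mk h' ↔ ∃ c : ℝ, 0 < c ∧
      (fun v => h'.1 v) '' (DeltaStar n : Set (R0 n)) =
        (fun v => c • h.1 v) '' (DeltaStar n : Set (R0 n)) :=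
  Quotient.eq (r := shapeSetoid n)

/-- The equivalence is preserved by left multiplication: if h ~ h', then k h'⁻¹ h ~ k for every k.
Right multiplication by h'⁻¹ h thus carries a neighbourhood of h' into U. -/
theorem isOpenMap_shape_mk (n : ℕ) : IsOpenMap (Shape.mk (n := n)) := by
  intro U hU
  change IsOpen (Quotient.mk (shapeSetoid n) '' U)
  rw [isOpen_coinduced, isOpen_iff_mem_nhds]
  rintro h' ⟨h, hh, hhh'⟩
  obtain ⟨c, hc, e⟩ := shape_mk_eq_iff.1 hhh'
  have hcont : Continuous fun k : (R0 n →L[ℝ] R0 n)ˣ => k * (h'⁻¹ * h) :=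
    continuous_units_mul_const _
  have hU' : IsOpen ((fun k : (R0 n →L[ℝ] R0 n)ˣ => k * (h'⁻¹ * h)) ⁻¹' U) := hU.preimage hcont
  have hmem : h' ∈ (fun k : (R0 n →L[ℝ] R0 n)ˣ => k * (h'⁻¹ * h)) ⁻¹' U := by
    rw [Set.mem_preimage, mul_inv_cancel_left]
    exact hh
  filter_upwards [hU'.mem_nhds hmem] with k hk
  refine ⟨_, hk, shape_mk_eq_iff.2 ⟨c, hc, ?_⟩⟩
  have e' := congrArg (fun S : Set (R0 n) => (fun v => (k * h'⁻¹).1 v) '' S) e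
  simp only [Set.image_image] at e'
  convert e' using 1
  · congr 1
    funext v
    have : (k * h'⁻¹).1 (h'.1 v) = (k * h'⁻¹ * h').1 v := rfl
    rw [this, inv_mul_cancel_right]
  · congr 1
    funext v
    have h1 : (k * (h'⁻¹ * h)).1 v = (k * h'⁻¹ * h).1 v := by rw [mul_assoc]
    rw [map_smul]
    exact congrArg (c • ·) h1

/-- The condition number is continuous on GL but not defined on shapes. Openness of the quotient map
gives a local bound for some representative, and compactness makes it uniform. -/
theorem exists_condition_bound {n : ℕ} {K : Set (Shape n)} (hK : IsCompact K) :
    ∃ κ : ℝ, ∀ q ∈ K, ∃ h : (R0 n →L[ℝ] R0 n)ˣ, Shape.mk h = q ∧ ‖h.1‖ * ‖(h⁻¹).1‖ ≤ κ := by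
  refine hK.induction_on (p := fun S => ∃ κ : ℝ, ∀ q ∈ S, ∃ h : (R0 n →L[ℝ] R0 n)ˣ,
    Shape.mk h = q ∧ ‖h.1‖ * ‖(h⁻¹).1‖ ≤ κ) ⟨0, by simp⟩ ?_ ?_ ?_
  · rintro s t hst ⟨κ, h⟩
    exact ⟨κ, fun q hq => h q (hst hq)⟩
  · rintro s t ⟨κ, h⟩ ⟨κ', h'⟩
    refine ⟨max κ κ', ?_⟩
    rintro q (hq | hq)
    · obtain ⟨k, hk, hb⟩ := h q hq
      exact ⟨k, hk, hb.trans (le_max_left _ _)⟩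
    · obtain ⟨k, hk, hb⟩ := h' q hq
      exact ⟨k, hk, hb.trans (le_max_right _ _)⟩
  · intro q _
    obtain ⟨h, rfl⟩ := Quotient.exists_rep q
    have hcont : Continuous fun k : (R0 n →L[ℝ] R0 n)ˣ => ‖k.1‖ * ‖(k⁻¹).1‖ :=
      continuous_units_norm_mul
    have hopen : IsOpen {k : (R0 n →L[ℝ] R0 n)ˣ | ‖k.1‖ * ‖(k⁻¹).1‖ < ‖h.1‖ * ‖(h⁻¹).1‖ + 1} :=
      isOpen_lt hcont continuous_const
    refine ⟨_, mem_nhdsWithin_of_mem_nhds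
      ((isOpenMap_shape_mk n _ hopen).mem_nhds ⟨h, by simp, rfl⟩), ‖h.1‖ * ‖(h⁻¹).1‖ + 1, ?_⟩
    rintro _ ⟨k, hk, rfl⟩
    exact ⟨k, rfl, le_of_lt hk⟩

theorem bStar_mem_DeltaStar {n : ℕ} (j : Fin (n + 1)) : bStar n j ∈ DeltaStar n :=
  Submodule.subset_span ⟨j, rfl⟩

theorem mem_intVecs_of_mem_DeltaStar {n : ℕ} {v : R0 n} (hv : v ∈ DeltaStar n) :
    v.1 ∈ intVecs n := by
  refine Submodule.span_induction (p := fun v _ => v.1 ∈ intVecs n) ?_ ?_ ?_ ?_ hv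
  · rintro _ ⟨j, rfl⟩
    refine ⟨fun i => if i = j then -(n : ℤ) else 1, ?_⟩
    funext i
    change ((if i = j then -(n : ℤ) else 1 : ℤ) : ℝ) = if i = j then -(n : ℝ) else 1
    split_ifs <;> simp
  · exact ⟨0, by funext i; simp⟩
  · intro v w _ _ hv hw
    exact intVecs_add_mem hv hw
  · rintro k v _ ⟨z, hz⟩
    refine ⟨k • z, ?_⟩
    have h1 : (k • v).1 = k • v.1 := rfl
    rw [h1, ← hz]
    funext i
    simp

theorem sum_smul_bStar {n : ℕ} (s : R0 n) :
    s = ∑ j, (-(s.1 j) / (n + 1)) • bStar n j := by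
  have hs : ∑ i, s.1 i = 0 := s.2
  have hn0 : (n : ℝ) + 1 ≠ 0 := by positivity
  apply Subtype.ext
  funext i
  rw [Submodule.coe_sum, Finset.sum_apply]
  have h1 : ∀ j, ((-(s.1 j) / (n + 1)) • bStar n j).1 i =
      -(s.1 j) / (n + 1) + if i = j then s.1 j else 0 := by
    intro j
    change -(s.1 j) / (n + 1) * (if i = j then -(n : ℝ) else 1) = _
    split_ifs
    · field_simp
      ring
    · ring
  rw [Finset.sum_congr rfl fun j _ => h1 j, Finset.sum_add_distrib, ← Finset.sum_div,
    Finset.sum_neg_distrib, hs]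
  simp

theorem norm_bStar_le {n : ℕ} (j : Fin (n + 1)) : ‖bStar n j‖ ≤ n + 1 := by
  change ‖fun i => if i = j then -(n : ℝ) else 1‖ ≤ _
  rw [pi_norm_le_iff_of_nonneg (by positivity)]
  intro i
  have hn0 : (0 : ℝ) ≤ n := by positivity
  split_ifs
  · rw [norm_neg, Real.norm_eq_abs, abs_of_nonneg hn0]
    linarith
  · rw [norm_one]
    linarith

/-- A lattice whose shape is in a fixed compact set is spanned by vectors of length comparable
to that of its shortest vectors. -/
theorem exists_span_of_hasShapeIn {n : ℕ} {K : Set (Shape n)} (hK : IsCompact K) :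
    ∃ κ : ℝ, ∀ L, HasShapeIn n K L → ∀ Λ : ℝ, (∃ t ∈ L, t ≠ 0 ∧ ‖t‖ ≤ Λ) →
      Submodule.span ℝ ((L : Set (R0 n)) ∩ Metric.closedBall 0 (κ * Λ)) = ⊤ := by
  obtain ⟨κ, hκ⟩ := exists_condition_bound hK
  refine ⟨κ * (n + 1), ?_⟩
  rintro L ⟨h', hL, hmk⟩ Λ ⟨t, htL, ht0, htΛ⟩
  obtain ⟨h, hhh', hb⟩ := hκ _ hmk
  obtain ⟨c, hc, e⟩ := shape_mk_eq_iff.1 hhh'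
  rw [hL] at e
  have hinv : ∀ v, (h⁻¹).1 (h.1 v) = v := by
    intro v
    have h1 : (h⁻¹).1 (h.1 v) = (h⁻¹ * h).1 v := rfl
    rw [h1, inv_mul_cancel]
    rfl
  have hinv' : ∀ v, h.1 ((h⁻¹).1 v) = v := by
    intro v
    have h1 : h.1 ((h⁻¹).1 v) = (h * h⁻¹).1 v := rfl
    rw [h1, mul_inv_cancel]
    rfl
  have hmem : ∀ v ∈ DeltaStar n, c • h.1 v ∈ L := by
    intro v hv
    have : c • h.1 v ∈ (L : Set (R0 n)) := by
      rw [e]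
      exact ⟨v, hv, rfl⟩
    exact this
  -- Nonzero elements of Δ_* are integer vectors, of norm at least 1. A vector of L of norm at most
  -- Λ therefore bounds the scale c.
  have hcle : c ≤ ‖(h⁻¹).1‖ * Λ := by
    have ht' : t ∈ (L : Set (R0 n)) := htL
    rw [e] at ht'
    obtain ⟨v, hv, rfl⟩ := ht'
    have hv0 : v.1 ≠ 0 := by
      intro h0
      have : v = 0 := Subtype.ext h0
      apply ht0
      simp [this]
    have h1 : (1 : ℝ) ≤ ‖v‖ := one_le_norm_of_mem_intVecs (mem_intVecs_of_mem_DeltaStar hv) hv0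
    have h2 : ‖v‖ ≤ ‖(h⁻¹).1‖ * ‖h.1 v‖ := by
      have h3 := (h⁻¹).1.le_opNorm (h.1 v)
      rwa [hinv] at h3
    have h4 : c * ‖h.1 v‖ ≤ Λ := by
      have h5 : ‖c • h.1 v‖ ≤ Λ := htΛ
      rwa [norm_smul, Real.norm_eq_abs, abs_of_pos hc] at h5
    calc c ≤ c * (‖(h⁻¹).1‖ * ‖h.1 v‖) := le_mul_of_one_le_right hc.le (h1.trans h2)
      _ = ‖(h⁻¹).1‖ * (c * ‖h.1 v‖) := by ring
      _ ≤ _ := mul_le_mul_of_nonneg_left h4 (norm_nonneg (h⁻¹).1)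
  have hΛ : 0 ≤ Λ := (norm_nonneg _).trans htΛ
  refine top_unique fun u _ => ?_
  have hu : u = ∑ j, (-(((c⁻¹ • (h⁻¹).1 u : R0 n)).1 j) / (n + 1)) • (c • h.1 (bStar n j)) := by
    have h1 := congrArg (fun v => c • h.1 v) (sum_smul_bStar (c⁻¹ • (h⁻¹).1 u))
    simp only [map_smul, map_sum, hinv', smul_smul, mul_inv_cancel₀ hc.ne', one_smul,
      Finset.smul_sum] at h1
    refine h1.trans (Finset.sum_congr rfl fun j _ => ?_)
    rw [smul_smul, mul_comm]
  rw [hu]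
  refine Submodule.sum_mem _ fun j _ => Submodule.smul_mem _ _ (Submodule.subset_span ⟨hmem _
    (bStar_mem_DeltaStar j), mem_closedBall_zero_iff.2 ?_⟩)
  rw [norm_smul, Real.norm_eq_abs, abs_of_pos hc]
  calc c * ‖h.1 (bStar n j)‖ ≤ (‖(h⁻¹).1‖ * Λ) * (‖h.1‖ * (n + 1)) := by
        refine mul_le_mul hcle ((h.1.le_opNorm _).trans ?_) (norm_nonneg _) (by positivity)
        exact mul_le_mul_of_nonneg_left (norm_bStar_le j) (norm_nonneg _)
    _ = (‖h.1‖ * ‖(h⁻¹).1‖) * ((n + 1) * Λ) := by ring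
    _ ≤ κ * ((n + 1) * Λ) := mul_le_mul_of_nonneg_right hb (by positivity)
    _ = _ := by ring

/-! ### Generation of `Δ_x` -/

/-- If every dilate `m • t` of an element of `D` is within `B` of a sublattice `L` without short
vectors, then `m • D ⊆ L`. -/
theorem dilate_mem {n : ℕ} {L D : Submodule ℤ (R0 n)} (hLD : L ≤ D) {m B : ℝ} (hm : 0 < m)
    (hmD : ∀ t ∈ D, m • t ∈ D) (happ : ∀ t ∈ D, ∃ u ∈ L, ‖m • t - u‖ ≤ B)
    (hshort : ∀ u ∈ L, u ≠ 0 → (m + 2) * B < ‖u‖) {t : R0 n} (ht : t ∈ D) : m • t ∈ L := by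
  obtain ⟨u, hu, hB⟩ := happ t ht
  have heD : m • t - u ∈ D := D.sub_mem (hmD t ht) (hLD hu)
  suffices he : m • t - u = 0 by rwa [sub_eq_zero.1 he]
  generalize m • t - u = e at hB heD
  have hB0 : 0 ≤ B := (norm_nonneg _).trans hB
  -- If m j e has norm at most B, then m(j+1)e has norm at most (m+1)B, and its approximant v in L
  -- at most (m+2)B. So v = 0 and the bound B is recovered. Bounded multiples force e = 0.
  have hind : ∀ j : ℕ, ‖m • ((j : ℝ) • e)‖ ≤ B := by
    intro j
    induction j with
    | zero => simpa using hB0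
    | succ j ih =>
      have hje : ((j + 1 : ℕ) : ℝ) • e ∈ D := by
        rw [Nat.cast_smul_eq_nsmul]
        exact D.nsmul_mem heD _
      obtain ⟨v, hv, hvB⟩ := happ _ hje
      have hsplit : m • (((j + 1 : ℕ) : ℝ) • e) = m • ((j : ℝ) • e) + m • e := by
        rw [Nat.cast_add, Nat.cast_one, add_smul, one_smul, smul_add]
      have hme : ‖m • e‖ ≤ m * B := by
        rw [norm_smul, Real.norm_eq_abs, abs_of_pos hm]
        gcongr
      have hvn : ‖v‖ ≤ (m + 2) * B := by
        have h1 := norm_sub_le (m • (((j + 1 : ℕ) : ℝ) • e))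
          (m • (((j + 1 : ℕ) : ℝ) • e) - v)
        rw [sub_sub_cancel] at h1
        have h2 := norm_add_le (m • ((j : ℝ) • e)) (m • e)
        rw [← hsplit] at h2
        linarith
      have hv0 : v = 0 := by
        by_contra hv0
        exact absurd (hshort v hv hv0) (not_lt.2 hvn)
      rwa [hv0, sub_zero] at hvB
  by_contra he
  obtain ⟨j, hj⟩ := exists_nat_gt (B / (m * ‖e‖))
  have hpos : 0 < m * ‖e‖ := mul_pos hm (norm_pos_iff.2 he)
  rw [div_lt_iff₀ hpos] at hj
  have h1 := hind j
  rw [norm_smul, norm_smul, Real.norm_eq_abs, Real.norm_eq_abs, abs_of_pos hm,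
    abs_of_nonneg (Nat.cast_nonneg j)] at h1
  linarith

theorem succ_smul_mem {n : ℕ} (L : Submodule ℤ (R0 n)) {t : R0 n} (ht : t ∈ L) :
    ((n : ℝ) + 1) • t ∈ L := by
  have h := L.nsmul_mem ht (n + 1)
  rwa [← Nat.cast_smul_eq_nsmul ℝ, Nat.cast_add, Nat.cast_one] at h

/-- The times s and s + t have equal height, so both can be located. In n+1 times their difference
the points w_τ become lattice vectors, and only (n+1)(b' - b) remains for `dilate_mem` with m = n+1.
The time s need not come from the family φ. -/
theorem IsTightFamily.succ_smul_mem_latSpan {n : ℕ} (hn : 1 ≤ n) {M ξ δ : ℝ} {x : X n}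
    {φ : Fin (n + 1) → R0 n} (h : IsTightFamily n M ξ x φ) (hM : 0 < M) (hδ : 0 < δ) {s : R0 n}
    (hs : δ ≤ ell n (aMat n s • x))
    (hshort : ∀ u ∈ latSpan φ, u ≠ 0 →
      ((n : ℝ) + 1 + 2) * ((n + 1) * (2 * ((n + 1) * n * Real.log (M / δ)))) < ‖u‖)
    {t : R0 n} (ht : t ∈ Delta n x) : ((n : ℝ) + 1) • t ∈ latSpan φ := by
  refine dilate_mem h.latSpan_le (by positivity) (fun t ht => succ_smul_mem _ ht) ?_ hshort ht
  intro t ht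
  obtain ⟨τ, b, u, hu, hb, e⟩ := h.location hn hM hδ hs
  rw [← ell_aMat_add_smul ht] at hs
  obtain ⟨τ', b', u', hu', hb', e'⟩ := h.location hn hM hδ hs
  refine ⟨((n : ℝ) + 1) • wFam φ τ' - ((n : ℝ) + 1) • wFam φ τ +
    (((n : ℝ) + 1) • u' - ((n : ℝ) + 1) • u), ?_, ?_⟩
  · exact add_mem (sub_mem (smul_wFam_mem _ _) (smul_wFam_mem _ _))
      (sub_mem (succ_smul_mem _ hu') (succ_smul_mem _ hu))
  · have ht' : t = wFam φ τ' + b' + u' - (wFam φ τ + b + u) := by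
      rw [← e', ← e, add_sub_cancel_left]
    have e2 : ((n : ℝ) + 1) • t - (((n : ℝ) + 1) • wFam φ τ' - ((n : ℝ) + 1) • wFam φ τ +
        (((n : ℝ) + 1) • u' - ((n : ℝ) + 1) • u)) = ((n : ℝ) + 1) • (b' - b) := by
      rw [ht']
      module
    rw [e2, norm_smul, Real.norm_eq_abs, abs_of_pos (by positivity : (0 : ℝ) < n + 1)]
    have := norm_sub_le b' b
    gcongr
    linarith

/-- The time w_τ + t is as high as w_τ, so it equals w_τ' + b + u. Here (n+1)b is an element of Δ_x
too short to be nonzero. Hence b = 0 and t permutes the classes of the w_τ. -/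
theorem IsTightFamily.latSpan_eq_Delta {n : ℕ} (hn : 1 ≤ n) {M ξ δ : ℝ} {x : X n}
    {φ : Fin (n + 1) → R0 n} (h : IsTightFamily n M ξ x φ) (hM : 0 < M) (hδ : 0 < δ)
    (hτ : ∀ τ, δ ≤ ell n (aMat n (wFam φ τ) • x))
    (hshort : ∀ t ∈ Delta n x, t ≠ 0 →
      ((n : ℝ) + 1) * ((n + 1) * n * Real.log (M / δ)) < ‖t‖) : latSpan φ = Delta n x := by
  refine le_antisymm h.latSpan_le fun t ht => h.mem_of_permutes fun τ => ?_
  have hs := hτ τ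
  rw [← ell_aMat_add_smul ht] at hs
  obtain ⟨τ', b, u, hu, hb, e⟩ := h.location hn hM hδ hs
  have hpos : (0 : ℝ) < n + 1 := by positivity
  have hb0 : b = 0 := by
    by_contra hb0
    have hmem : ((n : ℝ) + 1) • b ∈ Delta n x := by
      have e2 : ((n : ℝ) + 1) • b = ((n : ℝ) + 1) • wFam φ τ - ((n : ℝ) + 1) • wFam φ τ' +
          (((n : ℝ) + 1) • t - ((n : ℝ) + 1) • u) := by
        have e3 : b = wFam φ τ + t - wFam φ τ' - u := by
          rw [e]
          module
        rw [e3]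
        module
      rw [e2]
      exact add_mem (sub_mem (h.latSpan_le (smul_wFam_mem _ _)) (h.latSpan_le (smul_wFam_mem _ _)))
        (sub_mem (succ_smul_mem _ ht) (succ_smul_mem _ (h.latSpan_le hu)))
    have hlt := hshort _ hmem (smul_ne_zero hpos.ne' hb0)
    rw [norm_smul, Real.norm_eq_abs, abs_of_pos hpos, mul_lt_mul_iff_right₀ hpos] at hlt
    linarith
  refine ⟨τ', ?_⟩
  rw [e, hb0, add_zero, add_sub_cancel_left]
  exact hu

/-! ### Connected components -/

/-- The complement of each trace on S is a finite union of closed traces, so every trace is clopen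
and separates components. -/
theorem injective_connectedComponents {Y ι κ : Type*} [TopologicalSpace Y] [Finite κ] {S : Set Y}
    {E : κ → Set Y} (hE : ∀ i, IsClosed (E i)) (hS : S ⊆ ⋃ i, E i)
    (hdisj : ∀ i j, E i = E j ∨ Disjoint (E i) (E j)) {f : ι → κ}
    (hf : ∀ c c', E (f c) = E (f c') → c = c') (y : ι → S) (hy : ∀ c, (y c : Y) ∈ E (f c)) :
    Function.Injective fun c => (y c : ConnectedComponents S) := by
  intro c c' hcc'
  have hcc : connectedComponent (y c) = connectedComponent (y c') :=
    ConnectedComponents.coe_eq_coe.1 hcc'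
  have hcompl : (Subtype.val ⁻¹' E (f c) : Set S)ᶜ =
      Subtype.val ⁻¹' ⋃ i ∈ {i | Disjoint (E (f c)) (E i)}, E i := by
    ext ⟨z, hz⟩
    simp only [Set.mem_compl_iff, Set.mem_preimage, Set.mem_iUnion]
    constructor
    · intro hzE
      obtain ⟨i, hi⟩ := Set.mem_iUnion.1 (hS hz)
      refine ⟨i, (hdisj (f c) i).resolve_left fun he => hzE (he ▸ hi), hi⟩
    · rintro ⟨i, hi, hzi⟩ hzE
      exact Set.disjoint_left.1 hi hzE hzi
  have hclopen : IsClopen (Subtype.val ⁻¹' E (f c) : Set S) := by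
    refine ⟨(hE _).preimage continuous_subtype_val, ?_⟩
    rw [← isClosed_compl_iff, hcompl]
    exact (Set.Finite.isClosed_biUnion (Set.toFinite _) fun i _ => hE i).preimage
      continuous_subtype_val
  have hmem : y c' ∈ (Subtype.val ⁻¹' E (f c) : Set S) :=
    hclopen.connectedComponent_subset (hy c) (hcc ▸ mem_connectedComponent)
  exact hf c c' ((hdisj _ _).resolve_right fun hd => Set.disjoint_left.1 hd hmem (hy c'))

/-- The part of the orbit at times within `D` of `w_τ + Δ_x`. -/
def orbitNear {n : ℕ} (φ : Fin (n + 1) → R0 n) (x : X n) (D : ℝ)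
    (τ : Equiv.Perm (Fin (n + 1))) : Set (X n) :=
  {y | ∃ b u, ‖b‖ ≤ D ∧ u ∈ latSpan φ ∧ y = aMat n (wFam φ τ + b + u) • x}

/-- Since 2Δ_Φ fixes x, the coefficients of u matter only modulo 2. This leaves a finite union of
compact images of a ball. -/
theorem isClosed_orbitNear {n : ℕ} {φ : Fin (n + 1) → R0 n} {x : X n} (h : latSpan φ ≤ Delta n x)
    (D : ℝ) (τ : Equiv.Perm (Fin (n + 1))) : IsClosed (orbitNear φ x D τ) := by
  have hcont : ∀ e : R0 n, Continuous fun b : R0 n => aMat n (wFam φ τ + b + e) • x := fun e =>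
    (continuous_aMat_smul_const x).comp ((continuous_const.add continuous_id).add continuous_const)
  have hcpt : IsCompact (⋃ ε : Fin (n + 1) → Fin 2,
      (fun b : R0 n => aMat n (wFam φ τ + b + ∑ i, ((ε i : ℕ) : ℝ) • φ i) • x) ''
        Metric.closedBall 0 D) :=
    isCompact_iUnion fun ε => (isCompact_closedBall _ _).image (hcont _)
  convert hcpt.isClosed using 1
  ext y
  simp only [Set.mem_iUnion]
  constructor
  · rintro ⟨b, u, hb, hu, rfl⟩
    obtain ⟨k, rfl⟩ := mem_latSpan_iff.1 hu
    have hk : ∀ i, ∃ ε : Fin 2, ∃ q : ℤ, (k i : ℝ) = (ε : ℕ) + (q + q) := by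
      intro i
      rcases Int.even_or_odd (k i) with ⟨q, hq⟩ | ⟨q, hq⟩
      · exact ⟨0, q, by rw [hq]; push_cast; simp⟩
      · exact ⟨1, q, by rw [hq]; push_cast; simp; ring⟩
    choose ε q hεq using hk
    refine ⟨ε, b, mem_closedBall_zero_iff.2 hb, ?_⟩
    have hq : ∑ i, (q i : ℝ) • φ i ∈ Delta n x := h (mem_latSpan_iff.2 ⟨q, rfl⟩)
    have e : ∑ i, (k i : ℝ) • φ i = ∑ i, ((ε i : ℕ) : ℝ) • φ i +
        (∑ i, (q i : ℝ) • φ i + ∑ i, (q i : ℝ) • φ i) := by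
      rw [← Finset.sum_add_distrib, ← Finset.sum_add_distrib]
      refine Finset.sum_congr rfl fun i _ => ?_
      rw [hεq, add_smul, add_smul]
    change aMat n _ • x = _
    rw [e, ← add_assoc (wFam φ τ + b), aMat_add_smul _ (_ + _), two_smul_mem_stabilizer hq]
  · rintro ⟨ε, b, hb, rfl⟩
    refine ⟨b, _, mem_closedBall_zero_iff.1 hb, mem_latSpan_iff.2 ⟨fun i => ((ε i : ℕ) : ℤ), ?_⟩,
      rfl⟩
    simp

theorem orbitNear_subset {n : ℕ} {φ : Fin (n + 1) → R0 n} {x : X n} {D : ℝ}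
    {τ τ' : Equiv.Perm (Fin (n + 1))} (h : wFam φ τ - wFam φ τ' ∈ latSpan φ) :
    orbitNear φ x D τ ⊆ orbitNear φ x D τ' := by
  rintro _ ⟨b, u, hb, hu, rfl⟩
  refine ⟨b, _, hb, add_mem h hu, ?_⟩
  congr 2
  abel

theorem sub_mem_of_not_disjoint {n : ℕ} {φ : Fin (n + 1) → R0 n} {x : X n} {D : ℝ}
    (h : latSpan φ = Delta n x)
    (hshort : ∀ t ∈ Delta n x, t ≠ 0 → ((n : ℝ) + 1) * (2 * D) < ‖t‖)
    {τ τ' : Equiv.Perm (Fin (n + 1))}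
    (hd : ¬ Disjoint (orbitNear φ x D τ) (orbitNear φ x D τ')) :
    wFam φ τ - wFam φ τ' ∈ latSpan φ := by
  obtain ⟨y, ⟨b, u, hb, hu, hy⟩, ⟨b', u', hb', hu', hy'⟩⟩ := Set.not_disjoint_iff.1 hd
  have hstab : aMat n (-(wFam φ τ' + b' + u') + (wFam φ τ + b + u)) • x = x := by
    rw [aMat_add_smul, ← hy, hy', ← aMat_add_smul, neg_add_cancel, aMat_zero, one_smul]
  have hv := mem_Delta_of_smul_eq hstab
  rw [← h] at hv hshort
  have hpos : (0 : ℝ) < n + 1 := by positivity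
  have hbb : b - b' = 0 := by
    by_contra hne
    have hmem : ((n : ℝ) + 1) • (b - b') ∈ latSpan φ := by
      have e : ((n : ℝ) + 1) • (b - b') =
          ((n : ℝ) + 1) • (-(wFam φ τ' + b' + u') + (wFam φ τ + b + u)) +
          (((n : ℝ) + 1) • wFam φ τ' - ((n : ℝ) + 1) • wFam φ τ) +
          (((n : ℝ) + 1) • u' - ((n : ℝ) + 1) • u) := by module
      rw [e]
      exact add_mem (add_mem (succ_smul_mem _ hv)
        (sub_mem (smul_wFam_mem _ _) (smul_wFam_mem _ _)))
        (sub_mem (succ_smul_mem _ hu') (succ_smul_mem _ hu))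
    have hlt := hshort _ hmem (smul_ne_zero hpos.ne' hne)
    rw [norm_smul, Real.norm_eq_abs, abs_of_pos hpos, mul_lt_mul_iff_right₀ hpos] at hlt
    have := norm_sub_le b b'
    linarith
  have e : wFam φ τ - wFam φ τ' =
      (-(wFam φ τ' + b' + u') + (wFam φ τ + b + u)) + (u' - u) - (b - b') := by abel
  rw [e, hbb, sub_zero]
  exact add_mem hv (sub_mem hu' hu)

theorem orbitNear_eq_or_disjoint {n : ℕ} {φ : Fin (n + 1) → R0 n} {x : X n} {D : ℝ}
    (h : latSpan φ = Delta n x)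
    (hshort : ∀ t ∈ Delta n x, t ≠ 0 → ((n : ℝ) + 1) * (2 * D) < ‖t‖)
    (τ τ' : Equiv.Perm (Fin (n + 1))) :
    orbitNear φ x D τ = orbitNear φ x D τ' ∨
      Disjoint (orbitNear φ x D τ) (orbitNear φ x D τ') := by
  by_contra! hd
  have h1 := sub_mem_of_not_disjoint h hshort hd.2
  have h2 : wFam φ τ' - wFam φ τ ∈ latSpan φ := by
    rw [← neg_sub]
    exact neg_mem h1
  exact hd.1 ((orbitNear_subset h1).antisymm (orbitNear_subset h2))

theorem factorial_le_card_components {n : ℕ} {φ : Fin (n + 1) → R0 n} {x : X n} {D δ : ℝ}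
    (hφ : IsSimplexFamily n φ) (h : latSpan φ = Delta n x)
    (hshort : ∀ t ∈ Delta n x, t ≠ 0 → ((n : ℝ) + 1) * (2 * D) < ‖t‖)
    (hcov : orbitA n x ∩ Xge n δ ⊆ ⋃ τ, orbitNear φ x D τ)
    (hpt : ∀ τ, ∃ y ∈ orbitA n x ∩ Xge n δ, y ∈ orbitNear φ x D τ) :
    (n.factorial : ℕ∞) ≤ ENat.card (ConnectedComponents ↥(orbitA n x ∩ Xge n δ)) := by
  choose y hyS hyE using hpt
  have hinj := injective_connectedComponents (E := orbitNear φ x D)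
    (fun τ => isClosed_orbitNear h.le D τ) hcov (orbitNear_eq_or_disjoint h hshort)
    -- A cyclic relabelling of positions does not change w_τ modulo the lattice. Permutations with τ
    -- 0 = 0 represent the classes, and `decomposeFin` enumerates these by `Perm (Fin n)`.
    (f := fun c : Equiv.Perm (Fin n) => Equiv.Perm.decomposeFin.symm (0, c)) (by
      intro c c' he
      have hne : ¬ Disjoint (orbitNear φ x D (Equiv.Perm.decomposeFin.symm (0, c)))
          (orbitNear φ x D (Equiv.Perm.decomposeFin.symm (0, c'))) := by
        rw [Set.not_disjoint_iff]
        exact ⟨_, hyE _, he ▸ hyE _⟩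
      have h1 := hφ.perm_eq (Equiv.Perm.decomposeFin_symm_apply_zero 0 c)
        (Equiv.Perm.decomposeFin_symm_apply_zero 0 c') (sub_mem_of_not_disjoint h hshort hne)
      have h2 := Equiv.Perm.decomposeFin.symm.injective h1
      exact congrArg Prod.snd h2)
    (fun c => ⟨y (Equiv.Perm.decomposeFin.symm (0, c)), hyS _⟩) (fun c => hyE _)
  have hcard := ENat.card_le_card_of_injective hinj
  rwa [ENat.card_eq_coe_fintype_card, Fintype.card_perm, Fintype.card_fin] at hcard

/-! ### Orbits that return close to the standard lattice at bounded times -/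

/-- Moving back by s replaces the point by a(-s) g a(s)ℤ^d, a small perturbation of ℤ^d, whose
nonzero vectors have length at least 1. -/
theorem le_ell_of_conj {n : ℕ} {x : X n} {w s : R0 n} {g : SLR n} {R δ : ℝ} (hδ : 0 ≤ δ)
    (hs : ‖s‖ ≤ R) (hg : Real.exp (2 * R) * distOne n g ≤ 1 - δ)
    (h : aMat n w • x = g • aMat n s • stdPoint n) : δ ≤ ell n (aMat n (w + -s) • x) := by
  have h0 : 0 ≤ distOne n g := opN_nonneg _
  have h1 : aMat n (w + -s) • x = (aMat n (-s) * g * aMat n (- -s)) • stdPoint n := by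
    rw [add_comm w, aMat_add_smul, h, aMat_smul_smul, ← aMat_add_smul, neg_add_cancel, aMat_zero,
      one_smul]
  have h2 := distOne_conj_aMat_le (-s) g
  rw [norm_neg] at h2
  have h3 : Real.exp (2 * ‖s‖) * distOne n g ≤ Real.exp (2 * R) * distOne n g := by gcongr
  have h4 := (h2.trans h3).trans hg
  rw [h1]
  have h5 := sub_distOne_mul_ell_le _ (h4.trans (by linarith)) (stdPoint n)
  have h6 := one_le_ell_stdPoint n
  nlinarith

/-- The family φ returns near ℤ^d, while φ' controls short vectors. The height of a(w_τ)x itself is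
only known to be e^{-R}δ, hence the argument of the logarithm. With B the location bound, the
constant dominates (m+2)(n+1)2B for m = n+1. Divided by n+1, it also excludes vectors of Δ_x of norm
at most (n+1)2(R+B), as the separation of the sets `orbitNear` of radius R + B requires. -/
theorem IsTightFamily.generates_and_components {n : ℕ} (hn : 1 ≤ n) {M ξ ξ' R δ : ℝ} {x : X n}
    {φ φ' : Fin (n + 1) → R0 n} (h : IsTightFamily n M ξ x φ) (h' : IsTightFamily n M ξ' x φ')
    (hM : 0 < M) (hδ : 0 < δ) (hR : 0 ≤ R)
    (hnear : ∀ τ, ∃ g : SLR n, Real.exp (2 * R) * distOne n g ≤ 1 - δ ∧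
      ∃ s, ‖s‖ ≤ R ∧ aMat n (wFam φ τ) • x = g • aMat n s • stdPoint n)
    (hshort : ∀ u ∈ latSpan φ', u ≠ 0 → 2 * ((n : ℝ) + 1) * (n + 3) *
      (R + (n + 1) * n * Real.log (M / (Real.exp (-R) * δ))) < ‖u‖) :
    latSpan φ = Delta n x ∧
      (n.factorial : ℕ∞) ≤ ENat.card (ConnectedComponents ↥(orbitA n x ∩ Xge n δ)) := by
  have hpt : ∀ τ, ∃ s, ‖s‖ ≤ R ∧ δ ≤ ell n (aMat n (wFam φ τ + -s) • x) := by
    intro τ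
    obtain ⟨g, hg, s, hs, e⟩ := hnear τ
    exact ⟨s, hs, le_ell_of_conj hδ.le hs hg e⟩
  have hδ0 : 0 < Real.exp (-R) * δ := mul_pos (Real.exp_pos _) hδ
  have hτ : ∀ τ, Real.exp (-R) * δ ≤ ell n (aMat n (wFam φ τ) • x) := by
    intro τ
    obtain ⟨s, hs, hsδ⟩ := hpt τ
    have h1 := exp_neg_norm_mul_ell_le s (aMat n (wFam φ τ + -s) • x)
    rw [← aMat_add_smul, add_comm s, neg_add_cancel_right] at h1
    refine le_trans ?_ h1
    gcongr
  have hδle : Real.exp (-R) * δ ≤ δ :=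
    mul_le_of_le_one_left hδ.le (Real.exp_le_one_iff.2 (by linarith))
  have hn0 : (0 : ℝ) ≤ n := Nat.cast_nonneg n
  obtain ⟨B, hB⟩ : ∃ B : ℝ, B = (n + 1) * n * Real.log (M / (Real.exp (-R) * δ)) := ⟨_, rfl⟩
  have hB0 : 0 ≤ B := by
    obtain ⟨τ, b, u, hu, hb, e⟩ := h.location hn hM hδ0 (hτ 1)
    rw [hB]
    exact (norm_nonneg b).trans hb
  rw [← hB] at hshort
  have hΔ : ∀ t ∈ Delta n x, t ≠ 0 → ((n : ℝ) + 1) * (2 * (R + B)) < ‖t‖ := by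
    intro t ht ht0
    have hpos : (0 : ℝ) < n + 1 := by positivity
    have h1 := h'.succ_smul_mem_latSpan hn hM hδ0 (hτ 1) (fun u hu hu0 => ?_) ht
    · have h2 := hshort _ h1 (smul_ne_zero hpos.ne' ht0)
      rw [norm_smul, Real.norm_eq_abs, abs_of_pos hpos] at h2
      rw [← mul_lt_mul_iff_right₀ hpos]
      refine lt_of_le_of_lt ?_ h2
      nlinarith [mul_nonneg hpos.le (add_nonneg hR hB0)]
    · rw [← hB]
      refine lt_of_le_of_lt ?_ (hshort u hu hu0)
      have h3 : 0 ≤ 2 * ((n : ℝ) + 1) * (n + 3) * R := by positivity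
      linarith
  have hgen : latSpan φ = Delta n x := by
    refine h.latSpan_eq_Delta hn hM hδ0 hτ fun t ht ht0 => ?_
    rw [← hB]
    refine lt_of_le_of_lt ?_ (hΔ t ht ht0)
    gcongr
    linarith
  refine ⟨hgen, factorial_le_card_components h.toIsSimplexFamily hgen hΔ ?_ ?_⟩
  · rintro y ⟨hyO, hyδ⟩
    obtain ⟨s, rfl⟩ := mem_orbitA_iff.1 hyO
    have hyδ' : δ ≤ ell n (aMat n s • x) := hyδ
    obtain ⟨τ, b, u, hu, hb, rfl⟩ := h.location hn hM hδ0 (hδle.trans hyδ')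
    rw [← hB] at hb
    exact Set.mem_iUnion.2 ⟨τ, b, u, hb.trans (by linarith), hu, rfl⟩
  · intro τ
    obtain ⟨s, hs, hsδ⟩ := hpt τ
    refine ⟨_, ⟨mem_orbitA_iff.2 ⟨_, rfl⟩, show δ ≤ ell n _ from hsδ⟩, -s, 0, ?_, zero_mem _, ?_⟩
    · rw [norm_neg]
      linarith
    · rw [add_zero]

/-- Lattices `Δ_Φ ⊆ Δ_{x_k}` with shapes in a compact set have no short vectors when the orbits
are distinct. -/
theorem eventually_lt_norm {n : ℕ} {K : Set (Shape n)} (hK : IsCompact K) {x : ℕ → X n}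
    (hx : Function.Injective fun k => orbitA n (x k)) {L : ℕ → Submodule ℤ (R0 n)}
    (hL : ∀ k, L k ≤ Delta n (x k)) (hLK : ∀ k, HasShapeIn n K (L k)) (Λ : ℝ) :
    ∀ᶠ k in atTop, ∀ u ∈ L k, u ≠ 0 → Λ < ‖u‖ := by
  obtain ⟨κ, hκ⟩ := exists_span_of_hasShapeIn hK
  filter_upwards [eventually_not_of_finite hx (finite_orbits_of_span_bounded n (κ * Λ))]
    with k hk u hu hu0
  by_contra! hle
  apply hk
  rw [eq_top_iff, ← hκ (L k) (hLK k) Λ ⟨u, hu, hu0, hle⟩]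
  exact Submodule.span_mono (Set.inter_subset_inter_left _ (hL k))

end EscapeOfMass

end

/-! ### Assembly of the three assertions. -/

theorem mainTheorem8 (n : ℕ) (hn : 1 ≤ n) (M C ε : ℝ) (hM : 1 ≤ M) (hC : 1 ≤ C) (hε : 0 < ε)
    (K : Set (EscapeOfMass.Shape n)) (hK : IsCompact K) :
    (∀ x : ℕ → EscapeOfMass.X n,
      Function.Injective (fun k => EscapeOfMass.orbitA n (x k)) →
      (∀ k, x k ∈ EscapeOfMass.OmegaM n M) →
      EscapeOfMass.FullEscape n x) ∧
    (∀ x : ℕ → EscapeOfMass.X n,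
      Function.Injective (fun k => EscapeOfMass.orbitA n (x k)) →
      (∀ k, x k ∈ EscapeOfMass.OmegaMEps n M ε C) →
      EscapeOfMass.AccumulatesOnlyOnStd n x) ∧
    (∀ x : ℕ → EscapeOfMass.X n,
      Function.Injective (fun k => EscapeOfMass.orbitA n (x k)) →
      (∀ k, x k ∈ EscapeOfMass.OmegaMEps n M ε C ∩ EscapeOfMass.OmegaMK n M K) →
      ∀ (Φ : ℕ → Finset (EscapeOfMass.R0 n))
        (h : ℕ → (EscapeOfMass.R0 n ≃ₗ[ℝ] EscapeOfMass.R0 n))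
        (s : ℕ → Equiv.Perm (Fin (n + 1)) → EscapeOfMass.R0 n),
      (∀ k, EscapeOfMass.IsTight n M (x k) (Φ k)) →
      (∀ k, EscapeOfMass.IsDistortionMap n (Φ k) (h k)) →
      (∀ k, EscapeOfMass.NearStdAt n ε C (x k) (Φ k) (h k) (s k)) →
      (∃ R : ℝ, ∀ k τ, ‖s k τ‖ ≤ R) →
      ∀ δ₁ : ℝ, 0 < δ₁ → δ₁ < 1 →
      ∀ᶠ k in atTop,
        EscapeOfMass.DeltaPhi n (Φ k) = EscapeOfMass.Delta n (x k) ∧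
        (n.factorial : ℕ∞) ≤
          ENat.card (ConnectedComponents
            ↥(EscapeOfMass.orbitA n (x k) ∩ EscapeOfMass.Xge n δ₁))) := by
  have hM0 : 0 < M := one_pos.trans_le hM
  refine ⟨fun x hx hxM => ?_, fun x hx hxM => ?_, ?_⟩
  · choose hΩ Φ hΦ using hxM
    choose φ hφ using fun k => (hΦ k).exists_range_eq
    exact EscapeOfMass.fullEscape_of_tight hn hM0 hx hΩ fun k => (hΦ k).family hn (hφ k)
  · choose _ Φ hΦ h hh s hs using hxM
    choose φ hφ hw using fun k => (hh k).exists_range_eq hn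
    have hfam := fun k => (hΦ k).family hn (hφ k)
    refine EscapeOfMass.accumulates_of_near_std hn hM0 hfam (EscapeOfMass.tendsto_error (C := C) hε
      (EscapeOfMass.tendsto_covol hx fun k => (hfam k).span_Delta)) fun k τ => ?_
    obtain ⟨g, hg, e⟩ := hs k τ
    rw [hw] at e
    exact ⟨g, hg, _, e⟩
  · intro x hx hxM Φ h s hΦ hh hs hR δ₁ hδ hδ1
    obtain ⟨R, hR⟩ := hR
    choose φ hφ hw using fun k => (hh k).exists_range_eq hn
    have hfam := fun k => (hΦ k).family hn (hφ k)
    -- The tight simplex set with shape in K may differ from the given Φ k, so two families are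
    -- carried along.
    choose _ Φ' hΦ' hK' using fun k => (hxM k).2
    choose φ' hφ' using fun k => (hΦ' k).exists_range_eq
    have hfam' := fun k => (hΦ' k).family hn (hφ' k)
    have hR0 : 0 ≤ R := (norm_nonneg _).trans (hR 0 1)
    have hlim := (EscapeOfMass.tendsto_error (C := C) hε
      (EscapeOfMass.tendsto_covol hx fun k => (hfam k).span_Delta)).const_mul (Real.exp (2 * R))
    rw [mul_zero] at hlim
    have hshort := EscapeOfMass.eventually_lt_norm hK hx (fun k => (hfam' k).latSpan_le)
      (fun k => by rw [EscapeOfMass.latSpan_eq_DeltaPhi (hφ' k)]; exact hK' k)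
      (2 * ((n : ℝ) + 1) * (n + 3) *
        (R + (n + 1) * n * Real.log (M / (Real.exp (-R) * δ₁))))
    filter_upwards [hshort, hlim.eventually (gt_mem_nhds (sub_pos.2 hδ1))] with k hk hωk
    rw [← EscapeOfMass.latSpan_eq_DeltaPhi (hφ k)]
    refine (hfam k).generates_and_components hn (hfam' k) hM0 hδ hR0 (fun τ => ?_) hk
    obtain ⟨g, hg, e⟩ := hs k τ
    rw [hw] at e
    exact ⟨g, le_trans (mul_le_mul_of_nonneg_left hg (Real.exp_pos _).le) hωk.le, _, hR k τ, e⟩
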